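/- Let $A\in\mathbb C^{m\times m}$, $B\in\mathbb C^{n\times n}$, $c_A\in\mathbb C^m$, $c_B\in\mathbb C^n$, and let $W(M)=\{v^*Mv:\|v\|_2=1\}$ denote the numerical range of a square matrix $M$. Let $\Omega_A,\Omega_B\subset\mathbb C$ be open with $W(A)\subset\Omega_A$ and $W(B)\subset\Omega_B$, and let $f:\Omega_A\times\Omega_B\to\mathbb C$ be analytic. For matrices $M,N$ with eigenvalues in $\Omega_A$ and $\Omega_B$, respectively, put \[ f\{M,N\}:=-\frac1{4\pi^2}\oint_{\Gamma_M}\oint_{\Gamma_N} f(x,y)\,(yI-N)^{-1}\otimes(xI-M)^{-1}\,\mathrm dy\,\mathrm dx , \] where $\otimes$ is the Kronecker product, $\Gamma_M\subset\Omega_A$ and $\Gamma_N\subset\Omega_B$ are any contours (finite unions of closed piecewise $C^1$ curves) that avoid the eigenvalues of $M$ and $N$, respectively, $\Gamma_M$ has winding number $1$ around each eigenvalue of $M$ and $0$ around each point outside $\Omega_A$, and $\Gamma_N$ has winding number $1$ around each eigenvalue of $N$ and $0$ around each point outside $\Omega_B$. Let $k,\ell\ge 1$, and let $U_k\in\mathbb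 C^{m\times k}$ and $V_\ell\in\mathbb C^{n\times\ell}$ have columns that form orthonormal bases of the ($k$- and $\ell$-dimensional) Krylov subspaces $\mathcal K_k(A,c_A)=\operatorname{span}\{c_A,Ac_A,\dots,A^{k-1}c_A\}$ and $\mathcal K_\ell(B,c_B)$, as generated by the Arnoldi process. With $c=\operatorname{vec}(c_Ac_B^T)$ (columns stacked), the bivariate Arnoldi approximation of $f\{A,B\}c$ is \[ x_{k,\ell}=(V_\ell\otimes U_k)\, f\{U_k^*AU_k,\,V_\ell^*BV_\ell\}\,(V_\ell\otimes U_k)^*c . \] Then \[ \|f\{A,B\}c-x_{k,\ell}\|_2\le 2(1+\sqrt2)^2\,\|c\|_2\inf_{p\in\Pi_{k-1,\ell-1}}\|f-p\|_{W(A)\times W(B)}, \] where $\Pi_{k-1,\ell-1}$ is the set of complex polynomials $p(x,y)$ of degree at most $k-1$ in $x$ and at most $\ell-1$ in $y$, and $\|g\|_{W(A)\times W(B)}=\max\{|g(x,y)|:x\in W(A),\,y\in W(B)\}$. -/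

import Mathlib

open scoped Kronecker Matrix

/-- A closed, piecewise continuously differentiable curve in `ℂ`, parametrized over `[0, 1]`: it is
continuous, its end points agree, and away from finitely many parameters it is differentiable with
a continuous and bounded derivative. -/
structure ClosedCurve where
  toFun : ℝ → ℂ
  continuousOn' : ContinuousOn toFun (Set.Icc 0 1)
  closed' : toFun 0 = toFun 1
  piecewise' : ∃ (S : Finset ℝ) (C : ℝ), ∀ t ∈ Set.Ioo (0 : ℝ) 1, t ∉ S →
    DifferentiableAt ℝ toFun t ∧ ContinuousAt (deriv toFun) t ∧ ‖deriv toFun t‖ ≤ C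

/-- A contour: finitely many closed curves. For instance the boundary of a convex domain, or one
small circle around each point of a finite set. -/
structure Contour where
  N : ℕ
  curve : Fin N → ClosedCurve

namespace Contour

/-- The trace of the contour. -/
def image (Γ : Contour) : Set ℂ :=
  ⋃ i, (Γ.curve i).toFun '' Set.Icc 0 1

/-- The contour integral `∮_Γ g(z) dz`. -/
noncomputable def integral (Γ : Contour) (g : ℂ → ℂ) : ℂ :=
  ∑ i, ∫ t in (0 : ℝ)..1, g ((Γ.curve i).toFun t) * deriv (Γ.curve i).toFun t

/-- The winding number of the contour around a point off its trace. -/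
noncomputable def windingNumber (Γ : Contour) (a : ℂ) : ℂ :=
  (2 * Real.pi * Complex.I)⁻¹ * Γ.integral fun z => (z - a)⁻¹

/-- `Γ` encloses the set `K` inside the open set `Ω`: it lies in `Ω`, avoids `K`, goes round every
point of `K` exactly once in the positive sense, and does not go round any point outside `Ω`. -/
structure Encloses (Γ : Contour) (Ω K : Set ℂ) : Prop where
  image_subset : Γ.image ⊆ Ω
  disjoint : Disjoint Γ.image K
  winding_one : ∀ a ∈ K, Γ.windingNumber a = 1
  winding_zero : ∀ a ∉ Ω, Γ.windingNumber a = 0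

end Contour

/-- The numerical range `W(A) = {v^* A v : ‖v‖₂ = 1}`. -/
def numericalRange {ι : Type*} [Fintype ι] (A : Matrix ι ι ℂ) : Set ℂ :=
  {z | ∃ v : EuclideanSpace ℂ ι, ‖v‖ = 1 ∧ z = star v.ofLp ⬝ᵥ (A *ᵥ v.ofLp)}

/-- The bivariate matrix function
`f{A,B} = -1/(4π²) ∮_{Γ_A} ∮_{Γ_B} f(x,y) (yI - B)⁻¹ ⊗ (xI - A)⁻¹ dy dx`,
for contours `Γ_A`, `Γ_B` enclosing the eigenvalues of `A` and `B`; the integral is taken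
entrywise. -/
noncomputable def bivariateMatrixFunction {m n : Type*} [Fintype m] [Fintype n] [DecidableEq m]
    [DecidableEq n] (ΓA ΓB : Contour) (f : ℂ × ℂ → ℂ) (A : Matrix m m ℂ) (B : Matrix n n ℂ) :
    Matrix (n × m) (n × m) ℂ :=
  Matrix.of fun r s => -(1 / (4 * (Real.pi : ℂ) ^ 2)) *
    ΓA.integral fun x => ΓB.integral fun y =>
      f (x, y) * ((y • (1 : Matrix n n ℂ) - B)⁻¹ ⊗ₖ (x • (1 : Matrix m m ℂ) - A)⁻¹) r s

/-- The Krylov subspace `K_k(A, b) = span {b, A b, …, A^(k-1) b}`. -/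
def krylovSubspace {ι : Type*} [Fintype ι] [DecidableEq ι] (k : ℕ) (A : Matrix ι ι ℂ)
    (b : ι → ℂ) : Submodule ℂ (ι → ℂ) :=
  Submodule.span ℂ (Set.range fun j : Fin k => (A ^ (j : ℕ)) *ᵥ b)

/-- The `k` columns of `U` form an orthonormal basis of the Krylov subspace `K_k(A, b)`, which is
thus `k`-dimensional. -/
def IsKrylovBasis {ι : Type*} [Fintype ι] [DecidableEq ι] {k : ℕ} (U : Matrix ι (Fin k) ℂ)
    (A : Matrix ι ι ℂ) (b : ι → ℂ) : Prop :=
  Uᴴ * U = 1 ∧ Submodule.span ℂ (Set.range Uᵀ) = krylovSubspace k A b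

/-- The approximation `x = (V ⊗ U) f{U^* A U, V^* B V} (V ⊗ U)^* c`; the contours enclose the
eigenvalues of the reduced matrices `U^* A U` and `V^* B V`. -/
noncomputable def arnoldiApprox {m n k l : Type*} [Fintype m] [Fintype n] [Fintype k] [Fintype l]
    [DecidableEq k] [DecidableEq l] (ΓA ΓB : Contour) (f : ℂ × ℂ → ℂ)
    (A : Matrix m m ℂ) (B : Matrix n n ℂ) (U : Matrix m k ℂ) (V : Matrix n l ℂ)
    (c : n × m → ℂ) : n × m → ℂ :=
  (V ⊗ₖ U) *ᵥ
    (bivariateMatrixFunction ΓA ΓB f (Uᴴ * A * U) (Vᴴ * B * V) *ᵥ ((V ⊗ₖ U)ᴴ *ᵥ c))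

/-- `Π_{k,l}`: the bivariate polynomials of degree at most `k` in the first and at most `l` in the
second variable. -/
def bivariatePolynomials (k l : ℕ) : Set (MvPolynomial (Fin 2) ℂ) :=
  {p | p.degreeOf 0 ≤ k ∧ p.degreeOf 1 ≤ l}

/-- `‖g‖_S`, the supremum of `|g|` on `S`. -/
noncomputable def supNormOn (S : Set (ℂ × ℂ)) (g : ℂ × ℂ → ℂ) : ℝ :=
  ⨆ z : S, ‖g z‖

/-- The Euclidean norm of a vector. -/
noncomputable def euclideanNorm {ι : Type*} [Fintype ι] (v : ι → ℂ) : ℝ :=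
  ‖WithLp.toLp 2 v‖

/-! The Arnoldi approximation is exact for p in Π_{k-1,l-1}: `U * Uᴴ` fixes the Krylov space, so
compressed powers of A up to k-1 act on `cA` as the powers themselves, and likewise for B
(`arnoldiApprox_mvPolynomial`). Hence the error for f equals the error for f - p, namely (f-p){A,B}c
minus its compressed counterpart. Compressions have smaller numerical ranges, so both terms fall
under one estimate: ‖g{A,B}‖ ≤ (1+√2)² sup|g| over W(A) × W(B). The factor 2 counts the two terms.

The tensor estimate comes from iteration. g{A,B} is the one-variable calculus in A applied to the
matrix-valued function x ↦ g(x,B). The scalar Crouzeix–Palencia theorem bounds that function by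
(1+√2) sup|g(x,·)|, and the matrix-valued Crouzeix–Palencia theorem contributes the second factor.

The matrix-valued theorem is proved for a matrix polynomial P with ‖P‖ ≤ 1 on a smooth convex body
around W(A). Put T = P(A), and let G be the Cauchy transform of P* evaluated at A. Two facts carry
the argument. The Hermitian part of the resolvent kernel is positive and has known total mass, so ‖T
+ G*‖ ≤ 2 (`norm_polyAeval_add_le`). The Cauchy transform of P* is again bounded by 1 inside the
body (`norm_cauchyTransform_le`). In T T* T = T (T+G*)* T - T G T the last term is, up to Runge
approximation, the value at A of a product of three functions bounded by 1. With K the best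
constant, ‖T‖³ ≤ 2‖T‖² + K, so K³ ≤ 2K² + K and K ≤ 1+√2. Approximation needs room between curve and
body, which is gained by dilating A and letting the ratio tend to 1.

The reduction to smooth bodies uses that W(A) is compact and convex: averaging its support function
twice makes it C², and an outer parallel body has radius of curvature bounded below. Independence of
the contours follows from the winding-number form of Cauchy's theorem, by Dixon's argument
(`Contour.integral_dslope_eq_zero`). -/

section

set_option linter.unusedSectionVars false

open MeasureTheory Filter Topology

/-! ### Line integrals over closed piecewise C¹ curves -/

namespace ClosedCurve

/-- The trace of a closed curve. -/
def trace (γ : ClosedCurve) : Set ℂ := γ.toFun '' Set.Icc 0 1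

/-- The line integral over a closed curve. -/
noncomputable def integral (γ : ClosedCurve) (g : ℂ → ℂ) : ℂ :=
  ∫ t in (0 : ℝ)..1, g (γ.toFun t) * deriv γ.toFun t

theorem isCompact_trace (γ : ClosedCurve) : IsCompact γ.trace :=
  isCompact_Icc.image_of_continuousOn γ.continuousOn'

theorem mem_trace (γ : ClosedCurve) {t : ℝ} (ht : t ∈ Set.Icc (0 : ℝ) 1) :
    γ.toFun t ∈ γ.trace := ⟨t, ht, rfl⟩

theorem exists_ae_norm_deriv_le (γ : ClosedCurve) :
    ∃ C : ℝ, 0 ≤ C ∧ ∀ᵐ t ∂volume.restrict (Set.Ioc (0 : ℝ) 1), ‖deriv γ.toFun t‖ ≤ C := by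
  obtain ⟨S, C, h⟩ := γ.piecewise'
  refine ⟨max C 0, le_max_right _ _, ?_⟩
  -- The bound on the derivative holds on the open interval off S; the end point 1 joins the null
  -- set.
  have h1 : ∀ᵐ t : ℝ, t ∉ ((S ∪ {1} : Finset ℝ) : Set ℝ) :=
    (Finset.finite_toSet _).countable.ae_notMem _
  rw [ae_restrict_iff' measurableSet_Ioc]
  filter_upwards [h1] with t ht hI
  simp only [Finset.coe_union, Finset.coe_singleton, Set.mem_union, Finset.mem_coe,
    Set.mem_singleton_iff, not_or] at ht
  exact (h t ⟨hI.1, lt_of_le_of_ne hI.2 ht.2⟩ ht.1).2.2.trans (le_max_left _ _)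

theorem integrable_deriv_smul {E : Type*} [NormedAddCommGroup E] [NormedSpace ℂ E]
    (γ : ClosedCurve) {φ : ℝ → E} (hφ : ContinuousOn φ (Set.Icc 0 1)) :
    IntervalIntegrable (fun t => deriv γ.toFun t • φ t) volume 0 1 := by
  rw [intervalIntegrable_iff_integrableOn_Ioc_of_le zero_le_one]
  obtain ⟨C, -, hC⟩ := γ.exists_ae_norm_deriv_le
  have hi : IntegrableOn φ (Set.Ioc 0 1) :=
    (hφ.integrableOn_Icc).mono_set Set.Ioc_subset_Icc_self
  exact Integrable.bdd_smul (hf := hi) (C := C)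
    ((measurable_deriv γ.toFun).aestronglyMeasurable) hC

theorem integrable_mul_deriv (γ : ClosedCurve) {g : ℂ → ℂ} (hg : ContinuousOn g γ.trace) :
    IntervalIntegrable (fun t => g (γ.toFun t) * deriv γ.toFun t) volume 0 1 := by
  have := γ.integrable_deriv_smul (φ := fun t => g (γ.toFun t))
    (hg.comp γ.continuousOn' fun t ht => γ.mem_trace ht)
  simpa only [smul_eq_mul, mul_comm] using this

theorem integral_eq_zero_of_hasDerivAt (γ : ClosedCurve) {F g : ℂ → ℂ}
    (hF : ∀ z ∈ γ.trace, HasDerivAt F (g z) z) (hg : ContinuousOn g γ.trace) :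
    γ.integral g = 0 := by
  obtain ⟨S, C, h⟩ := γ.piecewise'
  have := integral_eq_of_hasDerivAt_off_countable_of_le (fun t => F (γ.toFun t))
    (fun t => g (γ.toFun t) * deriv γ.toFun t) zero_le_one (Finset.countable_toSet S)
    (fun t ht => (hF _ (γ.mem_trace ht)).continuousAt.comp_continuousWithinAt
      (γ.continuousOn' t ht))
    (fun t ht => by
      exact (hF _ (γ.mem_trace (Set.Ioo_subset_Icc_self ht.1))).comp_of_eq t
        (h t ht.1 ht.2).1.hasDerivAt rfl)
    (γ.integrable_mul_deriv hg)
  rw [integral, this, γ.closed', sub_self]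

theorem integral_congr (γ : ClosedCurve) {f g : ℂ → ℂ} (h : Set.EqOn f g γ.trace) :
    γ.integral f = γ.integral g := by
  refine intervalIntegral.integral_congr fun t ht => ?_
  rw [Set.uIcc_of_le zero_le_one] at ht
  simp only [h (γ.mem_trace ht)]

theorem integral_add (γ : ClosedCurve) {f g : ℂ → ℂ} (hf : ContinuousOn f γ.trace)
    (hg : ContinuousOn g γ.trace) :
    γ.integral (fun z => f z + g z) = γ.integral f + γ.integral g := by
  simp only [integral, add_mul]
  exact intervalIntegral.integral_add (γ.integrable_mul_deriv hf) (γ.integrable_mul_deriv hg)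

theorem integral_const_mul (γ : ClosedCurve) (c : ℂ) (f : ℂ → ℂ) :
    γ.integral (fun z => c * f z) = c * γ.integral f := by
  simp only [integral, mul_assoc, intervalIntegral.integral_const_mul]

theorem exists_norm_integral_le (γ : ClosedCurve) :
    ∃ C : ℝ, 0 ≤ C ∧ ∀ (g : ℂ → ℂ) (M : ℝ), (∀ z ∈ γ.trace, ‖g z‖ ≤ M) →
      ‖γ.integral g‖ ≤ C * M := by
  obtain ⟨C, hC0, hC⟩ := γ.exists_ae_norm_deriv_le
  refine ⟨C, hC0, fun g M hg => ?_⟩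
  have := intervalIntegral.norm_integral_le_of_norm_le_const_ae (a := 0) (b := 1) (C := C * M)
    (f := fun t => g (γ.toFun t) * deriv γ.toFun t) (by
      rw [Set.uIoc_of_le zero_le_one]
      rw [ae_restrict_iff' measurableSet_Ioc] at hC
      filter_upwards [hC] with t ht hI
      rw [norm_mul, mul_comm]
      exact mul_le_mul (ht hI) (hg _ (γ.mem_trace (Set.Ioc_subset_Icc_self hI)))
        (norm_nonneg _) hC0)
  simpa [integral] using this

/-- Differentiation under the integral sign. Cauchy's estimate bounds the derivative in z, so a
locally uniform bound on φ itself is enough for domination. -/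
theorem differentiableOn_integral (γ : ClosedCurve) {Ω : Set ℂ} (hΩ : IsOpen Ω)
    {φ : ℂ → ℂ → ℂ} (hc : ∀ z ∈ Ω, ContinuousOn (φ z) γ.trace)
    (hd : ∀ w ∈ γ.trace, DifferentiableOn ℂ (fun z => φ z w) Ω)
    (hb : ∀ z₀ ∈ Ω, ∃ r > 0, ∃ M, ∀ z ∈ Metric.ball z₀ r, ∀ w ∈ γ.trace, ‖φ z w‖ ≤ M) :
    DifferentiableOn ℂ (fun z => γ.integral (φ z)) Ω := by
  intro z₀ hz₀
  obtain ⟨r₁, hr₁, M, hM⟩ := hb z₀ hz₀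
  obtain ⟨r₂, hr₂, hball⟩ := Metric.isOpen_iff.1 hΩ z₀ hz₀
  set r := min r₁ r₂ with hr
  have hr0 : 0 < r := lt_min hr₁ hr₂
  have hsub : Metric.ball z₀ r ⊆ Ω := (Metric.ball_subset_ball (min_le_right _ _)).trans hball
  obtain ⟨C, hC0, hC⟩ := γ.exists_ae_norm_deriv_le
  rw [ae_restrict_iff' measurableSet_Ioc] at hC
  have hdz : ∀ w ∈ γ.trace, ∀ z ∈ Metric.ball z₀ (r / 2),
      HasDerivAt (fun z => φ z w) (deriv (fun z => φ z w) z) z := fun w hw z hz =>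
    ((hd w hw).differentiableAt (hΩ.mem_nhds (hsub (Metric.ball_subset_ball (by linarith) hz)))).hasDerivAt
  -- A circle of radius r/4 around a point of the ball of radius r/2 stays inside the ball of radius
  -- r.
  have hbd : ∀ w ∈ γ.trace, ∀ z ∈ Metric.ball z₀ (r / 2),
      ‖deriv (fun z => φ z w) z‖ ≤ M / (r / 4) := by
    intro w hw z hz
    have hcb : Metric.closedBall z (r / 4) ⊆ Metric.ball z₀ r := by
      intro y hy
      rw [Metric.mem_closedBall] at hy
      rw [Metric.mem_ball] at hz ⊢
      linarith [dist_triangle y z z₀]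
    refine Complex.norm_deriv_le_of_forall_mem_sphere_norm_le (by positivity) ?_ ?_
    · refine ((hd w hw).mono ?_).diffContOnCl
      rw [closure_ball _ (by positivity)]
      exact hcb.trans hsub
    · intro y hy
      exact hM y (Metric.ball_subset_ball (min_le_left _ _) (hcb (Metric.sphere_subset_closedBall hy))) w hw
  have hmeas : ∀ z ∈ Ω, AEStronglyMeasurable
      (fun t => φ z (γ.toFun t) * deriv γ.toFun t) (volume.restrict (Set.uIoc 0 1)) := fun z hz =>
    ((γ.integrable_mul_deriv (hc z hz)).def').aestronglyMeasurable
  -- No joint regularity of φ is assumed: the derivative at z₀ is measurable along the curve as a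
  -- pointwise limit of difference quotients over a sequence tending to z₀.
  have hmeas' : AEStronglyMeasurable
      (fun t => deriv (fun z => φ z (γ.toFun t)) z₀ * deriv γ.toFun t)
      (volume.restrict (Set.uIoc 0 1)) := by
    have hu : Tendsto (fun n : ℕ => z₀ + (r / 2 * ((1 : ℝ) / ((n : ℝ) + 1)) : ℝ)) atTop (𝓝[≠] z₀) := by
      rw [tendsto_nhdsWithin_iff]
      constructor
      · have := ((Complex.continuous_ofReal.tendsto _).comp
          ((tendsto_one_div_add_atTop_nhds_zero_nat (𝕜 := ℝ)).const_mul (r / 2))).const_add z₀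
        simpa using this
      · refine Eventually.of_forall fun n => ?_
        have : (r / 2 * ((1 : ℝ) / ((n : ℝ) + 1))) ≠ 0 := by positivity
        simp only [Set.mem_compl_iff, Set.mem_singleton_iff, add_eq_left]
        exact_mod_cast this
    have hmem : ∀ n : ℕ, z₀ + (r / 2 * ((1 : ℝ) / ((n : ℝ) + 1)) : ℝ) ∈ Ω := fun n => by
      apply hsub
      rw [Metric.mem_ball, dist_eq_norm, add_sub_cancel_left, Complex.norm_real, Real.norm_eq_abs,
        abs_of_pos (by positivity)]
      have : (1 : ℝ) / ((n : ℝ) + 1) ≤ 1 := by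
        rw [div_le_one (by positivity)]; linarith [n.cast_nonneg (α := ℝ)]
      nlinarith
    refine aestronglyMeasurable_of_tendsto_ae (u := atTop)
      (f := fun (n : ℕ) t => slope (fun z => φ z (γ.toFun t)) z₀
        (z₀ + (r / 2 * ((1 : ℝ) / ((n : ℝ) + 1)) : ℝ)) * deriv γ.toFun t) ?_ ?_
    · intro n
      have := (((hmeas _ (hmem n)).sub (hmeas z₀ hz₀)).const_mul
        ((z₀ + (r / 2 * ((1 : ℝ) / ((n : ℝ) + 1)) : ℝ)) - z₀)⁻¹)
      refine this.congr (Eventually.of_forall fun t => ?_)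
      simp only [slope, Pi.sub_apply, vsub_eq_sub, smul_eq_mul]
      ring
    · rw [ae_restrict_iff' measurableSet_uIoc]
      refine Eventually.of_forall fun t ht => ?_
      rw [Set.uIoc_of_le zero_le_one] at ht
      exact ((hasDerivAt_iff_tendsto_slope.1 (hdz _ (γ.mem_trace (Set.Ioc_subset_Icc_self ht)) z₀
        (Metric.mem_ball_self (by positivity)))).comp hu).mul_const _
  have key := intervalIntegral.hasDerivAt_integral_of_dominated_loc_of_deriv_le
    (μ := volume) (a := 0) (b := 1) (x₀ := z₀) (s := Metric.ball z₀ (r / 2))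
    (F := fun z t => φ z (γ.toFun t) * deriv γ.toFun t)
    (F' := fun z t => deriv (fun z => φ z (γ.toFun t)) z * deriv γ.toFun t)
    (bound := fun _ => M / (r / 4) * C)
    (Metric.ball_mem_nhds _ (by positivity))
    (by filter_upwards [hΩ.mem_nhds hz₀] with z hz using hmeas z hz)
    (γ.integrable_mul_deriv (hc z₀ hz₀)) hmeas'
    (by
      filter_upwards [hC] with t ht hI z hz
      rw [Set.uIoc_of_le zero_le_one] at hI
      rw [norm_mul]
      have h1 := hbd _ (γ.mem_trace (Set.Ioc_subset_Icc_self hI)) z hz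
      exact mul_le_mul h1 (ht hI) (norm_nonneg _) ((norm_nonneg _).trans h1))
    intervalIntegrable_const
    (by
      refine Eventually.of_forall fun t hI z hz => ?_
      rw [Set.uIoc_of_le zero_le_one] at hI
      exact (hdz _ (γ.mem_trace (Set.Ioc_subset_Icc_self hI)) z hz).mul_const _)
  exact key.2.differentiableAt.differentiableWithinAt

/-- The curve run through backwards. -/
noncomputable def reverse (γ : ClosedCurve) : ClosedCurve where
  toFun t := γ.toFun (1 - t)
  continuousOn' := γ.continuousOn'.comp (by fun_prop) fun t ht => by
    simp only [Set.mem_Icc] at ht ⊢; constructor <;> linarith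
  closed' := by simp [γ.closed']
  piecewise' := by
    obtain ⟨S, C, h⟩ := γ.piecewise'
    refine ⟨S.image (fun t => 1 - t), C, fun t ht htS => ?_⟩
    obtain ⟨h1, h2, h3⟩ := h (1 - t) ⟨by linarith [ht.2], by linarith [ht.1]⟩
      fun hS => htS (Finset.mem_image.2 ⟨1 - t, hS, by ring⟩)
    have hder : deriv (fun t => γ.toFun (1 - t)) = fun t => -deriv γ.toFun (1 - t) := by
      ext s; rw [deriv_comp_const_sub]
    refine ⟨h1.comp t (by fun_prop), ?_, ?_⟩
    · rw [hder]
      exact (ContinuousAt.comp (f := fun t : ℝ => 1 - t) h2 (by fun_prop)).neg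
    · rw [hder, norm_neg]; exact h3

theorem trace_reverse (γ : ClosedCurve) : γ.reverse.trace = γ.trace := by
  ext z
  constructor
  · rintro ⟨t, ht, rfl⟩
    exact ⟨1 - t, ⟨by linarith [ht.2], by linarith [ht.1]⟩, rfl⟩
  · rintro ⟨t, ht, rfl⟩
    exact ⟨1 - t, ⟨by linarith [ht.2], by linarith [ht.1]⟩, by simp [reverse]⟩

theorem integral_reverse (γ : ClosedCurve) (g : ℂ → ℂ) :
    γ.reverse.integral g = -γ.integral g := by
  have hder : deriv (fun t => γ.toFun (1 - t)) = fun t => -deriv γ.toFun (1 - t) := by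
    ext s; rw [deriv_comp_const_sub]
  simp only [integral, reverse, hder]
  have := intervalIntegral.integral_comp_sub_left (a := 0) (b := 1)
    (fun t => g (γ.toFun t) * -deriv γ.toFun t) 1
  rw [this]
  simp

end ClosedCurve

/-! ### Winding numbers and Cauchy's theorem for contours -/

namespace Contour

theorem image_eq (Γ : Contour) : Γ.image = ⋃ i, (Γ.curve i).trace := rfl

theorem trace_subset_image (Γ : Contour) (i : Fin Γ.N) : (Γ.curve i).trace ⊆ Γ.image :=
  Set.subset_iUnion (fun i => (Γ.curve i).trace) i

theorem integral_eq_sum (Γ : Contour) (g : ℂ → ℂ) :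
    Γ.integral g = ∑ i, (Γ.curve i).integral g := rfl

theorem isCompact_image (Γ : Contour) : IsCompact Γ.image :=
  isCompact_iUnion fun i => (Γ.curve i).isCompact_trace

theorem integral_eq_zero_of_hasDerivAt (Γ : Contour) {F g : ℂ → ℂ}
    (hF : ∀ z ∈ Γ.image, HasDerivAt F (g z) z) (hg : ContinuousOn g Γ.image) :
    Γ.integral g = 0 :=
  Finset.sum_eq_zero fun i _ => (Γ.curve i).integral_eq_zero_of_hasDerivAt
    (fun z hz => hF z (Γ.trace_subset_image i hz)) (hg.mono (Γ.trace_subset_image i))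

theorem integral_congr (Γ : Contour) {f g : ℂ → ℂ} (h : Set.EqOn f g Γ.image) :
    Γ.integral f = Γ.integral g :=
  Finset.sum_congr rfl fun i _ => (Γ.curve i).integral_congr (h.mono (Γ.trace_subset_image i))

theorem integral_add (Γ : Contour) {f g : ℂ → ℂ} (hf : ContinuousOn f Γ.image)
    (hg : ContinuousOn g Γ.image) :
    Γ.integral (fun z => f z + g z) = Γ.integral f + Γ.integral g := by
  simp only [integral_eq_sum, ← Finset.sum_add_distrib]
  exact Finset.sum_congr rfl fun i _ => (Γ.curve i).integral_add
    (hf.mono (Γ.trace_subset_image i)) (hg.mono (Γ.trace_subset_image i))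

theorem integral_const_mul (Γ : Contour) (c : ℂ) (f : ℂ → ℂ) :
    Γ.integral (fun z => c * f z) = c * Γ.integral f := by
  simp only [integral_eq_sum, ClosedCurve.integral_const_mul, Finset.mul_sum]

theorem integral_mul_const (Γ : Contour) (f : ℂ → ℂ) (c : ℂ) :
    Γ.integral (fun z => f z * c) = Γ.integral f * c := by
  simp only [mul_comm _ c, integral_const_mul]

theorem integral_sub (Γ : Contour) {f g : ℂ → ℂ} (hf : ContinuousOn f Γ.image)
    (hg : ContinuousOn g Γ.image) :
    Γ.integral (fun z => f z - g z) = Γ.integral f - Γ.integral g := by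
  have := Γ.integral_add hf (g := fun z => -1 * g z) (continuousOn_const.mul hg)
  rw [integral_const_mul] at this
  simpa [sub_eq_add_neg] using this

theorem integral_sum (Γ : Contour) {ι : Type*} (s : Finset ι) {f : ι → ℂ → ℂ}
    (hf : ∀ i ∈ s, ContinuousOn (f i) Γ.image) :
    Γ.integral (fun z => ∑ i ∈ s, f i z) = ∑ i ∈ s, Γ.integral (f i) := by
  classical
  induction s using Finset.induction_on with
  | empty => simp [integral]
  | insert a s ha ih =>
    simp only [Finset.sum_insert ha]
    rw [integral_add _ (hf a (Finset.mem_insert_self a s))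
      (continuousOn_finsetSum _ fun i hi => hf i (Finset.mem_insert_of_mem hi)),
      ih fun i hi => hf i (Finset.mem_insert_of_mem hi)]

theorem integral_sum_const_mul (Γ : Contour) {ι : Type*} (s : Finset ι) (c : ι → ℂ)
    {f : ι → ℂ → ℂ} (hf : ∀ i ∈ s, ContinuousOn (f i) Γ.image) :
    Γ.integral (fun z => ∑ i ∈ s, c i * f i z) = ∑ i ∈ s, c i * Γ.integral (f i) := by
  rw [integral_sum Γ s (f := fun i z => c i * f i z) fun i hi => continuousOn_const.mul (hf i hi)]
  simp only [integral_const_mul]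

theorem exists_norm_integral_le (Γ : Contour) :
    ∃ C : ℝ, 0 ≤ C ∧ ∀ (g : ℂ → ℂ) (M : ℝ), (∀ z ∈ Γ.image, ‖g z‖ ≤ M) →
      ‖Γ.integral g‖ ≤ C * M := by
  choose C hC0 hC using fun i => (Γ.curve i).exists_norm_integral_le
  refine ⟨∑ i, C i, Finset.sum_nonneg fun i _ => hC0 i, fun g M hg => ?_⟩
  rw [integral_eq_sum, Finset.sum_mul]
  exact (norm_sum_le _ _).trans (Finset.sum_le_sum fun i _ =>
    hC i g M fun z hz => hg z (Γ.trace_subset_image i hz))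

theorem differentiableOn_integral (Γ : Contour) {Ω : Set ℂ} (hΩ : IsOpen Ω)
    {φ : ℂ → ℂ → ℂ} (hc : ∀ z ∈ Ω, ContinuousOn (φ z) Γ.image)
    (hd : ∀ w ∈ Γ.image, DifferentiableOn ℂ (fun z => φ z w) Ω)
    (hb : ∀ z₀ ∈ Ω, ∃ r > 0, ∃ M, ∀ z ∈ Metric.ball z₀ r, ∀ w ∈ Γ.image, ‖φ z w‖ ≤ M) :
    DifferentiableOn ℂ (fun z => Γ.integral (φ z)) Ω := by
  simp only [integral_eq_sum]
  refine DifferentiableOn.fun_sum fun i _ => (Γ.curve i).differentiableOn_integral hΩ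
    (fun z hz => (hc z hz).mono (Γ.trace_subset_image i))
    (fun w hw => hd w (Γ.trace_subset_image i hw)) fun z₀ hz₀ => ?_
  obtain ⟨r, hr, M, hM⟩ := hb z₀ hz₀
  exact ⟨r, hr, M, fun z hz w hw => hM z hz w (Γ.trace_subset_image i hw)⟩

/-- The difference of two contours. -/
noncomputable def sub (Γ Γ' : Contour) : Contour where
  N := Γ.N + Γ'.N
  curve := Fin.append Γ.curve fun i => (Γ'.curve i).reverse

theorem integral_sub_contour (Γ Γ' : Contour) (g : ℂ → ℂ) :
    (Γ.sub Γ').integral g = Γ.integral g - Γ'.integral g := by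
  rw [integral_eq_sum, integral_eq_sum, integral_eq_sum]
  change ∑ i : Fin (Γ.N + Γ'.N), _ = _
  rw [Fin.sum_univ_add]
  simp [sub, ClosedCurve.integral_reverse, sub_eq_add_neg]

theorem image_sub_contour (Γ Γ' : Contour) : (Γ.sub Γ').image ⊆ Γ.image ∪ Γ'.image := by
  rw [image_eq, Set.iUnion_subset_iff]
  change ∀ i : Fin (Γ.N + Γ'.N), _
  refine fun i => Fin.addCases (fun i => ?_) (fun i => ?_) i
  · simpa [sub] using (Γ.trace_subset_image i).trans Set.subset_union_left
  · simpa [sub, ClosedCurve.trace_reverse] using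
      (Γ'.trace_subset_image i).trans Set.subset_union_right

/-- A contour in an open half plane does not go round the points outside. -/
theorem integral_inv_sub_eq_zero_of_halfPlane (Γ : Contour) {u z : ℂ}
    (h : ∀ w ∈ Γ.image, 0 < (u * (w - z)).re) : Γ.integral (fun w => (w - z)⁻¹) = 0 := by
  have hne : ∀ w ∈ Γ.image, u ≠ 0 ∧ w - z ≠ 0 := fun w hw => by
    have := h w hw
    refine ⟨fun h0 => ?_, fun h0 => ?_⟩ <;> simp [h0] at this
  -- On the half plane the principal logarithm of u(w - z) is a single-valued primitive of the
  -- integrand.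
  refine Γ.integral_eq_zero_of_hasDerivAt (F := fun w => Complex.log (u * (w - z))) ?_ ?_
  · intro w hw
    have h1 : HasDerivAt (fun w => u * (w - z)) u w := by
      simpa using ((hasDerivAt_id w).sub_const z).const_mul u
    convert! h1.clog (Or.inl (h w hw)) using 1
    field_simp [(hne w hw).1, (hne w hw).2]
  · exact (continuousOn_id.sub continuousOn_const).inv₀ fun w hw => (hne w hw).2

/-- Winding numbers are locally constant. If z is closer to a than the trace is, then (w - z)/(w -
a) stays within distance 1 of 1, and its principal logarithm is a primitive of the difference of the
integrands. -/
theorem eventually_integral_inv_sub_eq (Γ : Contour) {a : ℂ} (ha : a ∉ Γ.image) :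
    ∀ᶠ z in 𝓝 a, z ∉ Γ.image ∧
      Γ.integral (fun w => (w - z)⁻¹) = Γ.integral (fun w => (w - a)⁻¹) := by
  obtain ⟨r, hr, hball⟩ := Metric.isOpen_iff.1 Γ.isCompact_image.isClosed.isOpen_compl a ha
  filter_upwards [Metric.ball_mem_nhds a hr] with z hz
  refine ⟨hball hz, ?_⟩
  have hza : ∀ w ∈ Γ.image, w - a ≠ 0 ∧ w - z ≠ 0 := fun w hw =>
    ⟨fun h0 => ha (by rwa [← sub_eq_zero.1 h0]), fun h0 => hball hz (by rwa [← sub_eq_zero.1 h0])⟩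
  have hc1 : ContinuousOn (fun w => (w - z)⁻¹) Γ.image :=
    (continuousOn_id.sub continuousOn_const).inv₀ fun w hw => (hza w hw).2
  have hc2 : ContinuousOn (fun w => (w - a)⁻¹) Γ.image :=
    (continuousOn_id.sub continuousOn_const).inv₀ fun w hw => (hza w hw).1
  rw [← sub_eq_zero, ← integral_sub _ hc1 hc2]
  refine Γ.integral_eq_zero_of_hasDerivAt (F := fun w => Complex.log ((w - z) / (w - a))) ?_
    (hc1.sub hc2)
  intro w hw
  obtain ⟨h1, h2⟩ := hza w hw
  have hd : HasDerivAt (fun w => (w - z) / (w - a))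
      ((1 * (w - a) - (w - z) * 1) / (w - a) ^ 2) w :=
    ((hasDerivAt_id w).sub_const z).div ((hasDerivAt_id w).sub_const a) h1
  have hs : (w - z) / (w - a) ∈ Complex.slitPlane := by
    have hlt : ‖(a - z) / (w - a)‖ < 1 := by
      rw [norm_div, div_lt_one (norm_pos_iff.2 h1)]
      have hw' : w ∉ Metric.ball a r := fun hb => hball hb hw
      rw [Metric.mem_ball, not_lt, dist_eq_norm] at hw'
      rw [Metric.mem_ball, dist_comm, dist_eq_norm] at hz
      linarith
    convert! Complex.mem_slitPlane_of_norm_lt_one hlt using 1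
    field_simp
    ring
  convert! hd.clog hs using 1
  field_simp

/-- Seen from a point z of larger modulus than the whole trace, the contour lies in the half plane
through z that faces the origin. -/
theorem eventually_integral_inv_sub_eq_zero (Γ : Contour) :
    ∀ᶠ z in cocompact ℂ, z ∉ Γ.image ∧ Γ.integral (fun w => (w - z)⁻¹) = 0 := by
  obtain ⟨R, hR⟩ := Γ.isCompact_image.isBounded.exists_norm_le
  filter_upwards [(tendsto_norm_cocompact_atTop (E := ℂ)).eventually_gt_atTop (max R 0)]
    with z hz
  have hz0 : 0 < ‖z‖ := (le_max_right _ _).trans_lt hz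
  refine ⟨fun h => ((hR z h).trans (le_max_left _ _)).not_gt hz,
    Γ.integral_inv_sub_eq_zero_of_halfPlane (u := -(starRingEnd ℂ) z) fun w hw => ?_⟩
  have h1 : (starRingEnd ℂ z * z).re = ‖z‖ ^ 2 := by
    rw [mul_comm, Complex.mul_conj, Complex.ofReal_re, Complex.normSq_eq_norm_sq]
  have h2 : (starRingEnd ℂ z * w).re ≤ ‖z‖ * ‖w‖ := by
    simpa using (Complex.re_le_norm (starRingEnd ℂ z * w))
  have h3 : ‖w‖ < ‖z‖ := ((hR w hw).trans (le_max_left _ _)).trans_lt hz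
  have : (-(starRingEnd ℂ) z * (w - z)).re
      = (starRingEnd ℂ z * z).re - (starRingEnd ℂ z * w).re := by
    rw [← Complex.sub_re]; congr 1; ring
  rw [this, h1]
  nlinarith

theorem differentiableOn_cauchyTransform (Γ : Contour) {h : ℂ → ℂ}
    (hh : ContinuousOn h Γ.image) :
    DifferentiableOn ℂ (fun z => Γ.integral fun w => h w / (w - z)) Γ.imageᶜ := by
  have hopen := Γ.isCompact_image.isClosed.isOpen_compl
  have hne : ∀ z ∈ Γ.imageᶜ, ∀ w ∈ Γ.image, w - z ≠ 0 := fun z hz w hw h0 =>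
    hz (by rwa [← sub_eq_zero.1 h0])
  obtain ⟨M, hM⟩ := Γ.isCompact_image.exists_bound_of_continuousOn hh
  refine Γ.differentiableOn_integral hopen
    (fun z hz => hh.div (continuousOn_id.sub continuousOn_const) (hne z hz))
    (fun w hw z hz => ?_) fun z₀ hz₀ => ?_
  · exact ((differentiableAt_const _).div
      ((differentiableAt_const _).sub differentiableAt_id) (hne z hz w hw)).differentiableWithinAt
  · obtain ⟨r, hr, hball⟩ := Metric.isOpen_iff.1 hopen z₀ hz₀
    refine ⟨r / 2, by positivity, M / (r / 2), fun z hz w hw => ?_⟩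
    rw [norm_div]
    have hw' : w ∉ Metric.ball z₀ r := fun hb => hball hb hw
    rw [Metric.mem_ball, not_lt] at hw'
    rw [Metric.mem_ball] at hz
    have : r / 2 ≤ ‖w - z‖ := by
      rw [← dist_eq_norm]
      linarith [dist_triangle w z z₀]
    have h0 := (norm_nonneg _).trans (hM w hw)
    exact div_le_div₀ h0 (hM w hw) (by positivity) this

/-- Near the diagonal the mean value inequality on a convex ball bounds the divided difference; away
from it the denominator is at least r/2. -/
theorem exists_bound_dslope {Ω K : Set ℂ} (hΩ : IsOpen Ω) (hK : IsCompact K)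
    {h : ℂ → ℂ} (hh : DifferentiableOn ℂ h Ω) (hKΩ : K ⊆ Ω) {z₀ : ℂ} (hz₀ : z₀ ∈ Ω) :
    ∃ r > 0, ∃ M, ∀ z ∈ Metric.ball z₀ r, ∀ w ∈ K, ‖dslope h z w‖ ≤ M := by
  obtain ⟨r, hr, hball⟩ := Metric.nhds_basis_closedBall.mem_iff.1 (hΩ.mem_nhds hz₀)
  have hcb : IsCompact (Metric.closedBall z₀ r) := isCompact_closedBall _ _
  obtain ⟨M₁, hM₁⟩ := hcb.exists_bound_of_continuousOn (hh.continuousOn.mono hball)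
  obtain ⟨M₂, hM₂⟩ := hK.exists_bound_of_continuousOn (hh.continuousOn.mono hKΩ)
  obtain ⟨L, hL⟩ := hcb.exists_bound_of_continuousOn
    (((hh.deriv hΩ).continuousOn).mono hball)
  refine ⟨r / 2, by positivity, max L ((M₁ + M₂) / (r / 2)), fun z hz w hw => ?_⟩
  have hz' : z ∈ Metric.closedBall z₀ r := by
    rw [Metric.mem_ball] at hz; rw [Metric.mem_closedBall]; linarith
  rcases eq_or_ne w z with rfl | hne
  · rw [dslope_same]
    exact (hL w hz').trans (le_max_left _ _)
  rw [dslope_of_ne _ hne, slope_def_field, norm_div]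
  have hpos : 0 < ‖w - z‖ := norm_pos_iff.2 (sub_ne_zero.2 hne)
  by_cases hwb : w ∈ Metric.closedBall z₀ r
  · refine le_trans ?_ (le_max_left _ _)
    rw [div_le_iff₀ hpos]
    exact (convex_closedBall z₀ r).norm_image_sub_le_of_norm_deriv_le
      (fun x hx => hh.differentiableAt (hΩ.mem_nhds (hball hx))) hL hz' hwb
  · refine le_trans ?_ (le_max_right _ _)
    have h1 : r / 2 ≤ ‖w - z‖ := by
      rw [Metric.mem_closedBall, not_le] at hwb
      rw [Metric.mem_ball] at hz
      rw [← dist_eq_norm]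
      linarith [dist_triangle w z z₀]
    have h2 : ‖h w - h z‖ ≤ M₁ + M₂ :=
      (norm_sub_le _ _).trans (by linarith [hM₁ z hz', hM₂ w hw])
    exact div_le_div₀ ((norm_nonneg _).trans h2) h2 (by positivity) h1

/-- Dixon's argument: the function equal to the integral of the divided difference on Ω and to the
Cauchy transform of h off Ω is entire and vanishes at infinity, so Liouville's theorem makes it
zero. -/
theorem integral_dslope_eq_zero (Γ : Contour) {Ω : Set ℂ} (hΩ : IsOpen Ω) (hΓ : Γ.image ⊆ Ω)
    (hw : ∀ a ∉ Ω, Γ.integral (fun w => (w - a)⁻¹) = 0) {h : ℂ → ℂ}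
    (hh : DifferentiableOn ℂ h Ω) {a : ℂ} (ha : a ∈ Ω) : Γ.integral (dslope h a) = 0 := by
  classical
  set G : ℂ → ℂ := fun z => if z ∈ Ω then Γ.integral (dslope h z)
    else Γ.integral fun w => h w / (w - z) with hG
  have hhc : ContinuousOn h Γ.image := hh.continuousOn.mono hΓ
  have hcs : ∀ z ∈ Ω, ContinuousOn (dslope h z) Γ.image := fun z hz =>
    (((continuousOn_dslope (hΩ.mem_nhds hz)).2
      ⟨hh.continuousOn, hh.differentiableAt (hΩ.mem_nhds hz)⟩)).mono hΓ
  -- The two formulas differ by h(z) times the integral of (w - z)⁻¹, so they agree wherever the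
  -- winding number is 0.
  have hoff : ∀ z ∉ Γ.image, Γ.integral (fun w => (w - z)⁻¹) = 0 →
      G z = Γ.integral fun w => h w / (w - z) := by
    intro z hz hz0
    by_cases hzΩ : z ∈ Ω
    · have hne : ∀ w ∈ Γ.image, w - z ≠ 0 := fun w hw h0 => hz (by rwa [← sub_eq_zero.1 h0])
      have hci : ContinuousOn (fun w => (w - z)⁻¹) Γ.image :=
        (continuousOn_id.sub continuousOn_const).inv₀ hne
      have hcd : ContinuousOn (fun w => h w / (w - z)) Γ.image :=
        hhc.div (continuousOn_id.sub continuousOn_const) hne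
      simp only [hG, if_pos hzΩ]
      have : Γ.integral (dslope h z)
          = Γ.integral fun w => h w / (w - z) - h z * (w - z)⁻¹ := by
        refine Γ.integral_congr fun w hw => ?_
        rw [dslope_of_ne _ (sub_ne_zero.1 (hne w hw)), slope_def_field]
        ring
      rw [this, Γ.integral_sub hcd (g := fun w => h z * (w - z)⁻¹)
        (continuousOn_const.mul hci), integral_const_mul, hz0,
        mul_zero, sub_zero]
    · simp only [hG, if_neg hzΩ]
  have hGd : Differentiable ℂ G := by
    intro z
    by_cases hzΩ : z ∈ Ω
    · have h1 : DifferentiableOn ℂ (fun z => Γ.integral (dslope h z)) Ω := by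
        refine Γ.differentiableOn_integral hΩ hcs (fun w hw => ?_)
          fun z₀ hz₀ => exists_bound_dslope hΩ Γ.isCompact_image hh hΓ hz₀
        -- The divided difference is symmetric, so it is holomorphic in its base point as well.
        refine ((Complex.differentiableOn_dslope (hΩ.mem_nhds (hΓ hw))).2 hh).congr fun z _ => ?_
        rcases eq_or_ne z w with rfl | hne
        · rfl
        · rw [dslope_of_ne _ hne, dslope_of_ne _ hne.symm, slope_comm]
      refine (h1.differentiableAt (hΩ.mem_nhds hzΩ)).congr_of_eventuallyEq ?_
      filter_upwards [hΩ.mem_nhds hzΩ] with y hy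
      simp only [hG, if_pos hy]
    · have hzi : z ∉ Γ.image := fun h => hzΩ (hΓ h)
      refine ((Γ.differentiableOn_cauchyTransform hhc).differentiableAt
        (Γ.isCompact_image.isClosed.isOpen_compl.mem_nhds hzi)).congr_of_eventuallyEq ?_
      filter_upwards [Γ.eventually_integral_inv_sub_eq hzi] with y hy
      exact hoff y hy.1 (hy.2.trans (hw z hzΩ))
  have hlim : Tendsto G (cocompact ℂ) (𝓝 0) := by
    obtain ⟨C, hC0, hC⟩ := Γ.exists_norm_integral_le
    obtain ⟨M, hM⟩ := Γ.isCompact_image.exists_bound_of_continuousOn hhc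
    obtain ⟨R, hR⟩ := Γ.isCompact_image.isBounded.exists_norm_le
    have hlim2 : Tendsto (fun z : ℂ => C * (max M 0 / (‖z‖ - R))) (cocompact ℂ) (𝓝 0) := by
      have := ((tendsto_const_nhds (x := max M 0)).div_atTop
        (tendsto_atTop_add_const_right _ (-R) (tendsto_norm_cocompact_atTop (E := ℂ)))).const_mul C
      simpa [sub_eq_add_neg] using this
    refine squeeze_zero_norm' ?_ hlim2
    filter_upwards [Γ.eventually_integral_inv_sub_eq_zero,
      (tendsto_norm_cocompact_atTop (E := ℂ)).eventually_gt_atTop R] with z hz hzR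
    rw [hoff z hz.1 hz.2]
    refine hC _ _ fun w hw => ?_
    rw [norm_div]
    refine div_le_div₀ (le_max_right _ _) ((hM w hw).trans (le_max_left _ _)) (by linarith) ?_
    have := norm_sub_norm_le z w
    rw [norm_sub_rev] at this
    linarith [hR w hw]
  have := hGd.apply_eq_of_tendsto_cocompact a hlim
  simpa only [hG, if_pos ha] using this

/-- **Cauchy's integral formula** for a contour that does not go round points outside `Ω`. -/
theorem integral_div_sub (Γ : Contour) {Ω : Set ℂ} (hΩ : IsOpen Ω) (hΓ : Γ.image ⊆ Ω)
    (hw : ∀ a ∉ Ω, Γ.integral (fun w => (w - a)⁻¹) = 0) {h : ℂ → ℂ}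
    (hh : DifferentiableOn ℂ h Ω) {a : ℂ} (ha : a ∈ Ω) (ha' : a ∉ Γ.image) :
    Γ.integral (fun w => h w / (w - a)) = Γ.integral (fun w => (w - a)⁻¹) * h a := by
  have hne : ∀ w ∈ Γ.image, w - a ≠ 0 := fun w hw h0 => ha' (by rwa [← sub_eq_zero.1 h0])
  have hci : ContinuousOn (fun w => (w - a)⁻¹) Γ.image :=
    (continuousOn_id.sub continuousOn_const).inv₀ hne
  rw [← integral_mul_const, ← sub_eq_zero, ← integral_sub]
  · rw [← Γ.integral_dslope_eq_zero hΩ hΓ hw hh ha]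
    refine Γ.integral_congr fun w hw => ?_
    rw [dslope_of_ne _ (sub_ne_zero.1 (hne w hw)), slope_def_field]
    ring
  · exact (hh.continuousOn.mono hΓ).div (continuousOn_id.sub continuousOn_const) hne
  · exact hci.mul continuousOn_const

/-- **Cauchy's theorem** for a contour that does not go round points outside `Ω`. -/
theorem integral_eq_zero (Γ : Contour) {Ω : Set ℂ} (hΩ : IsOpen Ω) (hΓ : Γ.image ⊆ Ω)
    (hw : ∀ a ∉ Ω, Γ.integral (fun w => (w - a)⁻¹) = 0) {h : ℂ → ℂ}
    (hh : DifferentiableOn ℂ h Ω) : Γ.integral h = 0 := by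
  rcases Γ.image.eq_empty_or_nonempty with he | hne
  · rw [Γ.integral_congr (g := fun z => 0 * h z) (by rw [he]; exact Set.eqOn_empty _ _),
      integral_const_mul, zero_mul]
  -- Otherwise the trace would be nonempty and clopen, hence all of ℂ, which is not compact.
  obtain ⟨a, ha, ha'⟩ : ∃ a ∈ Ω, a ∉ Γ.image := by
    by_contra! hcon
    have heq : Γ.image = Ω := hΓ.antisymm hcon
    have : IsClopen Γ.image := ⟨Γ.isCompact_image.isClosed, heq ▸ hΩ⟩
    have hu := this.eq_univ hne
    exact noncompact_univ ℂ (hu ▸ Γ.isCompact_image)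
  -- Cauchy's formula at a for a function that vanishes there has right-hand side 0 and integrand h.
  have hd : DifferentiableOn ℂ (fun w => (w - a) * h w) Ω :=
    (differentiableOn_id.sub_const a).mul hh
  have := Γ.integral_div_sub hΩ hΓ hw hd ha ha'
  rw [sub_self, zero_mul, mul_zero] at this
  rw [← this]
  refine Γ.integral_congr fun w hw => ?_
  have : w - a ≠ 0 := fun h0 => ha' (by rwa [← sub_eq_zero.1 h0])
  field_simp

theorem integral_inv_of_windingNumber (Γ : Contour) {a c : ℂ} (h : Γ.windingNumber a = c) :
    Γ.integral (fun w => (w - a)⁻¹) = 2 * Real.pi * Complex.I * c := by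
  rw [← h, windingNumber, mul_inv_cancel_left₀ Complex.two_pi_I_ne_zero]

/-- Two contours that enclose the same set have the same integrals. -/
theorem Encloses.integral_eq {Γ Γ' : Contour} {Ω K : Set ℂ} (hΩ : IsOpen Ω) (hK : IsClosed K)
    (h : Γ.Encloses Ω K) (h' : Γ'.Encloses Ω K) {g : ℂ → ℂ} (hg : DifferentiableOn ℂ g (Ω \ K)) :
    Γ.integral g = Γ'.integral g := by
  rw [← sub_eq_zero, ← integral_sub_contour]
  -- Around points of K both winding numbers are 1 and cancel in the difference contour, so Cauchy's
  -- theorem applies in Ω \ K.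
  refine (Γ.sub Γ').integral_eq_zero (hΩ.sdiff hK) ?_ ?_ hg
  · exact (image_sub_contour Γ Γ').trans (Set.union_subset
      (Set.subset_sdiff.2 ⟨h.image_subset, h.disjoint⟩)
      (Set.subset_sdiff.2 ⟨h'.image_subset, h'.disjoint⟩))
  · intro a ha
    rw [integral_sub_contour, sub_eq_zero]
    by_cases haΩ : a ∈ Ω
    · have haK : a ∈ K := by by_contra hcon; exact ha ⟨haΩ, hcon⟩
      rw [Γ.integral_inv_of_windingNumber (h.winding_one a haK),
        Γ'.integral_inv_of_windingNumber (h'.winding_one a haK)]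
    · rw [Γ.integral_inv_of_windingNumber (h.winding_zero a haΩ),
        Γ'.integral_inv_of_windingNumber (h'.winding_zero a haΩ)]

end Contour

/-! ### Smooth plane convex bodies described by support functions -/

/-- A twice continuously differentiable support function of a plane convex body: `h + h''`, the
radius of curvature as a function of the direction of the outer normal, is nonnegative. -/
structure SupportFunction where
  h : ℝ → ℝ
  h₁ : ℝ → ℝ
  h₂ : ℝ → ℝ
  hasDerivAt_h : ∀ θ, HasDerivAt h (h₁ θ) θ
  hasDerivAt_h₁ : ∀ θ, HasDerivAt h₁ (h₂ θ) θ
  continuous_h₂ : Continuous h₂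
  periodic_h : Function.Periodic h (2 * Real.pi)
  nonneg : ∀ θ, 0 ≤ h θ + h₂ θ

namespace SupportFunction

variable (S : SupportFunction)

/-- The radius of curvature. -/
def radius (θ : ℝ) : ℝ := S.h θ + S.h₂ θ

/-- The boundary point with outer normal `exp (i θ)`. -/
noncomputable def point (θ : ℝ) : ℂ :=
  Complex.exp (θ * Complex.I) * (S.h θ + S.h₁ θ * Complex.I)

/-- The signed distance from `z` to the supporting line with outer normal `exp (i θ)`. -/
noncomputable def gap (θ : ℝ) (z : ℂ) : ℝ := S.h θ - (Real.cos θ * z.re + Real.sin θ * z.im)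

/-- The derivative of the distance to the supporting line. -/
noncomputable def gapDeriv (θ : ℝ) (z : ℂ) : ℝ :=
  S.h₁ θ - (-Real.sin θ * z.re + Real.cos θ * z.im)

/-- The convex body. -/
def body : Set ℂ := {z | ∀ θ, 0 ≤ S.gap θ z}

/-- The open inner parallel body at distance `d`. -/
def inner (d : ℝ) : Set ℂ := {z | ∀ θ, d < S.gap θ z}

theorem continuous_h : Continuous S.h :=
  continuous_iff_continuousAt.2 fun θ => (S.hasDerivAt_h θ).continuousAt

theorem continuous_radius : Continuous S.radius := S.continuous_h.add S.continuous_h₂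

theorem radius_nonneg (θ : ℝ) : 0 ≤ S.radius θ := S.nonneg θ

theorem periodic_h₁ : Function.Periodic S.h₁ (2 * Real.pi) := fun θ => by
  have h1 := (S.hasDerivAt_h (θ + 2 * Real.pi)).comp_add_const θ (2 * Real.pi)
  have h2 : (fun x => S.h (x + 2 * Real.pi)) = S.h := funext S.periodic_h
  rw [h2] at h1
  exact h1.unique (S.hasDerivAt_h θ)

theorem periodic_gap (z : ℂ) : Function.Periodic (fun θ => S.gap θ z) (2 * Real.pi) := fun θ => by
  simp only [gap, S.periodic_h θ, Real.cos_add_two_pi, Real.sin_add_two_pi]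

theorem periodic_point : Function.Periodic S.point (2 * Real.pi) := fun θ => by
  simp only [point, S.periodic_h θ, S.periodic_h₁ θ]
  congr 1
  push_cast
  rw [add_mul, Complex.exp_periodic]

theorem point_re (θ : ℝ) : (S.point θ).re = Real.cos θ * S.h θ - Real.sin θ * S.h₁ θ := by
  simp [point, Complex.exp_re, Complex.exp_im]

theorem point_im (θ : ℝ) : (S.point θ).im = Real.cos θ * S.h₁ θ + Real.sin θ * S.h θ := by
  simp [point, Complex.exp_re, Complex.exp_im]

theorem hasDerivAt_point (θ : ℝ) :
    HasDerivAt S.point (Complex.I * Complex.exp (θ * Complex.I) * S.radius θ) θ := by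
  have h1 : HasDerivAt (fun θ : ℝ => Complex.exp (θ * Complex.I))
      (Complex.exp (θ * Complex.I) * (1 * Complex.I)) θ :=
    ((Complex.ofRealCLM.hasDerivAt (x := θ)).mul_const Complex.I).cexp
  have h2 : HasDerivAt (fun θ : ℝ => (S.h θ + S.h₁ θ * Complex.I : ℂ))
      (S.h₁ θ + S.h₂ θ * Complex.I) θ :=
    ((S.hasDerivAt_h θ).ofReal_comp).add (((S.hasDerivAt_h₁ θ).ofReal_comp).mul_const _)
  convert! h1.mul h2 using 1
  simp only [radius]
  push_cast
  linear_combination (-S.h₁ θ * Complex.exp (θ * Complex.I)) * Complex.I_sq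

theorem continuous_point : Continuous S.point :=
  continuous_iff_continuousAt.2 fun θ => (S.hasDerivAt_point θ).continuousAt

theorem hasDerivAt_gap (z : ℂ) (θ : ℝ) :
    HasDerivAt (fun θ => S.gap θ z) (S.gapDeriv θ z) θ :=
  (S.hasDerivAt_h θ).sub
    (((Real.hasDerivAt_cos θ).mul_const _).add ((Real.hasDerivAt_sin θ).mul_const _))

theorem hasDerivAt_gapDeriv (z : ℂ) (θ : ℝ) :
    HasDerivAt (fun θ => S.gapDeriv θ z) (S.radius θ - S.gap θ z) θ := by
  convert! (S.hasDerivAt_h₁ θ).sub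
    (((Real.hasDerivAt_sin θ).neg.mul_const _).add ((Real.hasDerivAt_cos θ).mul_const _)) using 1
  simp only [radius, gap]; ring

theorem continuous_gap (z : ℂ) : Continuous fun θ => S.gap θ z :=
  continuous_iff_continuousAt.2 fun θ => (S.hasDerivAt_gap z θ).continuousAt

/-- In the frame turned by θ, the vector from z to the boundary point has the gap as its normal and
the derivative of the gap as its tangential component. Positivity of the gap thus becomes positivity
of a real part in all kernel estimates. -/
theorem point_sub (θ : ℝ) (z : ℂ) :
    S.point θ - z = Complex.exp (θ * Complex.I) * (S.gap θ z + S.gapDeriv θ z * Complex.I) := by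
  apply Complex.ext
  · simp only [point_re, Complex.sub_re, Complex.mul_re, Complex.mul_im,
      Complex.add_re, Complex.add_im, Complex.ofReal_re, Complex.ofReal_im, Complex.I_re,
      Complex.I_im, Complex.exp_ofReal_mul_I_re, Complex.exp_ofReal_mul_I_im, gap, gapDeriv]
    linear_combination z.re * (Real.sin_sq_add_cos_sq θ)
  · simp only [point_im, Complex.sub_im, Complex.mul_re, Complex.mul_im,
      Complex.add_re, Complex.add_im, Complex.ofReal_re, Complex.ofReal_im, Complex.I_re,
      Complex.I_im, Complex.exp_ofReal_mul_I_re, Complex.exp_ofReal_mul_I_im, gap, gapDeriv]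
    linear_combination z.im * (Real.sin_sq_add_cos_sq θ)

theorem gap_point_self (θ : ℝ) : S.gap θ (S.point θ) = 0 := by
  simp only [gap, point_re, point_im]
  linear_combination -S.h θ * (Real.sin_sq_add_cos_sq θ)

theorem gap_sub_le (θ : ℝ) (z w : ℂ) : S.gap θ z - ‖w - z‖ ≤ S.gap θ w := by
  have h1 := Complex.re_le_norm (Complex.exp (-θ * Complex.I) * (w - z))
  rw [norm_mul, ← Complex.ofReal_neg, Complex.norm_exp_ofReal_mul_I, one_mul] at h1
  simp [Complex.exp_re, Complex.exp_im] at h1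
  simp only [gap]
  linarith

/-- The gap to the line with normal angle τ vanishes at the boundary point of parameter τ. Along the
curve its derivative is -R(s) sin(τ - s), which is nonnegative for half a turn after τ and
nonpositive for half a turn before. -/
theorem gap_point_nonneg (τ θ : ℝ) : 0 ≤ S.gap τ (S.point θ) := by
  have hd : ∀ s, HasDerivAt (fun s => S.gap τ (S.point s)) (-(S.radius s * Real.sin (τ - s))) s := by
    intro s
    have h1 := (S.hasDerivAt_point s)
    have hre : HasDerivAt (fun s => (S.point s).re) (-(Real.sin s) * S.radius s) s := by
      convert! (Complex.reCLM.hasFDerivAt.comp_hasDerivAt s h1) using 1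
      simp [Complex.exp_re, Complex.exp_im]
    have him : HasDerivAt (fun s => (S.point s).im) (Real.cos s * S.radius s) s := by
      convert! (Complex.imCLM.hasFDerivAt.comp_hasDerivAt s h1) using 1
      simp [Complex.exp_re, Complex.exp_im]
    convert! ((hre.const_mul (Real.cos τ)).add (him.const_mul (Real.sin τ))).const_sub (S.h τ) using 1
    rw [Real.sin_sub]; ring
  have hcont : Continuous fun s => S.gap τ (S.point s) :=
    continuous_iff_continuousAt.2 fun θ => (hd θ).continuousAt
  have hpos : ∀ s ∈ Set.Icc τ (τ + Real.pi), 0 ≤ S.gap τ (S.point s) := by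
    intro s hs
    rw [← S.gap_point_self τ]
    refine (monotoneOn_of_deriv_nonneg (convex_Icc τ (τ + Real.pi)) hcont.continuousOn
      (fun s _ => (hd s).differentiableAt.differentiableWithinAt) (fun s hs => ?_))
      (Set.left_mem_Icc.2 (by linarith [Real.pi_pos])) hs hs.1
    rw [interior_Icc] at hs
    rw [(hd s).deriv, ← mul_neg, ← Real.sin_neg]
    exact mul_nonneg (S.radius_nonneg s)
      (Real.sin_nonneg_of_nonneg_of_le_pi (by linarith [hs.1]) (by linarith [hs.2]))
  have hneg : ∀ s ∈ Set.Icc (τ - Real.pi) τ, 0 ≤ S.gap τ (S.point s) := by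
    intro s hs
    rw [← S.gap_point_self τ]
    refine (antitoneOn_of_deriv_nonpos (convex_Icc (τ - Real.pi) τ) hcont.continuousOn
      (fun s _ => (hd s).differentiableAt.differentiableWithinAt) (fun s hs => ?_))
      hs (Set.right_mem_Icc.2 (by linarith [Real.pi_pos])) hs.2
    rw [interior_Icc] at hs
    rw [(hd s).deriv, neg_nonpos]
    exact mul_nonneg (S.radius_nonneg s)
      (Real.sin_nonneg_of_nonneg_of_le_pi (by linarith [hs.2]) (by linarith [hs.1]))
  obtain ⟨s, hs, hse⟩ := S.periodic_point.exists_mem_Ico (Real.two_pi_pos) θ (τ - Real.pi)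
  rw [hse]
  rcases le_total s τ with h | h
  · exact hneg s ⟨hs.1, h⟩
  · exact hpos s ⟨h, by linarith [hs.2]⟩

theorem point_mem_body (θ : ℝ) : S.point θ ∈ S.body := fun τ => S.gap_point_nonneg τ θ

theorem exists_gap_le (z : ℂ) : ∃ θ₀, ∀ θ, S.gap θ₀ z ≤ S.gap θ z := by
  obtain ⟨θ₀, -, h⟩ := (isCompact_Icc (a := 0) (b := 2 * Real.pi)).exists_isMinOn
    (Set.nonempty_Icc.2 Real.two_pi_pos.le) (S.continuous_gap z).continuousOn
  refine ⟨θ₀, fun θ => ?_⟩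
  obtain ⟨s, hs, hse⟩ := (S.periodic_gap z).exists_mem_Ico₀ Real.two_pi_pos θ
  rw [hse]
  exact h (Set.Ico_subset_Icc_self hs)

theorem isOpen_inner (d : ℝ) : IsOpen (S.inner d) := by
  rw [Metric.isOpen_iff]
  intro z hz
  obtain ⟨θ₀, h0⟩ := S.exists_gap_le z
  refine ⟨S.gap θ₀ z - d, by linarith [hz θ₀], fun w hw θ => ?_⟩
  rw [Metric.mem_ball, dist_eq_norm] at hw
  linarith [S.gap_sub_le θ z w, h0 θ]

theorem isClosed_body : IsClosed S.body := by
  simp only [body, Set.ofPred_forall]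
  refine isClosed_iInter fun θ => isClosed_le continuous_const ?_
  unfold gap
  fun_prop

theorem isBounded_body : Bornology.IsBounded S.body := by
  obtain ⟨M, hM⟩ := (isCompact_Icc (a := -Real.pi) (b := Real.pi)).exists_bound_of_continuousOn
    S.continuous_h.continuousOn
  refine isBounded_iff_forall_norm_le.2 ⟨M, fun z hz => ?_⟩
  have h1 := hz z.arg
  have h2 := hM z.arg ⟨(Complex.neg_pi_lt_arg z).le, Complex.arg_le_pi z⟩
  have h3 : Real.cos z.arg * z.re + Real.sin z.arg * z.im = ‖z‖ := by
    have hr := Complex.norm_mul_cos_arg z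
    have hi := Complex.norm_mul_sin_arg z
    have := Real.sin_sq_add_cos_sq z.arg
    linear_combination -Real.cos z.arg * hr - Real.sin z.arg * hi + ‖z‖ * this
  rw [gap, h3] at h1
  linarith [le_abs_self (S.h z.arg), Real.norm_eq_abs (S.h z.arg)]

theorem isCompact_body : IsCompact S.body :=
  Metric.isCompact_of_isClosed_isBounded S.isClosed_body S.isBounded_body

theorem inner_subset_body {d : ℝ} (hd : 0 ≤ d) : S.inner d ⊆ S.body :=
  fun _ hz θ => hd.trans (hz θ).le

theorem le_gap_of_mem_closure_inner {d : ℝ} {z : ℂ} (hz : z ∈ closure (S.inner d)) (θ : ℝ) :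
    d ≤ S.gap θ z := by
  have : closure (S.inner d) ⊆ {z | d ≤ S.gap θ z} := by
    refine closure_minimal (fun z hz => (hz θ).le) (isClosed_le continuous_const ?_)
    unfold gap
    fun_prop
  exact this hz

/-- Frontier points of the inner parallel body lie on the inner normals at distance `d`. -/
theorem exists_of_mem_frontier_inner {d : ℝ} {z : ℂ} (hz : z ∈ frontier (S.inner d)) :
    ∃ θ₀ : ℝ, (∀ θ, d ≤ S.gap θ z) ∧ z = S.point θ₀ - d * Complex.exp (θ₀ * Complex.I) := by
  have h1 : ∀ θ, d ≤ S.gap θ z := S.le_gap_of_mem_closure_inner hz.1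
  have h2 : z ∉ S.inner d := by
    rw [(S.isOpen_inner d).frontier_eq] at hz
    exact hz.2
  simp only [inner, Set.mem_ofPred_eq, not_forall, not_lt] at h2
  obtain ⟨θ₀, h3⟩ := h2
  have h4 : S.gap θ₀ z = d := le_antisymm h3 (h1 θ₀)
  -- The gap attains its minimum d over all directions at θ₀, so z lies on the normal through that
  -- boundary point.
  have h5 : S.gapDeriv θ₀ z = 0 :=
    IsLocalMin.hasDerivAt_eq_zero (Eventually.of_forall fun θ => by simpa [h4] using h1 θ)
      (S.hasDerivAt_gap z θ₀)
  refine ⟨θ₀, h1, ?_⟩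
  have := S.point_sub θ₀ z
  rw [h4, h5, Complex.ofReal_zero] at this
  linear_combination -this

/-- The boundary curve, run through counterclockwise. -/
noncomputable def curve : ClosedCurve where
  toFun t := S.point (2 * Real.pi * t)
  continuousOn' := (S.continuous_point.comp (by fun_prop)).continuousOn
  closed' := by
    simpa using (S.periodic_point 0).symm
  piecewise' := by
    have hd : ∀ t, HasDerivAt (fun t => S.point (2 * Real.pi * t))
        ((2 * Real.pi : ℝ) • (Complex.I * Complex.exp ((2 * Real.pi * t : ℝ) * Complex.I)
          * S.radius (2 * Real.pi * t))) t := fun t => by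
      refine HasDerivAt.scomp t (S.hasDerivAt_point (2 * Real.pi * t)) ?_
      simpa using (hasDerivAt_id t).const_mul (2 * Real.pi)
    have hde := deriv_eq hd
    have hcont : Continuous (deriv fun t => S.point (2 * Real.pi * t)) := by
      rw [hde]
      have := S.continuous_radius
      fun_prop
    obtain ⟨C, hC⟩ := (isCompact_Icc (a := (0 : ℝ)) (b := 1)).exists_bound_of_continuousOn
      hcont.continuousOn
    exact ⟨∅, C, fun t ht _ => ⟨(hd t).differentiableAt, hcont.continuousAt,
      hC t (Set.Ioo_subset_Icc_self ht)⟩⟩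

/-- The boundary as a contour. -/
noncomputable def contour : Contour := ⟨1, fun _ => S.curve⟩

theorem contour_integral (g : ℂ → ℂ) : S.contour.integral g =
    ∫ θ in (0 : ℝ)..2 * Real.pi,
      g (S.point θ) * (Complex.I * Complex.exp (θ * Complex.I) * S.radius θ) := by
  have hd : ∀ t, deriv (fun t => S.point (2 * Real.pi * t)) t =
        ((2 * Real.pi : ℝ) • (Complex.I * Complex.exp ((2 * Real.pi * t : ℝ) * Complex.I)
          * S.radius (2 * Real.pi * t))) := fun t => by
    refine (HasDerivAt.scomp t (S.hasDerivAt_point (2 * Real.pi * t)) ?_).deriv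
    simpa using (hasDerivAt_id t).const_mul (2 * Real.pi)
  change ∑ i : Fin 1, ∫ t in (0 : ℝ)..1, g (S.point (2 * Real.pi * t)) *
    deriv (fun t => S.point (2 * Real.pi * t)) t = _
  simp only [hd, Finset.univ_unique, Finset.sum_singleton, mul_smul_comm]
  rw [intervalIntegral.integral_smul, intervalIntegral.smul_integral_comp_mul_left
    (fun θ : ℝ => g (S.point θ) * (Complex.I * Complex.exp (θ * Complex.I) * S.radius θ))]
  simp

theorem contour_image : S.contour.image = Set.range S.point := by
  have : S.contour.image = ⋃ _ : Fin 1, S.curve.toFun '' Set.Icc 0 1 := rfl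
  rw [this, Set.iUnion_const]
  apply Set.Subset.antisymm
  · rintro _ ⟨t, -, rfl⟩
    exact ⟨_, rfl⟩
  · rintro _ ⟨θ, rfl⟩
    obtain ⟨s, hs, hse⟩ := S.periodic_point.exists_mem_Ico₀ Real.two_pi_pos θ
    refine ⟨s / (2 * Real.pi), ⟨div_nonneg hs.1 Real.two_pi_pos.le,
      (div_le_one Real.two_pi_pos).2 hs.2.le⟩, ?_⟩
    rw [hse]
    change S.point (2 * Real.pi * (s / (2 * Real.pi))) = _
    rw [mul_div_cancel₀ _ Real.two_pi_pos.ne']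

theorem contour_image_subset_body : S.contour.image ⊆ S.body := by
  rw [contour_image]
  rintro _ ⟨θ, rfl⟩
  exact S.point_mem_body θ

theorem point_notMem_inner (θ : ℝ) : S.point θ ∉ S.inner 0 := fun h =>
  (h θ).ne' (S.gap_point_self θ)

theorem point_sub_ne_zero {z : ℂ} (hz : z ∈ S.inner 0) (θ : ℝ) : S.point θ - z ≠ 0 := fun h =>
  S.point_notMem_inner θ (by rwa [sub_eq_zero.1 h])

theorem point_sub_ne_zero_of_notMem {z : ℂ} (hz : z ∉ S.body) (θ : ℝ) : S.point θ - z ≠ 0 :=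
  fun h => hz (by rw [← sub_eq_zero.1 h]; exact S.point_mem_body θ)

/-- For interior z the gap is positive, so iθ + log(gap + i gap') is a primitive on the whole
parameter interval. Its logarithm is periodic, and only iθ contributes. -/
theorem integral_inv_sub_of_mem {z : ℂ} (hz : z ∈ S.inner 0) :
    S.contour.integral (fun w => (w - z)⁻¹) = 2 * Real.pi * Complex.I := by
  rw [contour_integral]
  have hd : ∀ θ ∈ Set.uIcc 0 (2 * Real.pi), HasDerivAt
      (fun θ : ℝ => θ * Complex.I + Complex.log (S.gap θ z + S.gapDeriv θ z * Complex.I))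
      ((S.point θ - z)⁻¹ * (Complex.I * Complex.exp (θ * Complex.I) * S.radius θ)) θ := by
    intro θ _
    have h1 : HasDerivAt (fun θ : ℝ => (θ * Complex.I : ℂ)) (1 * Complex.I) θ :=
      (Complex.ofRealCLM.hasDerivAt (x := θ)).mul_const Complex.I
    have h2 : HasDerivAt (fun θ : ℝ => (S.gap θ z + S.gapDeriv θ z * Complex.I : ℂ))
        (S.gapDeriv θ z + (S.radius θ - S.gap θ z : ℝ) * Complex.I) θ :=
      ((S.hasDerivAt_gap z θ).ofReal_comp).add
        (((S.hasDerivAt_gapDeriv z θ).ofReal_comp).mul_const _)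
    have hs : (S.gap θ z + S.gapDeriv θ z * Complex.I : ℂ) ∈ Complex.slitPlane :=
      Or.inl (by simpa using hz θ)
    convert! h1.add (h2.clog_real hs) using 1
    have hne := Complex.slitPlane_ne_zero hs
    rw [point_sub]
    have hexp := Complex.exp_ne_zero (θ * Complex.I)
    generalize hg : (S.gap θ z + S.gapDeriv θ z * Complex.I : ℂ) = g at hne ⊢
    field_simp
    push_cast
    linear_combination Complex.I * hg - (S.gapDeriv θ z : ℂ) * Complex.I_sq
  rw [intervalIntegral.integral_eq_sub_of_hasDerivAt hd]
  · have h1 := S.periodic_gap z 0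
    have h2 : S.gapDeriv (2 * Real.pi) z = S.gapDeriv 0 z := by
      have := S.periodic_h₁ 0
      simp only [zero_add] at this
      simp [gapDeriv, this]
    simp only [zero_add] at h1
    rw [h1, h2]
    push_cast
    ring
  · refine Continuous.intervalIntegrable ?_ _ _
    have := S.continuous_radius
    have := S.continuous_point
    exact ((this.sub continuous_const).inv₀ (S.point_sub_ne_zero hz)).mul (by fun_prop)

theorem integral_inv_sub_of_notMem {z : ℂ} (hz : z ∉ S.body) :
    S.contour.integral (fun w => (w - z)⁻¹) = 0 := by
  simp only [body, Set.mem_ofPred_eq, not_forall, not_le] at hz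
  obtain ⟨θ, hθ⟩ := hz
  -- The supporting line with normal angle θ separates z from the body.
  refine S.contour.integral_inv_sub_eq_zero_of_halfPlane
    (u := -Complex.exp ((-θ : ℝ) * Complex.I)) fun w hw => ?_
  have := S.contour_image_subset_body hw θ
  simp only [gap] at this hθ
  simp only [Complex.mul_re, Complex.neg_re, Complex.neg_im, Complex.exp_ofReal_mul_I_re,
    Complex.exp_ofReal_mul_I_im, Complex.sub_re, Complex.sub_im, Real.cos_neg, Real.sin_neg]
  linarith

theorem contour_encloses {Ω K : Set ℂ} (hΩ : S.body ⊆ Ω) (hK : K ⊆ S.inner 0) :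
    S.contour.Encloses Ω K where
  image_subset := S.contour_image_subset_body.trans hΩ
  disjoint := by
    rw [Set.disjoint_left, contour_image]
    rintro _ ⟨θ, rfl⟩ hz
    exact S.point_notMem_inner θ (hK hz)
  winding_one a ha := by
    rw [Contour.windingNumber, S.integral_inv_sub_of_mem (hK ha),
      inv_mul_cancel₀ Complex.two_pi_I_ne_zero]
  winding_zero a ha := by
    rw [Contour.windingNumber, S.integral_inv_sub_of_notMem fun h => ha (hΩ h), mul_zero]

/-- The outer parallel body at distance `δ`. -/
def parallel (δ : ℝ) (hδ : ∀ θ, 0 ≤ δ + S.radius θ) : SupportFunction where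
  h θ := δ + S.h θ
  h₁ := S.h₁
  h₂ := S.h₂
  hasDerivAt_h θ := (S.hasDerivAt_h θ).const_add δ
  hasDerivAt_h₁ := S.hasDerivAt_h₁
  continuous_h₂ := S.continuous_h₂
  periodic_h θ := by simp only [S.periodic_h θ]
  nonneg θ := by have := hδ θ; simp only [radius] at this; linarith

theorem gap_parallel (δ : ℝ) (hδ : ∀ θ, 0 ≤ δ + S.radius θ) (θ : ℝ) (z : ℂ) :
    (S.parallel δ hδ).gap θ z = δ + S.gap θ z := by
  simp only [gap, parallel]; ring

theorem point_parallel (δ : ℝ) (hδ : ∀ θ, 0 ≤ δ + S.radius θ) (θ : ℝ) :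
    (S.parallel δ hδ).point θ = S.point θ + δ * Complex.exp (θ * Complex.I) := by
  simp only [point, parallel]; push_cast; ring

theorem body_subset_inner_parallel {δ : ℝ} (hδ : 0 < δ) (h : ∀ θ, 0 ≤ δ + S.radius θ) :
    S.body ⊆ (S.parallel δ h).inner 0 := fun z hz θ => by
  rw [gap_parallel]; linarith [hz θ]

/-- If the radius of curvature is at least `ε`, then the inverse of the boundary parametrization by
normal directions is Lipschitz. -/
theorem mul_norm_le_norm_point_sub {ε : ℝ} (hε : ∀ θ, ε ≤ S.radius θ) (θ τ : ℝ) :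
    ε * ‖Complex.exp (θ * Complex.I) - Complex.exp (τ * Complex.I)‖ ≤
      ‖S.point θ - S.point τ‖ := by
  have hε' : ∀ θ, 0 ≤ -ε + S.radius θ := fun θ => by linarith [hε θ]
  -- Shrinking by ε keeps a nonnegative radius of curvature, and the boundary point of S is that of
  -- T plus ε times the normal.
  set T := S.parallel (-ε) hε' with hT
  set u := Complex.exp (θ * Complex.I) - Complex.exp (τ * Complex.I) with hu
  have h1 : S.point θ - S.point τ = (T.point θ - T.point τ) + ε * u := by
    rw [hT, point_parallel, point_parallel, hu]; push_cast; ring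
  -- Monotonicity of the normal map: the sum of two supporting line inequalities for T.
  have h2 : 0 ≤ ((starRingEnd ℂ) u * (T.point θ - T.point τ)).re := by
    have e1 := T.gap_point_nonneg θ τ
    have e2 := T.gap_point_nonneg τ θ
    have e3 := T.gap_point_self θ
    have e4 := T.gap_point_self τ
    simp only [gap] at e1 e2 e3 e4
    simp only [hu, Complex.mul_re, Complex.conj_re, Complex.conj_im, Complex.sub_re,
      Complex.sub_im, Complex.exp_ofReal_mul_I_re, Complex.exp_ofReal_mul_I_im]
    linarith
  have h3 : ((starRingEnd ℂ) u * (S.point θ - S.point τ)).re ≤ ‖u‖ * ‖S.point θ - S.point τ‖ := by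
    simpa using Complex.re_le_norm ((starRingEnd ℂ) u * (S.point θ - S.point τ))
  have h4 : ((starRingEnd ℂ) u * (ε * u)).re = ε * ‖u‖ ^ 2 := by
    rw [mul_left_comm, mul_comm _ u, Complex.mul_conj, ← Complex.ofReal_mul, Complex.ofReal_re,
      Complex.normSq_eq_norm_sq]
  rw [h1, mul_add, Complex.add_re, h4, ← h1] at h3
  rcases (norm_nonneg u).eq_or_lt with h | h
  · rw [← h]; simp
  · nlinarith

end SupportFunction

/-! ### Cauchy transforms of antianalytic functions on a convex body -/

/-- If a = b the modulus and the sum of real parts coincide when the real part is nonnegative. For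
points a and b seen from either side of the boundary at distance d, the discrepancy a - b costs an
error of order dq/‖a‖². -/
theorem norm_inv_add_inv_conj_le {a b : ℂ} {d c s q : ℝ} (hd : 0 ≤ d)
    (hab : a - b = 2 * d * (c + s * Complex.I)) (ha : 0 ≤ a.re) (hsum : 0 ≤ a.re + b.re)
    (ha0 : a ≠ 0) (hle : ‖a‖ ≤ ‖b‖) (hs : |s| ≤ q) (hc : -c ≤ q) :
    ‖a⁻¹ + ((starRingEnd ℂ) b)⁻¹‖ ≤ a⁻¹.re + b⁻¹.re + 4 * (d * q / ‖a‖ ^ 2) := by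
  have hA : 0 < ‖a‖ := norm_pos_iff.2 ha0
  have hB : 0 < ‖b‖ := hA.trans_le hle
  have hb0 : b ≠ 0 := norm_pos_iff.1 hB
  have hq : 0 ≤ q := (abs_nonneg s).trans hs
  set X := ‖a‖⁻¹ with hX
  set Y := ‖b‖⁻¹ with hY
  have hX0 : 0 < X := inv_pos.2 hA
  have hY0 : 0 < Y := inv_pos.2 hB
  have hYX : Y ≤ X := inv_anti₀ hA hle
  have hre : b.re = a.re - 2 * d * c := by
    have := congrArg Complex.re hab
    simp at this
    linarith
  have him : b.im = a.im - 2 * d * s := by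
    have := congrArg Complex.im hab
    simp at this
    linarith
  have h1 : ‖a⁻¹ + ((starRingEnd ℂ) b)⁻¹‖ ≤ (a.re + b.re + 2 * d * q) * (X * Y) := by
    have hcb : (starRingEnd ℂ) b ≠ 0 := by simpa using hb0
    have : a⁻¹ + ((starRingEnd ℂ) b)⁻¹ = ((starRingEnd ℂ) b + a) * (a⁻¹ * ((starRingEnd ℂ) b)⁻¹) := by
      field_simp
    rw [this, norm_mul, norm_mul, norm_inv, norm_inv, RCLike.norm_conj]
    refine mul_le_mul_of_nonneg_right ?_ (mul_pos hX0 hY0).le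
    refine (Complex.norm_le_abs_re_add_abs_im _).trans ?_
    have e1 : ((starRingEnd ℂ) b + a).re = a.re + b.re := by simp [add_comm]
    have e2 : ((starRingEnd ℂ) b + a).im = 2 * d * s := by simp [him]
    rw [e1, e2, abs_of_nonneg hsum, abs_mul, abs_of_nonneg (by positivity : 0 ≤ 2 * d)]
    gcongr
  have h2 : a⁻¹.re = a.re * X ^ 2 := by
    rw [Complex.inv_re, Complex.normSq_eq_norm_sq, hX, inv_pow, div_eq_mul_inv]
  have h3 : b⁻¹.re = b.re * Y ^ 2 := by
    rw [Complex.inv_re, Complex.normSq_eq_norm_sq, hY, inv_pow, div_eq_mul_inv]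
  have h4 : d * q / ‖a‖ ^ 2 = d * q * X ^ 2 := by rw [hX, inv_pow, div_eq_mul_inv]
  refine h1.trans ?_
  rw [h2, h3, h4]
  -- With b.re = a.re - 2dc, right minus left is a.re (X-Y)² + 2dc (X-Y)Y - 2dq XY + 4dq X². Since
  -- -c ≤ q, each of the two possibly negative terms is at least -2dq X².
  have hdq : 0 ≤ d * q := mul_nonneg hd hq
  have h5 : 0 ≤ (X - Y) * Y := mul_nonneg (by linarith) hY0.le
  have h6 : (X - Y) * Y ≤ X ^ 2 := by nlinarith
  have h7 : X * Y ≤ X ^ 2 := by nlinarith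
  have h8 : 0 ≤ a.re * (X - Y) ^ 2 := by positivity
  have h9 : -(d * q) * ((X - Y) * Y) ≤ d * c * ((X - Y) * Y) := by
    refine mul_le_mul_of_nonneg_right ?_ h5
    nlinarith
  have h10 := mul_le_mul_of_nonneg_left h6 hdq
  have h11 := mul_le_mul_of_nonneg_left h7 hdq
  rw [hre]
  nlinarith

namespace SupportFunction

variable (S : SupportFunction)

/-- The Cauchy kernel `exp (i θ) R / (σ(θ) - z)` of the boundary curve. -/
noncomputable def kernel (z : ℂ) (θ : ℝ) : ℂ :=
  S.radius θ * (Complex.exp (θ * Complex.I) / (S.point θ - z))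

theorem kernel_eq (z : ℂ) (θ : ℝ) :
    S.kernel z θ = S.radius θ * (S.gap θ z + S.gapDeriv θ z * Complex.I)⁻¹ := by
  rw [kernel, point_sub, div_mul_eq_div_div, div_self (Complex.exp_ne_zero _), one_div]

theorem continuous_kernel {z : ℂ} (hz : ∀ θ, S.point θ - z ≠ 0) : Continuous (S.kernel z) := by
  have h1 := S.continuous_radius
  have h2 := S.continuous_point
  unfold kernel
  exact (Complex.continuous_ofReal.comp h1).mul
    (Continuous.div (by fun_prop) (h2.sub continuous_const) hz)

theorem contour_integral_div_sub (g : ℂ → ℂ) (z : ℂ) :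
    S.contour.integral (fun w => g w / (w - z)) =
      Complex.I * ∫ θ in (0 : ℝ)..2 * Real.pi, S.kernel z θ * g (S.point θ) := by
  rw [contour_integral, ← intervalIntegral.integral_const_mul]
  refine intervalIntegral.integral_congr fun θ _ => ?_
  simp only [kernel]
  ring

theorem integral_kernel_of_mem {z : ℂ} (hz : z ∈ S.inner 0) :
    ∫ θ in (0 : ℝ)..2 * Real.pi, S.kernel z θ = 2 * Real.pi := by
  have h1 := S.contour_integral_div_sub (fun _ => 1) z
  simp only [one_div, mul_one] at h1
  rw [S.integral_inv_sub_of_mem hz] at h1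
  exact (mul_left_cancel₀ Complex.I_ne_zero (by rw [← h1]; ring)).symm

theorem integral_kernel_of_notMem {z : ℂ} (hz : z ∉ S.body) :
    ∫ θ in (0 : ℝ)..2 * Real.pi, S.kernel z θ = 0 := by
  have h1 := S.contour_integral_div_sub (fun _ => 1) z
  simp only [one_div, mul_one] at h1
  rw [S.integral_inv_sub_of_notMem hz] at h1
  exact (mul_eq_zero.1 h1.symm).resolve_left Complex.I_ne_zero

theorem integral_re_kernel {z : ℂ} (hz : ∀ θ, S.point θ - z ≠ 0) :
    ∫ θ in (0 : ℝ)..2 * Real.pi, (S.kernel z θ).re =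
      (∫ θ in (0 : ℝ)..2 * Real.pi, S.kernel z θ).re :=
  Complex.reCLM.intervalIntegral_comp_comm ((S.continuous_kernel hz).intervalIntegrable _ _)

/-- A bound for the part of the kernel that is not controlled by the winding numbers. -/
noncomputable def kernelError (ε d q : ℝ) : ℝ := d * q / (max d (ε * q / 2)) ^ 2

/-- The kernel at an inner point is paired with the conjugate kernel at its mirror image across the
boundary. The sum is almost real and nonnegative, so its modulus exceeds the real parts by a small
error only, and the integrals of those real parts are known from winding numbers. -/
theorem norm_kernel_add_conj_le {ε d : ℝ} (hd : 0 < d) (hε : ∀ θ, ε ≤ S.radius θ) {θ₀ : ℝ}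
    (hgap : ∀ θ, d ≤ S.gap θ (S.point θ₀ - d * Complex.exp (θ₀ * Complex.I))) (θ : ℝ) :
    ‖S.kernel (S.point θ₀ - d * Complex.exp (θ₀ * Complex.I)) θ +
        (starRingEnd ℂ) (S.kernel (S.point θ₀ + d * Complex.exp (θ₀ * Complex.I)) θ)‖ ≤
      (S.kernel (S.point θ₀ - d * Complex.exp (θ₀ * Complex.I)) θ).re +
      (S.kernel (S.point θ₀ + d * Complex.exp (θ₀ * Complex.I)) θ).re +
      4 * S.radius θ *
        kernelError ε d ‖Complex.exp (θ * Complex.I) - Complex.exp (θ₀ * Complex.I)‖ := by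
  set z := S.point θ₀ - d * Complex.exp (θ₀ * Complex.I) with hz
  set z' := S.point θ₀ + d * Complex.exp (θ₀ * Complex.I) with hz'
  set q := ‖Complex.exp (θ * Complex.I) - Complex.exp (θ₀ * Complex.I)‖ with hq
  have hR := S.radius_nonneg θ
  set a : ℂ := S.gap θ z + S.gapDeriv θ z * Complex.I with ha
  set b : ℂ := S.gap θ z' + S.gapDeriv θ z' * Complex.I with hb
  have hare : a.re = S.gap θ z := by simp [ha]
  have hbre : b.re = S.gap θ z' := by simp [hb]
  have hna : ‖a‖ = ‖S.point θ - z‖ := by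
    rw [point_sub, norm_mul, Complex.norm_exp_ofReal_mul_I, one_mul]
  have hnb : ‖b‖ = ‖S.point θ - z'‖ := by
    rw [point_sub, norm_mul, Complex.norm_exp_ofReal_mul_I, one_mul]
  have had : d ≤ ‖a‖ := (hgap θ).trans (hare ▸ Complex.re_le_norm a)
  have ha0 : a ≠ 0 := norm_pos_iff.1 (hd.trans_le had)
  have hq2 : q ^ 2 = 2 - 2 * Real.cos (θ - θ₀) := by
    rw [hq, ← Complex.normSq_eq_norm_sq, Complex.normSq_apply]
    simp only [Complex.sub_re, Complex.sub_im, Complex.exp_ofReal_mul_I_re,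
      Complex.exp_ofReal_mul_I_im, Real.cos_sub]
    nlinarith [Real.sin_sq_add_cos_sq θ, Real.sin_sq_add_cos_sq θ₀]
  have hq0 : 0 ≤ q := norm_nonneg _
  have hsc := Real.sin_sq_add_cos_sq (θ - θ₀)
  have hs : |(-Real.sin (θ - θ₀))| ≤ q := by
    refine abs_le_of_sq_le_sq ?_ hq0
    rw [hq2]; nlinarith [sq_nonneg (1 - Real.cos (θ - θ₀))]
  have hc : -Real.cos (θ - θ₀) ≤ q := by
    by_contra hcon
    rw [not_le] at hcon
    nlinarith [Real.neg_one_le_cos (θ - θ₀), Real.cos_le_one (θ - θ₀)]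
  have hab : a - b = 2 * d * ((Real.cos (θ - θ₀) : ℝ) + (-Real.sin (θ - θ₀) : ℝ) * Complex.I) := by
    apply Complex.ext
    · simp [hare, hbre, gap, hz, hz', Complex.exp_ofReal_mul_I_re, Complex.exp_ofReal_mul_I_im,
        Real.cos_sub, -Complex.ofReal_cos, -Complex.ofReal_sin]
      ring
    · simp [ha, hb, gapDeriv, hz, hz', Complex.exp_ofReal_mul_I_re, Complex.exp_ofReal_mul_I_im,
        Real.sin_sub, -Complex.ofReal_cos, -Complex.ofReal_sin]
      ring
  have hsum : 0 ≤ a.re + b.re := by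
    have := S.gap_point_nonneg θ θ₀
    have e : a.re + b.re = 2 * S.gap θ (S.point θ₀) := by
      rw [hare, hbre]
      simp only [gap, hz, hz', Complex.add_re, Complex.sub_re, Complex.add_im, Complex.sub_im]
      ring
    rw [e]; positivity
  -- The boundary point lies on the inner side of the tangent line at θ₀, hence no farther from the
  -- inner point than from its mirror image.
  have hle : ‖a‖ ≤ ‖b‖ := by
    rw [hna, hnb]
    refine le_of_sq_le_sq ?_ (norm_nonneg _)
    have h1 := S.gap_point_nonneg θ₀ θ
    have h2 := S.gap_point_self θ₀
    rw [← Complex.normSq_eq_norm_sq, ← Complex.normSq_eq_norm_sq, Complex.normSq_apply,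
      Complex.normSq_apply]
    simp only [gap] at h1 h2
    simp only [hz, hz', Complex.add_re, Complex.sub_re, Complex.add_im, Complex.sub_im,
      Complex.mul_re, Complex.mul_im, Complex.ofReal_re, Complex.ofReal_im,
      Complex.exp_ofReal_mul_I_re, Complex.exp_ofReal_mul_I_im]
    have h3 := mul_nonneg hd.le (sub_nonneg.2 (h2.le.trans h1))
    nlinarith
  -- The Lipschitz bound gives εq ≤ ‖a‖ + d, and d ≤ ‖a‖; this is the origin of the divisor 2.
  have hmax : max d (ε * q / 2) ≤ ‖a‖ := by
    refine max_le had ?_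
    have h1 := S.mul_norm_le_norm_point_sub hε θ θ₀
    have h2 : ‖S.point θ - S.point θ₀‖ ≤ ‖S.point θ - z‖ + d := by
      have : S.point θ - S.point θ₀ = (S.point θ - z) - d * Complex.exp (θ₀ * Complex.I) := by
        rw [hz]; ring
      rw [this]
      refine (norm_sub_le _ _).trans ?_
      rw [norm_mul, Complex.norm_exp_ofReal_mul_I, mul_one, Complex.norm_real, Real.norm_eq_abs,
        abs_of_pos hd]
    rw [← hna] at h2
    linarith
  have key := norm_inv_add_inv_conj_le hd.le hab (hare ▸ hd.le.trans (hgap θ)) hsum ha0 hle hs hc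
  have hker : d * q / ‖a‖ ^ 2 ≤ kernelError ε d q := by
    unfold kernelError
    have : 0 < max d (ε * q / 2) := lt_max_of_lt_left hd
    gcongr
  rw [kernel_eq, kernel_eq, map_mul, Complex.conj_ofReal, map_inv₀, ← mul_add, norm_mul,
    Complex.norm_real, Real.norm_eq_abs, abs_of_nonneg hR, Complex.re_ofReal_mul,
    Complex.re_ofReal_mul, ← ha, ← hb]
  nlinarith [mul_le_mul_of_nonneg_left (key.trans (add_le_add_right
    (mul_le_mul_of_nonneg_left hker (by norm_num : (0:ℝ) ≤ 4)) _)) hR]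

theorem kernelError_nonneg {ε d q : ℝ} (hd : 0 ≤ d) (hq : 0 ≤ q) : 0 ≤ kernelError ε d q := by
  unfold kernelError; positivity

/-- The square of the maximum is at least d · εq/2. The resulting bound depends on neither d nor q
and serves as dominating function. -/
theorem kernelError_le {ε d q : ℝ} (hε : 0 < ε) (hd : 0 < d) (hq : 0 ≤ q) :
    kernelError ε d q ≤ 2 / ε := by
  unfold kernelError
  have h1 : 0 < max d (ε * q / 2) := lt_max_of_lt_left hd
  rw [div_le_div_iff₀ (by positivity) hε]
  have h2 := mul_le_mul (le_max_left d (ε * q / 2)) (le_max_right d (ε * q / 2))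
    (by positivity) h1.le
  nlinarith

theorem tendsto_kernelError {ε q : ℝ} (hε : 0 < ε) (hq : 0 < q) :
    Tendsto (fun d => kernelError ε d q) (𝓝 0) (𝓝 0) := by
  have : ContinuousAt (fun d => kernelError ε d q) 0 := by
    unfold kernelError
    refine ContinuousAt.div (by fun_prop) (by fun_prop) ?_
    have : 0 < max 0 (ε * q / 2) := lt_max_of_lt_right (by positivity)
    positivity
  simpa [ContinuousAt, kernelError] using this

/-- Dominated convergence: the error tends to 0 wherever exp(iθ) ≠ 1, which excludes only the end
point 2π of the half-open interval. -/
theorem tendsto_integral_kernelError {ε : ℝ} (hε : 0 < ε) :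
    Tendsto (fun d => ∫ θ in (0 : ℝ)..2 * Real.pi,
      kernelError ε d ‖Complex.exp (θ * Complex.I) - 1‖) (𝓝[>] 0) (𝓝 0) := by
  have := intervalIntegral.tendsto_integral_filter_of_dominated_convergence
    (μ := volume) (a := 0) (b := 2 * Real.pi) (l := 𝓝[>] (0 : ℝ))
    (F := fun d θ => kernelError ε d ‖Complex.exp (θ * Complex.I) - 1‖) (f := fun _ => (0 : ℝ))
    (fun _ => 2 / ε) ?_ ?_ intervalIntegrable_const ?_
  · simpa using this
  · filter_upwards [self_mem_nhdsWithin] with d hd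
    refine Continuous.aestronglyMeasurable ?_
    unfold kernelError
    refine Continuous.div (by fun_prop) (by fun_prop) fun θ => ?_
    have : 0 < max d (ε * ‖Complex.exp (θ * Complex.I) - 1‖ / 2) := lt_max_of_lt_left hd
    positivity
  · filter_upwards [self_mem_nhdsWithin] with d hd
    refine Eventually.of_forall fun θ _ => ?_
    rw [Real.norm_eq_abs, abs_of_nonneg (kernelError_nonneg (le_of_lt hd) (norm_nonneg _))]
    exact kernelError_le hε hd (norm_nonneg _)
  · have h1 : ∀ᵐ θ : ℝ, θ ∉ ({2 * Real.pi} : Set ℝ) :=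
      (Set.countable_singleton _).ae_notMem _
    filter_upwards [h1] with θ hθ hI
    rw [Set.uIoc_of_le Real.two_pi_pos.le] at hI
    refine (tendsto_kernelError hε ?_).mono_left nhdsWithin_le_nhds
    rw [norm_pos_iff, sub_ne_zero]
    intro h
    rw [Complex.exp_eq_one_iff] at h
    obtain ⟨n, hn⟩ := h
    have hn' : θ = n * (2 * Real.pi) := by
      have := mul_right_cancel₀ Complex.I_ne_zero (hn.trans (by ring :
        (n : ℂ) * (2 * Real.pi * Complex.I) = (n * (2 * Real.pi)) * Complex.I))
      exact_mod_cast this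
    have hpi := Real.two_pi_pos
    have hlt : θ < 2 * Real.pi := lt_of_le_of_ne hI.2 hθ
    have n1 : (0 : ℝ) < n := by
      by_contra hcon
      nlinarith [hI.1]
    have n2 : (n : ℝ) < 1 := by
      by_contra hcon
      nlinarith
    have n1' : 0 < n := by exact_mod_cast n1
    have n2' : n < 1 := by exact_mod_cast n2
    omega

/-- The Cauchy transform of `φ` on the boundary curve. -/
noncomputable def cauchyTransform {E : Type*} [NormedAddCommGroup E] [NormedSpace ℂ E]
    (φ : ℂ → E) (z : ℂ) : E :=
  (2 * Real.pi : ℂ)⁻¹ • ∫ θ in (0 : ℝ)..2 * Real.pi, S.kernel z θ • φ (S.point θ)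

theorem integral_kernelError_shift (ε d : ℝ) (θ₀ : ℝ) :
    ∫ θ in (0 : ℝ)..2 * Real.pi,
      kernelError ε d ‖Complex.exp (θ * Complex.I) - Complex.exp (θ₀ * Complex.I)‖ =
    ∫ θ in (0 : ℝ)..2 * Real.pi, kernelError ε d ‖Complex.exp (θ * Complex.I) - 1‖ := by
  set g : ℝ → ℝ := fun θ => kernelError ε d ‖Complex.exp (θ * Complex.I) - 1‖ with hg
  have h1 : ∀ θ : ℝ,
      kernelError ε d ‖Complex.exp (θ * Complex.I) - Complex.exp (θ₀ * Complex.I)‖ = g (θ - θ₀) := by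
    intro θ
    have : Complex.exp (θ * Complex.I) - Complex.exp (θ₀ * Complex.I) =
        Complex.exp (θ₀ * Complex.I) * (Complex.exp ((θ - θ₀ : ℝ) * Complex.I) - 1) := by
      rw [mul_sub, ← Complex.exp_add, mul_one]
      congr 2
      push_cast; ring
    rw [this, norm_mul, Complex.norm_exp_ofReal_mul_I, one_mul]
  have hper : Function.Periodic g (2 * Real.pi) := fun θ => by
    simp only [hg]
    congr 3
    push_cast
    rw [add_mul, Complex.exp_periodic]
  simp only [h1]
  rw [intervalIntegral.integral_comp_sub_right g θ₀]
  have := hper.intervalIntegral_add_eq (0 - θ₀) 0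
  rw [zero_add] at this
  rw [← this]
  congr 1
  ring

/-- Since φ integrates to 0 against the conjugate kernel at outer points, that kernel may be added
for free. The combined kernel has modulus close to its real part, and the real parts integrate to 2π
at the inner point and to 0 at the mirror point. -/
theorem norm_cauchyTransform_le_aux {ε d M : ℝ} (hd : 0 < d) (hε : ∀ θ, ε ≤ S.radius θ)
    {φ : ℂ → ℂ} (hφ : ContinuousOn φ S.body) (hM : ∀ z ∈ S.body, ‖φ z‖ ≤ M)
    (hanti : ∀ z ∉ S.body, ∫ θ in (0 : ℝ)..2 * Real.pi,
      (starRingEnd ℂ) (S.kernel z θ) • φ (S.point θ) = 0)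
    {r : ℝ} (hr : ∀ θ ∈ Set.Icc 0 (2 * Real.pi), S.radius θ ≤ r)
    {z : ℂ} (hz : z ∈ frontier (S.inner d)) :
    ‖S.cauchyTransform φ z‖ ≤ (2 * Real.pi)⁻¹ * (M * (2 * Real.pi + 4 * r *
      ∫ θ in (0 : ℝ)..2 * Real.pi, kernelError ε d ‖Complex.exp (θ * Complex.I) - 1‖)) := by
  obtain ⟨θ₀, hgap, hzθ⟩ := S.exists_of_mem_frontier_inner hz
  set z' := S.point θ₀ + d * Complex.exp (θ₀ * Complex.I) with hz'
  have hzin : z ∈ S.inner 0 := fun θ => hd.trans_le (hgap θ)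
  have hz'out : z' ∉ S.body := fun h => by
    have h1 := h θ₀
    have h2 := S.gap_point_self θ₀
    have h3 := Real.sin_sq_add_cos_sq θ₀
    simp only [gap] at h1 h2
    simp only [hz', Complex.add_re, Complex.add_im, Complex.mul_re, Complex.mul_im,
      Complex.ofReal_re, Complex.ofReal_im, Complex.exp_ofReal_mul_I_re,
      Complex.exp_ofReal_mul_I_im] at h1
    nlinarith
  have hM0 : 0 ≤ M := (norm_nonneg _).trans (hM _ (S.point_mem_body 0))
  have hc1 := S.continuous_kernel (S.point_sub_ne_zero hzin)
  have hc2 := S.continuous_kernel (S.point_sub_ne_zero_of_notMem hz'out)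
  have hcφ : Continuous fun θ => φ (S.point θ) :=
    hφ.comp_continuous S.continuous_point S.point_mem_body
  have hce : Continuous fun θ : ℝ =>
      kernelError ε d ‖Complex.exp (θ * Complex.I) - Complex.exp (θ₀ * Complex.I)‖ := by
    unfold kernelError
    refine Continuous.div (by fun_prop) (by fun_prop) fun θ => ?_
    have : 0 < max d (ε * ‖Complex.exp (θ * Complex.I) - Complex.exp (θ₀ * Complex.I)‖ / 2) :=
      lt_max_of_lt_left hd
    positivity
  have hcR := S.continuous_radius
  have hsum : S.cauchyTransform φ z = (2 * Real.pi : ℂ)⁻¹ • ∫ θ in (0 : ℝ)..2 * Real.pi,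
      (S.kernel z θ + (starRingEnd ℂ) (S.kernel z' θ)) • φ (S.point θ) := by
    simp only [add_smul]
    rw [intervalIntegral.integral_add, hanti z' hz'out, add_zero, cauchyTransform]
    · exact (hc1.smul hcφ).intervalIntegrable _ _
    · exact ((Complex.continuous_conj.comp hc2).smul hcφ).intervalIntegrable _ _
  rw [hsum, norm_smul, norm_inv]
  have h2π : ‖(2 * Real.pi : ℂ)‖ = 2 * Real.pi := by
    rw [norm_mul, Complex.norm_real, Real.norm_eq_abs, abs_of_pos Real.pi_pos]; simp
  rw [h2π]
  refine mul_le_mul_of_nonneg_left ?_ (inv_nonneg.2 Real.two_pi_pos.le)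
  have hbound : ∀ θ ∈ Set.Icc 0 (2 * Real.pi),
      ‖(S.kernel z θ + (starRingEnd ℂ) (S.kernel z' θ)) • φ (S.point θ)‖ ≤
      M * ((S.kernel z θ).re + (S.kernel z' θ).re + 4 * r *
        kernelError ε d ‖Complex.exp (θ * Complex.I) - Complex.exp (θ₀ * Complex.I)‖) := by
    intro θ hθ
    rw [norm_smul, mul_comm]
    refine mul_le_mul (hM _ (S.point_mem_body θ)) ?_ (norm_nonneg _) hM0
    rw [hzθ]
    refine (S.norm_kernel_add_conj_le hd hε (hzθ ▸ hgap) θ).trans ?_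
    have := kernelError_nonneg (ε := ε) hd.le
      (norm_nonneg (Complex.exp (θ * Complex.I) - Complex.exp (θ₀ * Complex.I)))
    have := hr θ hθ
    gcongr
  refine (intervalIntegral.norm_integral_le_of_norm_le Real.two_pi_pos.le
    (Eventually.of_forall fun θ hθ => hbound θ (Set.Ioc_subset_Icc_self hθ)) ?_).trans ?_
  · refine Continuous.intervalIntegrable ?_ _ _
    have := Complex.continuous_re.comp hc1
    have := Complex.continuous_re.comp hc2
    fun_prop
  · have i1 : IntervalIntegrable (fun θ => (S.kernel z θ).re) volume 0 (2 * Real.pi) :=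
      (Complex.continuous_re.comp hc1).intervalIntegrable _ _
    have i2 : IntervalIntegrable (fun θ => (S.kernel z' θ).re) volume 0 (2 * Real.pi) :=
      (Complex.continuous_re.comp hc2).intervalIntegrable _ _
    rw [intervalIntegral.integral_const_mul, intervalIntegral.integral_add (i1.add i2)
      ((hce.const_mul _).intervalIntegrable _ _), intervalIntegral.integral_add i1 i2,
      intervalIntegral.integral_const_mul, integral_kernelError_shift,
      S.integral_re_kernel (S.point_sub_ne_zero hzin),
      S.integral_re_kernel (S.point_sub_ne_zero_of_notMem hz'out),
      S.integral_kernel_of_mem hzin, S.integral_kernel_of_notMem hz'out]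
    simp

theorem cauchyTransform_eq (φ : ℂ → ℂ) (z : ℂ) : S.cauchyTransform φ z =
    (2 * Real.pi * Complex.I)⁻¹ * S.contour.integral fun w => φ w / (w - z) := by
  rw [contour_integral_div_sub, cauchyTransform, mul_inv _ Complex.I, mul_assoc,
    inv_mul_cancel_left₀ Complex.I_ne_zero]
  rfl

theorem differentiableOn_cauchyTransform {φ : ℂ → ℂ} (hφ : ContinuousOn φ S.body) :
    DifferentiableOn ℂ (S.cauchyTransform φ) (S.inner 0) := by
  simp only [funext (S.cauchyTransform_eq φ)]
  refine ((S.contour.differentiableOn_cauchyTransform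
    (hφ.mono S.contour_image_subset_body)).mono ?_).const_mul _
  intro z hz hz'
  rw [contour_image] at hz'
  obtain ⟨θ, rfl⟩ := hz'
  exact S.point_notMem_inner θ hz

/-- The Cauchy transform of an antianalytic function is bounded by the bound of the function. -/
theorem norm_cauchyTransform_le_of_scalar {ε M : ℝ} (hε0 : 0 < ε) (hε : ∀ θ, ε ≤ S.radius θ)
    {φ : ℂ → ℂ} (hφ : ContinuousOn φ S.body) (hM : ∀ z ∈ S.body, ‖φ z‖ ≤ M)
    (hanti : ∀ z ∉ S.body, ∫ θ in (0 : ℝ)..2 * Real.pi,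
      (starRingEnd ℂ) (S.kernel z θ) • φ (S.point θ) = 0)
    {z : ℂ} (hz : z ∈ S.inner 0) : ‖S.cauchyTransform φ z‖ ≤ M := by
  obtain ⟨r, hr⟩ := (isCompact_Icc (a := 0) (b := 2 * Real.pi)).exists_bound_of_continuousOn
    S.continuous_radius.continuousOn
  have hr' : ∀ θ ∈ Set.Icc 0 (2 * Real.pi), S.radius θ ≤ r := fun θ hθ =>
    (le_abs_self _).trans (hr θ hθ)
  have hlim : Tendsto (fun d => (2 * Real.pi)⁻¹ * (M * (2 * Real.pi + 4 * r *
      ∫ θ in (0 : ℝ)..2 * Real.pi, kernelError ε d ‖Complex.exp (θ * Complex.I) - 1‖)))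
      (𝓝[>] 0) (𝓝 M) := by
    have := (((tendsto_integral_kernelError hε0).const_mul (4 * r)).const_add
      (2 * Real.pi)).const_mul M |>.const_mul (2 * Real.pi)⁻¹
    have e : (2 * Real.pi)⁻¹ * (M * (2 * Real.pi + 4 * r * 0)) = M := by
      have := Real.pi_pos.ne'
      field_simp
      ring
    rwa [e] at this
  obtain ⟨θ₀, h0⟩ := S.exists_gap_le z
  refine ge_of_tendsto hlim ?_
  filter_upwards [Ioo_mem_nhdsGT (hz θ₀)] with d hd
  have hzd : z ∈ S.inner d := fun θ => hd.2.trans_le (h0 θ)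
  have hsub : closure (S.inner d) ⊆ S.inner 0 := fun w hw θ =>
    hd.1.trans_le (S.le_gap_of_mem_closure_inner hw θ)
  -- The maximum principle on the inner parallel body carries the frontier bound to z; as d tends to
  -- 0 that bound tends to M.
  refine Complex.norm_le_of_forall_mem_frontier_norm_le
    (S.isBounded_body.subset (S.inner_subset_body hd.1.le))
    (((S.differentiableOn_cauchyTransform hφ).mono hsub).diffContOnCl)
    (fun w hw => S.norm_cauchyTransform_le_aux hd.1 hε hφ hM hanti hr' hw) (subset_closure hzd)

/-- Continuous linear functionals commute with the transform and preserve the annihilation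
condition, so the scalar case and the dual characterization of the norm suffice. -/
theorem norm_cauchyTransform_le {E : Type*} [NormedAddCommGroup E] [NormedSpace ℂ E]
    [CompleteSpace E] {ε M : ℝ} (hε0 : 0 < ε) (hε : ∀ θ, ε ≤ S.radius θ)
    {φ : ℂ → E} (hφ : ContinuousOn φ S.body) (hM : ∀ z ∈ S.body, ‖φ z‖ ≤ M)
    (hanti : ∀ z ∉ S.body, ∫ θ in (0 : ℝ)..2 * Real.pi,
      (starRingEnd ℂ) (S.kernel z θ) • φ (S.point θ) = 0)
    {z : ℂ} (hz : z ∈ S.inner 0) : ‖S.cauchyTransform φ z‖ ≤ M := by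
  have hM0 : 0 ≤ M := (norm_nonneg _).trans (hM _ (S.point_mem_body 0))
  have hcφ : Continuous fun θ => φ (S.point θ) :=
    hφ.comp_continuous S.continuous_point S.point_mem_body
  have hcomm : ∀ (g : StrongDual ℂ E) (k : ℝ → ℂ), Continuous k →
      g (∫ θ in (0 : ℝ)..2 * Real.pi, k θ • φ (S.point θ)) =
      ∫ θ in (0 : ℝ)..2 * Real.pi, k θ • g (φ (S.point θ)) := fun g k hk => by
    have := g.intervalIntegral_comp_comm (μ := volume) (a := 0) (b := 2 * Real.pi)
      (f := fun θ => k θ • φ (S.point θ)) ((hk.smul hcφ).intervalIntegrable _ _)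
    simpa only [map_smul] using this.symm
  refine NormedSpace.norm_le_dual_bound ℂ _ hM0 fun g => ?_
  have e : g (S.cauchyTransform φ z) = S.cauchyTransform (fun w => g (φ w)) z := by
    rw [cauchyTransform, map_smul, hcomm g _ (S.continuous_kernel (S.point_sub_ne_zero hz)),
      cauchyTransform]
  rw [e]
  refine S.norm_cauchyTransform_le_of_scalar hε0 hε (g.continuous.comp_continuousOn hφ)
    (fun w hw => ?_) (fun w hw => ?_) hz
  · rw [mul_comm]
    exact (g.le_opNorm _).trans (mul_le_mul_of_nonneg_left (hM w hw) (norm_nonneg _))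
  · have := hcomm g (fun θ => (starRingEnd ℂ) (S.kernel w θ))
      (Complex.continuous_conj.comp (S.continuous_kernel (S.point_sub_ne_zero_of_notMem hw)))
    rw [hanti w hw, map_zero] at this
    exact this.symm

end SupportFunction

/-! ### Runge approximation through a Banach algebra -/

section ClosedSubspace

variable {E : Type*} [NormedAddCommGroup E] [NormedSpace ℂ E] [CompleteSpace E]

/-- The interval has length 1, so the integral is an average of elements of a closed convex set. -/
theorem Submodule.intervalIntegral_mem {K : Submodule ℂ E} (hK : IsClosed (K : Set E)) {f : ℝ → E}
    (hf : IntervalIntegrable f volume 0 1) (hfK : ∀ t ∈ Set.Icc (0 : ℝ) 1, f t ∈ K) :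
    ∫ t in (0 : ℝ)..1, f t ∈ K := by
  rw [intervalIntegral.integral_of_le zero_le_one]
  have : IsProbabilityMeasure (volume.restrict (Set.Ioc (0 : ℝ) 1)) := ⟨by simp⟩
  let _ : NormedSpace ℝ E := NormedSpace.restrictScalars ℝ ℂ E
  refine Convex.integral_mem (s := (K : Set E)) ((K.restrictScalars ℝ).convex) hK ?_ hf.1
  rw [ae_restrict_iff' measurableSet_Ioc]
  exact Eventually.of_forall fun t ht => hfK t (Set.Ioc_subset_Icc_self ht)

end ClosedSubspace

open scoped Matrix.Norms.L2Operator

namespace SupportFunction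

variable (S : SupportFunction)

instance : CompactSpace S.body := isCompact_iff_compactSpace.1 S.isCompact_body

/-- From an outer point the ray along the normal of a separating line never meets the body. -/
theorem not_isBounded_connectedComponentIn {w : ℂ} (hw : w ∉ S.body) :
    ¬ Bornology.IsBounded (connectedComponentIn S.bodyᶜ w) := by
  have hw' := hw
  simp only [body, Set.mem_ofPred_eq, not_forall, not_le] at hw
  obtain ⟨θ, hθ⟩ := hw
  set r : ℝ → ℂ := fun t => w + t * Complex.exp (θ * Complex.I) with hr
  have hsub : r '' Set.Ici 0 ⊆ connectedComponentIn S.bodyᶜ w := by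
    refine IsPreconnected.subset_connectedComponentIn
      (isPreconnected_Ici.image _ (by fun_prop)) ⟨0, Set.self_mem_Ici, by simp [hr]⟩ ?_
    rintro _ ⟨t, ht, rfl⟩ hmem
    have h1 := hmem θ
    have h3 := Real.sin_sq_add_cos_sq θ
    simp only [gap] at h1 hθ
    simp only [hr, Complex.add_re, Complex.add_im, Complex.mul_re, Complex.mul_im,
      Complex.ofReal_re, Complex.ofReal_im, Complex.exp_ofReal_mul_I_re,
      Complex.exp_ofReal_mul_I_im] at h1
    have : (0 : ℝ) ≤ t := ht
    nlinarith
  intro hb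
  obtain ⟨M, hM⟩ := (hb.subset hsub).exists_norm_le
  have h1 := hM _ ⟨|M| + ‖w‖ + 1, by simp only [Set.mem_Ici]; positivity, rfl⟩
  have h2 : ‖((|M| + ‖w‖ + 1 : ℝ) : ℂ) * Complex.exp (θ * Complex.I)‖ = |M| + ‖w‖ + 1 := by
    rw [norm_mul, Complex.norm_exp_ofReal_mul_I, mul_one, Complex.norm_real, Real.norm_eq_abs,
      abs_of_nonneg (by positivity)]
  have h3 := norm_sub_norm_le (((|M| + ‖w‖ + 1 : ℝ) : ℂ) * Complex.exp (θ * Complex.I)) (-w)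
  rw [sub_neg_eq_add, add_comm _ w, norm_neg, h2] at h3
  simp only [hr] at h1
  linarith [le_abs_self M]

variable {m : Type*} [Fintype m] [DecidableEq m]

/-- The pair of the coordinate function on the body and the matrix `A`; polynomials in it are
pairs of the restriction of a polynomial `p` and of `p(A)`. -/
noncomputable def coordPair (A : Matrix m m ℂ) : C(S.body, ℂ) × Matrix m m ℂ :=
  (⟨fun z => z, continuous_subtype_val⟩, A)

theorem aeval_coordPair_fst (A : Matrix m m ℂ) (p : Polynomial ℂ) (z : S.body) :
    (Polynomial.aeval (S.coordPair A) p).1 z = p.eval z.1 := by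
  have := Polynomial.aeval_algHom_apply
    ((ContinuousMap.evalAlgHom ℂ ℂ z).comp (AlgHom.fst ℂ C(S.body, ℂ) (Matrix m m ℂ)))
    (S.coordPair A) p
  rw [← Polynomial.coe_aeval_eq_eval]
  exact this.symm

theorem aeval_coordPair_snd (A : Matrix m m ℂ) (p : Polynomial ℂ) :
    (Polynomial.aeval (S.coordPair A) p).2 = Polynomial.aeval A p := by
  have := Polynomial.aeval_algHom_apply
    (AlgHom.snd ℂ C(S.body, ℂ) (Matrix m m ℂ)) (S.coordPair A) p
  exact this.symm

/-- The closure of the polynomials in `coordPair A`. -/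
noncomputable def polynomialClosure (A : Matrix m m ℂ) :
    Subalgebra ℂ (C(S.body, ℂ) × Matrix m m ℂ) :=
  (Algebra.adjoin ℂ {S.coordPair A}).topologicalClosure

theorem isClosed_polynomialClosure (A : Matrix m m ℂ) :
    IsClosed (S.polynomialClosure A : Set (C(S.body, ℂ) × Matrix m m ℂ)) :=
  Subalgebra.isClosed_topologicalClosure _

theorem coordPair_mem (A : Matrix m m ℂ) : S.coordPair A ∈ S.polynomialClosure A :=
  Subalgebra.le_topologicalClosure _ (Algebra.subset_adjoin rfl)

theorem spectrum_coordPair_subset {A : Matrix m m ℂ} (hA : spectrum ℂ A ⊆ S.body) :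
    spectrum ℂ (S.coordPair A) ⊆ S.body := by
  intro w hw
  by_contra hwS
  refine hw (Prod.isUnit_iff.2 ⟨?_, ?_⟩)
  · refine (ContinuousMap.isUnit_iff_forall_ne_zero _).2 fun z => ?_
    change w - z.1 ≠ 0
    exact fun h => hwS (by rw [sub_eq_zero.1 h]; exact z.2)
  · have : w ∉ spectrum ℂ A := fun h => hwS (hA h)
    exact spectrum.notMem_iff.1 this

/-- Passing to a closed subalgebra enlarges a spectrum only by bounded components of its complement.
The complement of a convex body has none, so the resolvent at w already lies in the closure of the
polynomials. -/
theorem inverse_mem_polynomialClosure {A : Matrix m m ℂ} (hA : spectrum ℂ A ⊆ S.body) {w : ℂ}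
    (hw : w ∉ S.body) :
    Ring.inverse (algebraMap ℂ _ w - S.coordPair A) ∈ S.polynomialClosure A := by
  have : IsClosed (S.polynomialClosure A : Set (C(S.body, ℂ) × Matrix m m ℂ)) :=
    S.isClosed_polynomialClosure A
  have hw' : w ∉ spectrum ℂ (⟨S.coordPair A, S.coordPair_mem A⟩ : S.polynomialClosure A) := by
    intro h
    have hb := Subalgebra.spectrum_isBounded_connectedComponentIn (S.polynomialClosure A)
      (⟨S.coordPair A, S.coordPair_mem A⟩ : S.polynomialClosure A) h
    exact S.not_isBounded_connectedComponentIn hw (hb.subset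
      (connectedComponentIn_mono _ (Set.compl_subset_compl.2 (S.spectrum_coordPair_subset hA))))
  obtain ⟨u, hu⟩ := spectrum.notMem_iff.1 hw'
  have h1 : (u : S.polynomialClosure A).1 * (↑u⁻¹ : S.polynomialClosure A).1 = 1 := by
    rw [← MulMemClass.coe_mul, u.mul_inv]; rfl
  have h2 : (↑u⁻¹ : S.polynomialClosure A).1 * (u : S.polynomialClosure A).1 = 1 := by
    rw [← MulMemClass.coe_mul, u.inv_mul]; rfl
  have h3 : (u : S.polynomialClosure A).1 = algebraMap ℂ _ w - S.coordPair A := by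
    rw [hu]; rfl
  have h4 : Ring.inverse (algebraMap ℂ _ w - S.coordPair A) = (↑u⁻¹ : S.polynomialClosure A).1 := by
    rw [← h3]
    exact Ring.inverse_unit (⟨_, _, h1, h2⟩ : (C(S.body, ℂ) × Matrix m m ℂ)ˣ)
  rw [h4]
  exact (↑u⁻¹ : S.polynomialClosure A).2

theorem isUnit_sub_coordPair {A : Matrix m m ℂ} (hA : spectrum ℂ A ⊆ S.body) {w : ℂ}
    (hw : w ∉ S.body) : IsUnit (algebraMap ℂ _ w - S.coordPair A) :=
  spectrum.notMem_iff.1 fun h => hw (S.spectrum_coordPair_subset hA h)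

theorem inverse_sub_coordPair_fst {A : Matrix m m ℂ} (hA : spectrum ℂ A ⊆ S.body) {w : ℂ}
    (hw : w ∉ S.body) (z : S.body) :
    (Ring.inverse (algebraMap ℂ _ w - S.coordPair A)).1 z = (w - z.1)⁻¹ := by
  have h := Ring.mul_inverse_cancel _ (S.isUnit_sub_coordPair hA hw)
  have h1 : (w - z.1) * (Ring.inverse (algebraMap ℂ _ w - S.coordPair A)).1 z = 1 :=
    DFunLike.congr_fun (congrArg Prod.fst h) z
  exact eq_inv_of_mul_eq_one_right h1

theorem inverse_sub_coordPair_snd {A : Matrix m m ℂ} (hA : spectrum ℂ A ⊆ S.body) {w : ℂ}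
    (hw : w ∉ S.body) :
    (Ring.inverse (algebraMap ℂ _ w - S.coordPair A)).2 = (w • (1 : Matrix m m ℂ) - A)⁻¹ := by
  have h := Ring.mul_inverse_cancel _ (S.isUnit_sub_coordPair hA hw)
  have h1 : (algebraMap ℂ _ w - A) * (Ring.inverse (algebraMap ℂ _ w - S.coordPair A)).2 = 1 :=
    congrArg Prod.snd h
  rw [← Algebra.algebraMap_eq_smul_one]
  exact (Matrix.inv_eq_right_inv h1).symm

/-- A form of Runge's theorem: Cauchy integrals over a contour outside a convex body are, together
with their values at a matrix, limits of polynomials. -/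
theorem exists_polynomial_near {A : Matrix m m ℂ} (hA : spectrum ℂ A ⊆ S.body) (Γ : Contour)
    (hΓ : Disjoint Γ.image S.body) {φ : ℂ → ℂ} (hφ : ContinuousOn φ Γ.image) {δ : ℝ}
    (hδ : 0 < δ) : ∃ p : Polynomial ℂ,
      (∀ z ∈ S.body, ‖Γ.integral (fun w => φ w / (w - z)) - p.eval z‖ < δ) ∧
      ∀ i j, ‖Γ.integral (fun w => φ w * (w • (1 : Matrix m m ℂ) - A)⁻¹ i j)
        - Polynomial.aeval A p i j‖ < δ := by
  set X := C(S.body, ℂ) × Matrix m m ℂ with hX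
  set e : ℂ → X := fun w => Ring.inverse (algebraMap ℂ _ w - S.coordPair A) with he
  have hnot : ∀ w ∈ Γ.image, w ∉ S.body := fun w hw => Set.disjoint_left.1 hΓ hw
  have hec : ContinuousOn e Γ.image := by
    intro w hw
    obtain ⟨u, hu⟩ := S.isUnit_sub_coordPair hA (hnot w hw)
    have h1 : ContinuousAt Ring.inverse (algebraMap ℂ X w - S.coordPair A) :=
      hu ▸ NormedRing.inverse_continuousAt u
    have h2 : ContinuousAt (fun w => algebraMap ℂ X w - S.coordPair A) w :=
      ((continuous_algebraMap ℂ X).sub continuous_const).continuousAt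
    exact (ContinuousAt.comp (f := fun w => algebraMap ℂ X w - S.coordPair A) h1 h2).continuousWithinAt
  have hint : ∀ i, IntervalIntegrable
      (fun t => deriv (Γ.curve i).toFun t • (φ ((Γ.curve i).toFun t) • e ((Γ.curve i).toFun t)))
      volume 0 1 := fun i => (Γ.curve i).integrable_deriv_smul
    (ContinuousOn.smul
      (hφ.comp (Γ.curve i).continuousOn' fun t ht => Γ.trace_subset_image i ⟨t, ht, rfl⟩)
      (hec.comp (Γ.curve i).continuousOn' fun t ht => Γ.trace_subset_image i ⟨t, ht, rfl⟩))
  -- The Cauchy integral is taken once in C(S) × matrices. It stays in the closed polynomial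
  -- algebra, so a single polynomial approximates the function and its value at A together.
  set Y : X := ∑ i, ∫ t in (0 : ℝ)..1,
    deriv (Γ.curve i).toFun t • (φ ((Γ.curve i).toFun t) • e ((Γ.curve i).toFun t)) with hY
  have hYmem : Y ∈ S.polynomialClosure A := by
    refine sum_mem fun i _ => ?_
    refine Submodule.intervalIntegral_mem (K := (S.polynomialClosure A).toSubmodule)
      (S.isClosed_polynomialClosure A) (hint i) fun t ht => ?_
    refine Submodule.smul_mem _ _ (Submodule.smul_mem _ _ ?_)
    exact S.inverse_mem_polynomialClosure hA (hnot _ (Γ.trace_subset_image i ⟨t, ht, rfl⟩))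
  have hclm : ∀ (g : X →L[ℂ] ℂ), g Y = Γ.integral fun w => φ w * g (e w) := by
    intro g
    rw [hY, map_sum, Contour.integral_eq_sum]
    refine Finset.sum_congr rfl fun i _ => ?_
    rw [← g.intervalIntegral_comp_comm (hint i)]
    refine intervalIntegral.integral_congr fun t _ => ?_
    simp only [map_smul, smul_eq_mul]
    ring
  have hY1 : ∀ z : S.body, Y.1 z = Γ.integral fun w => φ w / (w - z.1) := by
    intro z
    have := hclm ((ContinuousMap.evalCLM ℂ z).comp (ContinuousLinearMap.fst ℂ _ _))
    refine this.trans (Γ.integral_congr fun w hw => ?_)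
    change φ w * (e w).1 z = _
    rw [he, S.inverse_sub_coordPair_fst hA (hnot w hw), div_eq_mul_inv]
  have hY2 : ∀ i j, Y.2 i j = Γ.integral fun w => φ w * (w • (1 : Matrix m m ℂ) - A)⁻¹ i j := by
    intro i j
    have := hclm (((Matrix.entryLinearMap ℂ ℂ i j).toContinuousLinearMap).comp
      (ContinuousLinearMap.snd ℂ _ _))
    refine this.trans (Γ.integral_congr fun w hw => ?_)
    change φ w * (e w).2 i j = _
    rw [he, S.inverse_sub_coordPair_snd hA (hnot w hw)]
  have hopen : {y : X | ‖Y.1 - y.1‖ < δ ∧ ∀ i j, ‖Y.2 i j - y.2 i j‖ < δ} ∈ 𝓝 Y := by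
    have h1 : ∀ᶠ y : X in 𝓝 Y, ‖Y.1 - y.1‖ < δ := by
      have : ContinuousAt (fun y : X => ‖Y.1 - y.1‖) Y :=
        (continuous_const.sub continuous_fst).norm.continuousAt
      refine this.eventually_lt continuousAt_const ?_
      simpa using hδ
    have h2 : ∀ᶠ y : X in 𝓝 Y, ∀ i j, ‖Y.2 i j - y.2 i j‖ < δ := by
      rw [eventually_all]; intro i
      rw [eventually_all]; intro j
      have : ContinuousAt (fun y : X => ‖Y.2 i j - y.2 i j‖) Y :=
        (continuous_const.sub (continuous_snd.matrix_elem i j)).norm.continuousAt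
      refine this.eventually_lt continuousAt_const ?_
      simpa using hδ
    exact h1.and h2
  obtain ⟨y, ⟨hy1, hy2⟩, hy⟩ := mem_closure_iff_nhds.1 hYmem _ hopen
  rw [Algebra.adjoin_singleton_eq_range_aeval] at hy
  obtain ⟨p, rfl⟩ := hy
  refine ⟨p, fun z hz => ?_, fun i j => ?_⟩
  · have := (ContinuousMap.norm_coe_le_norm _ (⟨z, hz⟩ : S.body)).trans_lt hy1
    rw [← hY1 ⟨z, hz⟩]
    refine lt_of_eq_of_lt ?_ this
    rw [ContinuousMap.sub_apply, ← S.aeval_coordPair_fst A p ⟨z, hz⟩]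
    rfl
  · rw [← hY2 i j, ← S.aeval_coordPair_snd A p]
    exact hy2 i j

end SupportFunction

/-! ### Operator norm inequalities for matrices -/

open scoped ComplexOrder

namespace Matrix

variable {m n : Type*} [Fintype m] [Fintype n] [DecidableEq m] [DecidableEq n]

theorem norm_toLp_mulVec_le (M : Matrix m n ℂ) (v : n → ℂ) :
    ‖WithLp.toLp 2 (M *ᵥ v)‖ ≤ ‖M‖ * ‖WithLp.toLp 2 v‖ :=
  M.l2_opNorm_mulVec (WithLp.toLp 2 v)

theorem l2_opNorm_le_of_forall {M : Matrix m n ℂ} {C : ℝ} (hC : 0 ≤ C)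
    (h : ∀ v : n → ℂ, ‖WithLp.toLp 2 (M *ᵥ v)‖ ≤ C * ‖WithLp.toLp 2 v‖) : ‖M‖ ≤ C := by
  rw [l2_opNorm_def]
  exact ContinuousLinearMap.opNorm_le_bound _ hC fun v => h v.ofLp

theorem norm_entry_le_l2_opNorm (M : Matrix m n ℂ) (i : m) (j : n) : ‖M i j‖ ≤ ‖M‖ := by
  have h1 := M.norm_toLp_mulVec_le (Pi.single j 1)
  have h2 : ‖WithLp.toLp 2 (Pi.single j 1 : n → ℂ)‖ = 1 := by
    change ‖EuclideanSpace.single j (1 : ℂ)‖ = 1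
    simp
  rw [h2, mul_one, mulVec_single_one] at h1
  exact (PiLp.norm_apply_le (WithLp.toLp 2 (M.col j)) i).trans h1

theorem norm_dotProduct_le (x y : n → ℂ) :
    ‖star x ⬝ᵥ y‖ ≤ ‖WithLp.toLp 2 x‖ * ‖WithLp.toLp 2 y‖ := by
  have := norm_inner_le_norm (𝕜 := ℂ) (WithLp.toLp 2 x) (WithLp.toLp 2 y)
  rwa [EuclideanSpace.inner_toLp_toLp, dotProduct_comm] at this

theorem dotProduct_self_eq_norm_sq (x : n → ℂ) :
    star x ⬝ᵥ x = ((‖WithLp.toLp 2 x‖ ^ 2 : ℝ) : ℂ) := by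
  have := inner_self_eq_norm_sq_to_K (𝕜 := ℂ) (WithLp.toLp 2 x)
  rw [EuclideanSpace.inner_toLp_toLp, dotProduct_comm] at this
  rw [this]
  simp

/-- Equivalence of norms in finite dimension; it turns entrywise polynomial approximation into
approximation in operator norm. -/
theorem exists_l2_opNorm_le_of_entries (m n : Type*) [Fintype m] [Fintype n] [DecidableEq m]
    [DecidableEq n] : ∃ C : ℝ, 0 ≤ C ∧
    ∀ (M : Matrix m n ℂ) (δ : ℝ), 0 ≤ δ → (∀ i j, ‖M i j‖ ≤ δ) → ‖M‖ ≤ C * δ := by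
  set L : (m → n → ℂ) →L[ℂ] Matrix m n ℂ :=
    LinearMap.toContinuousLinearMap (Matrix.ofLinearEquiv ℂ).toLinearMap
  refine ⟨‖L‖, L.opNorm_nonneg, fun M δ hδ h => ?_⟩
  refine (L.le_opNorm M).trans (mul_le_mul_of_nonneg_left ?_ L.opNorm_nonneg)
  exact (pi_norm_le_iff_of_nonneg hδ).2 fun i =>
    (pi_norm_le_iff_of_nonneg hδ).2 fun j => h i j

theorem l2_opNorm_one_le : ‖(1 : Matrix n n ℂ)‖ ≤ 1 :=
  l2_opNorm_le_of_forall zero_le_one fun v => by rw [one_mulVec, one_mul]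

theorem norm_toLp_prod_sq (y : n × m → ℂ) :
    ‖WithLp.toLp 2 y‖ ^ 2 = ∑ i, ‖WithLp.toLp 2 fun j => y (j, i)‖ ^ 2 := by
  simp only [EuclideanSpace.norm_sq_eq]
  rw [Fintype.sum_prod_type_right]

theorem l2_opNorm_kronecker_one_le (Φ : Matrix n n ℂ) :
    ‖Φ ⊗ₖ (1 : Matrix m m ℂ)‖ ≤ ‖Φ‖ := by
  refine l2_opNorm_le_of_forall (norm_nonneg _) fun y => ?_
  refine le_of_sq_le_sq ?_ (by positivity)
  have h1 : ∀ i, (fun j => ((Φ ⊗ₖ (1 : Matrix m m ℂ)) *ᵥ y) (j, i)) = Φ *ᵥ fun j => y (j, i) := by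
    intro i
    ext j
    simp only [mulVec, dotProduct, kroneckerMap_apply, Fintype.sum_prod_type]
    refine Finset.sum_congr rfl fun k _ => ?_
    simp [one_apply]
  rw [mul_pow, norm_toLp_prod_sq, norm_toLp_prod_sq y, Finset.mul_sum]
  refine Finset.sum_le_sum fun i _ => ?_
  rw [h1, ← mul_pow]
  exact pow_le_pow_left₀ (norm_nonneg _) (Φ.norm_toLp_mulVec_le _) 2

/-- A weighted Cauchy-Schwarz inequality. -/
theorem norm_dotProduct_kronecker_le {Φ : Matrix n n ℂ} {M : ℝ} (hΦ : ‖Φ‖ ≤ M)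
    {μ : Matrix m m ℂ} (hμ : μ.PosSemidef) (x y : n × m → ℂ) :
    ‖star x ⬝ᵥ ((Φ ⊗ₖ μ) *ᵥ y)‖ ≤
      M / 2 * ((star x ⬝ᵥ (((1 : Matrix n n ℂ) ⊗ₖ μ) *ᵥ x)).re +
        (star y ⬝ᵥ (((1 : Matrix n n ℂ) ⊗ₖ μ) *ᵥ y)).re) := by
  -- Factoring the weight as L*L moves it onto the vectors and leaves Φ ⊗ 1, whose norm is at most
  -- that of Φ.
  obtain ⟨L, rfl⟩ : ∃ L : Matrix m m ℂ, μ = Lᴴ * L := by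
    open scoped MatrixOrder in
    obtain ⟨L, hL⟩ := CStarAlgebra.nonneg_iff_eq_star_mul_self.1 hμ.nonneg
    exact ⟨L, hL⟩
  set D := (1 : Matrix n n ℂ) ⊗ₖ L with hD
  have h1 : ∀ Ψ : Matrix n n ℂ, Ψ ⊗ₖ (Lᴴ * L) = Dᴴ * ((Ψ ⊗ₖ (1 : Matrix m m ℂ)) * D) := by
    intro Ψ
    rw [hD, conjTranspose_kronecker, ← mul_kronecker_mul, ← mul_kronecker_mul]
    simp
  have h2 : ∀ (Ψ : Matrix n n ℂ) (u v : n × m → ℂ),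
      star u ⬝ᵥ ((Ψ ⊗ₖ (Lᴴ * L)) *ᵥ v) =
        star (D *ᵥ u) ⬝ᵥ ((Ψ ⊗ₖ (1 : Matrix m m ℂ)) *ᵥ (D *ᵥ v)) := by
    intro Ψ u v
    rw [h1, ← mulVec_mulVec, ← mulVec_mulVec, dotProduct_mulVec, star_mulVec]
  have h3 : ∀ u, (star u ⬝ᵥ (((1 : Matrix n n ℂ) ⊗ₖ (Lᴴ * L)) *ᵥ u)).re =
      ‖WithLp.toLp 2 (D *ᵥ u)‖ ^ 2 := by
    intro u
    rw [h2, one_kronecker_one, one_mulVec, dotProduct_self_eq_norm_sq, Complex.ofReal_re]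
  rw [h3, h3, h2]
  have hM : 0 ≤ M := (norm_nonneg _).trans hΦ
  have h4 := (Φ ⊗ₖ (1 : Matrix m m ℂ)).norm_toLp_mulVec_le (D *ᵥ y)
  have h5 : ‖WithLp.toLp 2 ((Φ ⊗ₖ (1 : Matrix m m ℂ)) *ᵥ (D *ᵥ y))‖ ≤
      M * ‖WithLp.toLp 2 (D *ᵥ y)‖ :=
    h4.trans (mul_le_mul_of_nonneg_right ((l2_opNorm_kronecker_one_le Φ).trans hΦ) (norm_nonneg _))
  refine (norm_dotProduct_le _ _).trans ?_
  have h6 := mul_le_mul_of_nonneg_left h5 (norm_nonneg (WithLp.toLp 2 (D *ᵥ x)))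
  nlinarith [mul_nonneg hM (sq_nonneg (‖WithLp.toLp 2 (D *ᵥ x)‖ - ‖WithLp.toLp 2 (D *ᵥ y)‖))]

theorem l2_opNorm_le_of_bilin {T : Matrix n n ℂ} {C : ℝ}
    (h : ∀ x y : n → ℂ, ‖star x ⬝ᵥ (T *ᵥ y)‖ ≤
      C * (‖WithLp.toLp 2 x‖ ^ 2 + ‖WithLp.toLp 2 y‖ ^ 2)) (hC : 0 ≤ C) : ‖T‖ ≤ 2 * C := by
  refine l2_opNorm_le_of_forall (by positivity) fun y => ?_
  set a := ‖WithLp.toLp 2 (T *ᵥ y)‖ with ha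
  set b := ‖WithLp.toLp 2 y‖ with hb
  rcases (norm_nonneg (WithLp.toLp 2 (T *ᵥ y))).eq_or_lt with h0 | h0
  · rw [ha, ← h0]; positivity
  rw [← ha] at h0
  -- The test vector is a multiple of Ty with the same norm b as y, which balances the two squares
  -- and yields ba ≤ 2Cb².
  have h1 := h (((b / a : ℝ) : ℂ) • (T *ᵥ y)) y
  have hb0 : 0 ≤ b := norm_nonneg _
  have hba : ‖((b / a : ℝ) : ℂ)‖ = b / a := by
    rw [Complex.norm_real, Real.norm_eq_abs, abs_of_nonneg (by positivity)]
  have e1 : ‖WithLp.toLp 2 (((b / a : ℝ) : ℂ) • (T *ᵥ y))‖ = b := by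
    rw [WithLp.toLp_smul, norm_smul, hba, ← ha, div_mul_cancel₀ _ h0.ne']
  have e2 : ‖star (((b / a : ℝ) : ℂ) • (T *ᵥ y)) ⬝ᵥ (T *ᵥ y)‖ = b * a := by
    rw [star_smul, smul_dotProduct, dotProduct_self_eq_norm_sq, ← ha, norm_smul, norm_star, hba,
      Complex.norm_real, Real.norm_eq_abs, abs_of_nonneg (by positivity)]
    field_simp
  rw [e1, e2, ← hb] at h1
  rcases hb0.eq_or_lt with hb1 | hb1
  · have : y = 0 := by
      have := norm_eq_zero.1 hb1.symm
      simpa using this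
    simp [ha, this] at h0
  · nlinarith

/-- The C*-identity used twice gives ‖T‖⁴ = ‖T T* T T*‖ ≤ ‖T T* T‖ ‖T‖. -/
theorem norm_pow_three_le (T : Matrix n n ℂ) : ‖T‖ ^ 3 ≤ ‖T * Tᴴ * T‖ := by
  rcases (norm_nonneg T).eq_or_lt with h | h
  · rw [← h]; simp
  have h1 : ‖T * Tᴴ‖ = ‖T‖ * ‖T‖ := CStarRing.norm_self_mul_star (x := T)
  have h2 : ‖(T * Tᴴ)ᴴ * (T * Tᴴ)‖ = ‖T * Tᴴ‖ * ‖T * Tᴴ‖ := l2_opNorm_conjTranspose_mul_self _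
  have h3 : (T * Tᴴ)ᴴ * (T * Tᴴ) = T * Tᴴ * T * Tᴴ := by
    rw [conjTranspose_mul, conjTranspose_conjTranspose]; simp only [Matrix.mul_assoc]
  rw [h3, h1] at h2
  have h4 := norm_mul_le (T * Tᴴ * T) Tᴴ
  rw [h2, l2_opNorm_conjTranspose] at h4
  have : ‖T‖ * ‖T‖ ^ 3 ≤ ‖T‖ * ‖T * Tᴴ * T‖ := by nlinarith
  exact le_of_mul_le_mul_left this h

end Matrix

/-! ### Numerical ranges, spectra and resolvents -/

section NumericalRange

variable {m : Type*} [Fintype m] [DecidableEq m]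

theorem mem_numericalRange_iff {A : Matrix m m ℂ} {z : ℂ} : z ∈ numericalRange A ↔
    ∃ v : m → ℂ, ‖WithLp.toLp 2 v‖ = 1 ∧ z = star v ⬝ᵥ (A *ᵥ v) :=
  ⟨fun ⟨v, hv, hz⟩ => ⟨v.ofLp, hv, hz⟩, fun ⟨v, hv, hz⟩ => ⟨WithLp.toLp 2 v, hv, hz⟩⟩

theorem exists_dotProduct_mulVec_eq (A : Matrix m m ℂ) {v : m → ℂ} (hv : v ≠ 0) :
    ∃ z ∈ numericalRange A, star v ⬝ᵥ (A *ᵥ v) = ((‖WithLp.toLp 2 v‖ ^ 2 : ℝ) : ℂ) * z := by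
  set r := ‖WithLp.toLp 2 v‖ with hr
  have hr0 : r ≠ 0 := by
    rw [hr, norm_ne_zero_iff]; simpa using hv
  refine ⟨_, mem_numericalRange_iff.2 ⟨((r⁻¹ : ℝ) : ℂ) • v, ?_, rfl⟩, ?_⟩
  · rw [WithLp.toLp_smul, norm_smul, ← hr, Complex.norm_real, Real.norm_eq_abs,
      abs_of_nonneg (inv_nonneg.2 (norm_nonneg _)), inv_mul_cancel₀ hr0]
  · rw [star_smul, Matrix.mulVec_smul, smul_dotProduct, dotProduct_smul]
    simp only [smul_eq_mul, Complex.star_def, Complex.conj_ofReal]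
    push_cast
    have : (r : ℂ) ≠ 0 := by exact_mod_cast hr0
    field_simp

theorem exists_mulVec_eq_of_mem_spectrum {A : Matrix m m ℂ} {w : ℂ} (hw : w ∈ spectrum ℂ A) :
    ∃ v ≠ 0, A *ᵥ v = w • v := by
  rw [spectrum.mem_iff, Matrix.isUnit_iff_isUnit_det, isUnit_iff_ne_zero, not_not,
    ← Matrix.exists_mulVec_eq_zero_iff] at hw
  obtain ⟨v, hv, h⟩ := hw
  refine ⟨v, hv, ?_⟩
  rw [Algebra.algebraMap_eq_smul_one, Matrix.sub_mulVec, Matrix.smul_mulVec, Matrix.one_mulVec,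
    sub_eq_zero] at h
  exact h.symm

theorem spectrum_subset_numericalRange (A : Matrix m m ℂ) :
    spectrum ℂ A ⊆ numericalRange A := by
  intro w hw
  obtain ⟨v, hv, h⟩ := exists_mulVec_eq_of_mem_spectrum hw
  obtain ⟨z, hz, h2⟩ := exists_dotProduct_mulVec_eq A hv
  rw [h, dotProduct_smul, Matrix.dotProduct_self_eq_norm_sq, smul_eq_mul, mul_comm] at h2
  have : ((‖WithLp.toLp 2 v‖ ^ 2 : ℝ) : ℂ) ≠ 0 := by
    have : ‖WithLp.toLp 2 v‖ ≠ 0 := by rw [norm_ne_zero_iff]; simpa using hv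
    exact_mod_cast pow_ne_zero 2 this
  rwa [mul_left_cancel₀ this h2]

theorem isUnit_smul_one_sub {A : Matrix m m ℂ} {w : ℂ} (hw : w ∉ spectrum ℂ A) :
    IsUnit (w • (1 : Matrix m m ℂ) - A) := by
  rw [← Algebra.algebraMap_eq_smul_one]
  exact spectrum.notMem_iff.1 hw

theorem resolvent_mul_cancel {A : Matrix m m ℂ} {w : ℂ} (hw : w ∉ spectrum ℂ A) :
    (w • (1 : Matrix m m ℂ) - A)⁻¹ * (w • (1 : Matrix m m ℂ) - A) = 1 :=
  Matrix.nonsing_inv_mul _ ((Matrix.isUnit_iff_isUnit_det _).1 (isUnit_smul_one_sub hw))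

theorem mul_resolvent_cancel {A : Matrix m m ℂ} {w : ℂ} (hw : w ∉ spectrum ℂ A) :
    (w • (1 : Matrix m m ℂ) - A) * (w • (1 : Matrix m m ℂ) - A)⁻¹ = 1 :=
  Matrix.mul_nonsing_inv _ ((Matrix.isUnit_iff_isUnit_det _).1 (isUnit_smul_one_sub hw))

theorem smul_resolvent_eq {A : Matrix m m ℂ} {w : ℂ} (hw : w ∉ spectrum ℂ A) :
    w • (w • (1 : Matrix m m ℂ) - A)⁻¹ = 1 + A * (w • (1 : Matrix m m ℂ) - A)⁻¹ := by
  have := mul_resolvent_cancel hw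
  rw [sub_mul, smul_mul_assoc, one_mul, sub_eq_iff_eq_add] at this
  exact this

theorem norm_resolvent_le {A : Matrix m m ℂ} {w : ℂ} (hw : w ∉ spectrum ℂ A) (h : ‖A‖ < ‖w‖) :
    ‖(w • (1 : Matrix m m ℂ) - A)⁻¹‖ ≤ (‖w‖ - ‖A‖)⁻¹ := by
  set X := (w • (1 : Matrix m m ℂ) - A)⁻¹ with hX
  have h1 := congrArg norm (smul_resolvent_eq hw)
  rw [norm_smul, ← hX] at h1
  have h2 : ‖1 + A * X‖ ≤ 1 + ‖A‖ * ‖X‖ :=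
    (norm_add_le _ _).trans (add_le_add Matrix.l2_opNorm_one_le (norm_mul_le _ _))
  rw [← h1] at h2
  rw [inv_eq_one_div, le_div_iff₀ (sub_pos.2 h)]
  nlinarith

/-- By Cramer's rule each entry is a quotient of polynomials in w whose denominator is the
determinant. -/
theorem differentiableOn_resolvent_entry (A : Matrix m m ℂ) (i j : m) :
    DifferentiableOn ℂ (fun w => (w • (1 : Matrix m m ℂ) - A)⁻¹ i j) (spectrum ℂ A)ᶜ := by
  have h1 : ∀ w : ℂ, (w • (1 : Matrix m m ℂ) - A)⁻¹ i j =
      (w • (1 : Matrix m m ℂ) - A).det⁻¹ * (w • (1 : Matrix m m ℂ) - A).adjugate i j := by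
    intro w
    rw [Matrix.inv_def, Ring.inverse_eq_inv', Matrix.smul_apply, smul_eq_mul]
  simp only [h1]
  have hent : ∀ k l, Differentiable ℂ fun w : ℂ => (w • (1 : Matrix m m ℂ) - A) k l := by
    intro k l
    simp only [Matrix.sub_apply, Matrix.smul_apply, smul_eq_mul]
    fun_prop
  have hdet : ∀ M : ℂ → Matrix m m ℂ, (∀ k l, Differentiable ℂ fun w => M w k l) →
      Differentiable ℂ fun w => (M w).det := by
    intro M hM
    simp only [Matrix.det_apply]
    refine Differentiable.fun_sum fun σ _ => Differentiable.const_smul ?_ _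
    exact Differentiable.fun_finsetProd fun k _ => hM _ _
  refine DifferentiableOn.mul (DifferentiableOn.inv (hdet _ hent).differentiableOn ?_) ?_
  · intro w hw
    exact ((Matrix.isUnit_iff_isUnit_det _).1 (isUnit_smul_one_sub hw)).ne_zero
  · simp only [Matrix.adjugate_apply]
    refine (hdet _ fun k l => ?_).differentiableOn
    by_cases hk : k = j
    · subst hk; simp
    · simp [Matrix.updateRow_ne hk]

end NumericalRange

/-! ### Cauchy's formula for polynomials of a matrix -/

section Resolvent

variable {m : Type*} [Fintype m] [DecidableEq m]

theorem norm_le_of_mem_numericalRange {A : Matrix m m ℂ} {z : ℂ} (hz : z ∈ numericalRange A) :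
    ‖z‖ ≤ ‖A‖ := by
  obtain ⟨v, hv, rfl⟩ := mem_numericalRange_iff.1 hz
  have h1 := Matrix.norm_dotProduct_le v (A *ᵥ v)
  have h2 := A.norm_toLp_mulVec_le v
  rw [hv, mul_one] at h2
  rw [hv, one_mul] at h1
  exact h1.trans h2

theorem continuousOn_resolvent_entry {A : Matrix m m ℂ} {K : Set ℂ}
    (hK : Disjoint K (spectrum ℂ A)) (i j : m) :
    ContinuousOn (fun w => (w • (1 : Matrix m m ℂ) - A)⁻¹ i j) K :=
  (differentiableOn_resolvent_entry A i j).continuousOn.mono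
    (Set.subset_compl_iff_disjoint_right.2 hK)

/-- The support function of a disc around the origin. -/
noncomputable def discSupportFunction (r : ℝ) (hr : 0 ≤ r) : SupportFunction where
  h _ := r
  h₁ _ := 0
  h₂ _ := 0
  hasDerivAt_h _ := hasDerivAt_const _ _
  hasDerivAt_h₁ _ := hasDerivAt_const _ _
  continuous_h₂ := continuous_const
  periodic_h _ := rfl
  nonneg _ := by simpa using hr

theorem mem_inner_disc {r : ℝ} (hr : 0 ≤ r) {z : ℂ} (hz : ‖z‖ < r) :
    z ∈ (discSupportFunction r hr).inner 0 := fun θ => by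
  have := (discSupportFunction r hr).gap_sub_le θ 0 z
  have h0 : (discSupportFunction r hr).gap θ 0 = r := by
    simp [SupportFunction.gap, discSupportFunction]
  rw [h0, sub_zero] at this
  linarith

theorem kernel_disc_zero {r : ℝ} (hr : 0 < r) (θ : ℝ) :
    (discSupportFunction r hr.le).kernel 0 θ = 1 := by
  have h1 : (r : ℂ) ≠ 0 := by exact_mod_cast hr.ne'
  have h2 := Complex.exp_ne_zero (θ * Complex.I)
  simp only [SupportFunction.kernel, SupportFunction.radius, SupportFunction.point,
    discSupportFunction]
  field_simp
  simp [mul_comm]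

theorem Contour.Encloses.toUniv {Γ : Contour} {Ω K : Set ℂ} (h : Γ.Encloses Ω K) :
    Γ.Encloses Set.univ K :=
  ⟨Set.subset_univ _, h.disjoint, h.winding_one, fun _ ha => absurd (Set.mem_univ _) ha⟩

/-- The resolvent is holomorphic off the spectrum, so the contour may be replaced by a circle of
radius r > ‖A‖. There the resolvent is 1/w plus A times the resolvent over w; the first term gives
the identity and the second vanishes as r grows. -/
theorem Contour.Encloses.integral_resolvent {Γ : Contour} {Ω : Set ℂ} {A : Matrix m m ℂ}
    (h : Γ.Encloses Ω (spectrum ℂ A)) (i j : m) :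
    Γ.integral (fun w => (w • (1 : Matrix m m ℂ) - A)⁻¹ i j) =
      2 * Real.pi * Complex.I * (1 : Matrix m m ℂ) i j := by
  have hcl : IsClosed (spectrum ℂ A) := spectrum.isClosed A
  have key : ∀ r, ‖A‖ < r → ‖Γ.integral (fun w => (w • (1 : Matrix m m ℂ) - A)⁻¹ i j) -
      2 * Real.pi * Complex.I * (1 : Matrix m m ℂ) i j‖ ≤
      ‖A‖ * (r - ‖A‖)⁻¹ * (2 * Real.pi) := by
    intro r hr
    have hr0 : 0 < r := (norm_nonneg A).trans_lt hr
    set D := discSupportFunction r hr0.le with hD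
    have hin : spectrum ℂ A ⊆ D.inner 0 := fun z hz => mem_inner_disc hr0.le
      ((norm_le_of_mem_numericalRange (spectrum_subset_numericalRange A hz)).trans_lt hr)
    have hE := D.contour_encloses (Set.subset_univ _) hin
    rw [Contour.Encloses.integral_eq isOpen_univ hcl h.toUniv hE
      ((differentiableOn_resolvent_entry A i j).mono (by simp [Set.compl_eq_univ_sdiff]))]
    have h0 : (0 : ℂ) ∈ D.inner 0 := mem_inner_disc hr0.le (by simpa using hr0)
    have hnorm : ∀ θ, ‖D.point θ‖ = r := fun θ => by
      simp only [SupportFunction.point, hD, discSupportFunction]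
      rw [norm_mul, Complex.norm_exp_ofReal_mul_I]
      simp [hr0.le]
    have himg : ∀ w ∈ D.contour.image, ‖w‖ = r := fun w hw => by
      rw [D.contour_image] at hw
      obtain ⟨θ, rfl⟩ := hw
      exact hnorm θ
    have hne : ∀ w ∈ D.contour.image, w ≠ 0 := fun w hw h0 => by
      have := himg w hw
      rw [h0, norm_zero] at this
      exact hr0.ne this
    have hnot : ∀ w ∈ D.contour.image, w ∉ spectrum ℂ A := fun w hw hs =>
      (Set.disjoint_left.1 hE.disjoint) hw hs
    set g : ℂ → ℂ := fun w => (A * (w • (1 : Matrix m m ℂ) - A)⁻¹) i j with hg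
    have hgc : ContinuousOn g D.contour.image := by
      simp only [hg, Matrix.mul_apply]
      exact continuousOn_finsetSum _ fun k _ =>
        continuousOn_const.mul (continuousOn_resolvent_entry hE.disjoint k j)
    have hinv : ContinuousOn (fun w : ℂ => (w - 0)⁻¹) D.contour.image :=
      (continuousOn_id.sub continuousOn_const).inv₀ fun w hw => by simpa using hne w hw
    have e1 : D.contour.integral (fun w => (w • (1 : Matrix m m ℂ) - A)⁻¹ i j) =
        D.contour.integral
          (fun w => (1 : Matrix m m ℂ) i j * (w - 0)⁻¹ + g w / (w - 0)) := by
      refine D.contour.integral_congr fun w hw => ?_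
      have := congrFun (congrFun (smul_resolvent_eq (hnot w hw)) i) j
      simp only [Matrix.smul_apply, Matrix.add_apply, smul_eq_mul] at this
      simp only [hg, sub_zero]
      have hw0 := hne w hw
      field_simp
      rw [mul_comm]
      exact this
    rw [e1, Contour.integral_add _ (f := fun w => (1 : Matrix m m ℂ) i j * (w - 0)⁻¹)
      (g := fun w => g w / (w - 0)) (continuousOn_const.mul hinv)
      (by simp only [div_eq_mul_inv]; exact hgc.mul hinv),
      Contour.integral_const_mul, D.integral_inv_sub_of_mem h0,
      mul_comm _ (2 * Real.pi * Complex.I), add_sub_cancel_left, D.contour_integral_div_sub,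
      norm_mul, Complex.norm_I, one_mul]
    have := intervalIntegral.norm_integral_le_of_norm_le_const (a := 0) (b := 2 * Real.pi)
      (C := ‖A‖ * (r - ‖A‖)⁻¹) (f := fun θ => D.kernel 0 θ * g (D.point θ)) (fun θ _ => by
        rw [hD, kernel_disc_zero hr0, ← hD, one_mul]
        have hmem : D.point θ ∈ D.contour.image := by rw [D.contour_image]; exact ⟨θ, rfl⟩
        refine (Matrix.norm_entry_le_l2_opNorm _ i j).trans ((norm_mul_le _ _).trans ?_)
        refine mul_le_mul_of_nonneg_left ?_ (norm_nonneg _)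
        have h3 := norm_resolvent_le (hnot _ hmem) (by rw [hnorm]; exact hr)
        rwa [hnorm] at h3)
    rwa [sub_zero, abs_of_pos Real.two_pi_pos] at this
  have hlim : Tendsto (fun r => ‖A‖ * (r - ‖A‖)⁻¹ * (2 * Real.pi)) atTop (𝓝 0) := by
    have := ((tendsto_inv_atTop_zero.comp
      (tendsto_atTop_add_const_right atTop (-‖A‖) tendsto_id)).const_mul ‖A‖).mul_const
        (2 * Real.pi)
    simpa [sub_eq_add_neg] using this
  have := ge_of_tendsto hlim (by
    filter_upwards [eventually_gt_atTop ‖A‖] with r hr using key r hr)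
  exact sub_eq_zero.1 (norm_le_zero_iff.1 this)

theorem Contour.integral_pow_eq_zero (Γ : Contour) (k : ℕ) : Γ.integral (fun w => w ^ k) = 0 := by
  refine Γ.integral_eq_zero_of_hasDerivAt (F := fun w => w ^ (k + 1) / (k + 1)) (fun w _ => ?_)
    (by fun_prop)
  have := (hasDerivAt_pow (k + 1) w).div_const ((k : ℂ) + 1)
  convert! this using 1
  have : (k : ℂ) + 1 ≠ 0 := by exact_mod_cast k.succ_ne_zero
  push_cast
  field_simp

/-- Induction by means of w (w - A)⁻¹ = 1 + A (w - A)⁻¹: the powers of w left over integrate to 0,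
and each step produces one factor A. -/
theorem Contour.Encloses.integral_pow_mul_resolvent {Γ : Contour} {Ω : Set ℂ} {A : Matrix m m ℂ}
    (h : Γ.Encloses Ω (spectrum ℂ A)) (k : ℕ) (i j : m) :
    Γ.integral (fun w => w ^ k * (w • (1 : Matrix m m ℂ) - A)⁻¹ i j) =
      2 * Real.pi * Complex.I * (A ^ k) i j := by
  induction k generalizing i j with
  | zero => simpa using h.integral_resolvent i j
  | succ k ih =>
    have hc : ∀ l, ContinuousOn (fun w => w ^ k * (w • (1 : Matrix m m ℂ) - A)⁻¹ l j) Γ.image :=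
      fun l => (continuousOn_pow k).mul (continuousOn_resolvent_entry h.disjoint l j)
    have e1 : Γ.integral (fun w => w ^ (k + 1) * (w • (1 : Matrix m m ℂ) - A)⁻¹ i j) =
        Γ.integral (fun w => (1 : Matrix m m ℂ) i j * w ^ k + ∑ l, A i l *
          (w ^ k * (w • (1 : Matrix m m ℂ) - A)⁻¹ l j)) := by
      refine Γ.integral_congr fun w hw => ?_
      have := congrFun (congrFun (smul_resolvent_eq
        (Set.disjoint_left.1 h.disjoint hw)) i) j
      simp only [Matrix.smul_apply, Matrix.add_apply, smul_eq_mul, Matrix.mul_apply] at this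
      have h2 : w ^ (k + 1) * (w • (1 : Matrix m m ℂ) - A)⁻¹ i j =
        w ^ k * (w * (w • (1 : Matrix m m ℂ) - A)⁻¹ i j) := by ring
      rw [h2, this, mul_add, Finset.mul_sum, mul_comm (w ^ k)]
      congr 1
      exact Finset.sum_congr rfl fun l _ => by ring
    rw [e1, Contour.integral_add _ (f := fun w => (1 : Matrix m m ℂ) i j * w ^ k)
      (g := fun w => ∑ l, A i l * (w ^ k * (w • (1 : Matrix m m ℂ) - A)⁻¹ l j))
      (by fun_prop) (continuousOn_finsetSum _ fun l _ => continuousOn_const.mul (hc l)),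
      Contour.integral_const_mul, Contour.integral_pow_eq_zero, mul_zero, zero_add,
      Contour.integral_sum_const_mul _ _ _
        (f := fun l w => w ^ k * (w • (1 : Matrix m m ℂ) - A)⁻¹ l j) fun l _ => hc l]
    simp only [ih]
    rw [pow_succ', Matrix.mul_apply, Finset.mul_sum]
    exact Finset.sum_congr rfl fun l _ => by ring

/-- Cauchy's formula for a polynomial of a matrix. -/
theorem Contour.Encloses.integral_eval_mul_resolvent {Γ : Contour} {Ω : Set ℂ} {A : Matrix m m ℂ}
    (h : Γ.Encloses Ω (spectrum ℂ A)) (p : Polynomial ℂ) (i j : m) :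
    Γ.integral (fun w => p.eval w * (w • (1 : Matrix m m ℂ) - A)⁻¹ i j) =
      2 * Real.pi * Complex.I * (Polynomial.aeval A p) i j := by
  have hc := continuousOn_resolvent_entry h.disjoint i j
  simp only [Polynomial.eval_eq_sum_range, Finset.sum_mul, mul_assoc]
  rw [Contour.integral_sum_const_mul _ _ _
    (f := fun k w => w ^ k * (w • (1 : Matrix m m ℂ) - A)⁻¹ i j) fun k _ =>
    (continuousOn_pow k).mul hc]
  simp only [h.integral_pow_mul_resolvent]
  rw [Polynomial.aeval_eq_sum_range, Matrix.sum_apply]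
  simp only [Finset.mul_sum]
  refine Finset.sum_congr rfl fun k _ => ?_
  rw [Matrix.smul_apply, smul_eq_mul]; ring

end Resolvent

/-! ### Integrals against positive matrix-valued kernels -/

section MatrixIntegral

variable {m n : Type*} [Fintype m] [Fintype n] [DecidableEq m] [DecidableEq n]

theorem Matrix.intervalIntegral_linear {f : ℝ → Matrix m n ℂ} (hf : Continuous f) {a b : ℝ}
    (L : Matrix m n ℂ →ₗ[ℂ] ℂ) :
    L (∫ θ in a..b, f θ) = ∫ θ in a..b, L (f θ) :=
  ((L.toContinuousLinearMap).intervalIntegral_comp_comm (hf.intervalIntegrable a b)).symm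

theorem Matrix.intervalIntegral_apply {f : ℝ → Matrix m n ℂ} (hf : Continuous f) {a b : ℝ}
    (i : m) (j : n) : (∫ θ in a..b, f θ) i j = ∫ θ in a..b, f θ i j :=
  Matrix.intervalIntegral_linear hf (Matrix.entryLinearMap ℂ ℂ i j)

theorem Matrix.intervalIntegral_conjTranspose {f : ℝ → Matrix m n ℂ} (hf : Continuous f)
    {a b : ℝ} : (∫ θ in a..b, f θ)ᴴ = ∫ θ in a..b, (f θ)ᴴ := by
  ext i j
  rw [Matrix.conjTranspose_apply, Matrix.intervalIntegral_apply hf,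
    Matrix.intervalIntegral_apply hf.matrix_conjTranspose]
  exact (Complex.conjCLE.toContinuousLinearMap.intervalIntegral_comp_comm
    ((hf.matrix_elem j i).intervalIntegrable a b)).symm

/-- The linear form `T ↦ x^* T y`. -/
noncomputable def sandwich (x : m → ℂ) (y : n → ℂ) : Matrix m n ℂ →ₗ[ℂ] ℂ where
  toFun T := star x ⬝ᵥ (T *ᵥ y)
  map_add' S T := by rw [Matrix.add_mulVec, dotProduct_add]
  map_smul' c T := by rw [Matrix.smul_mulVec, dotProduct_smul]; rfl

theorem continuous_kronecker {X : Type*} [TopologicalSpace X] {Φ : X → Matrix n n ℂ}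
    {μ : X → Matrix m m ℂ} (hΦ : Continuous Φ) (hμ : Continuous μ) :
    Continuous fun θ => Φ θ ⊗ₖ μ θ :=
  continuous_matrix fun r s => (hΦ.matrix_elem r.1 s.1).mul (hμ.matrix_elem r.2 s.2)

/-- A positive kernel of total mass t · 1 averages the values of Φ. Under the integral, the weighted
Cauchy–Schwarz inequality leaves quadratic forms whose integrals are known exactly. -/
theorem norm_integral_kronecker_le {Φ : ℝ → Matrix n n ℂ} (hΦ : Continuous Φ) {C : ℝ}
    (hC : ∀ θ, ‖Φ θ‖ ≤ C) {μ : ℝ → Matrix m m ℂ} (hμ : Continuous μ)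
    (hpos : ∀ θ, (μ θ).PosSemidef) {a b t : ℝ} (hab : a ≤ b) (ht : 0 ≤ t)
    (hint : ∫ θ in a..b, μ θ = (t : ℂ) • (1 : Matrix m m ℂ)) :
    ‖∫ θ in a..b, Φ θ ⊗ₖ μ θ‖ ≤ t * C := by
  have hC0 : 0 ≤ C := (norm_nonneg _).trans (hC 0)
  have hcK := continuous_kronecker hΦ hμ
  have hc1 : Continuous fun θ => (1 : Matrix n n ℂ) ⊗ₖ μ θ := continuous_kronecker continuous_const hμ
  have hcs : ∀ (x y : n × m → ℂ) {T : ℝ → Matrix (n × m) (n × m) ℂ}, Continuous T →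
      Continuous fun θ => star x ⬝ᵥ (T θ *ᵥ y) := fun x y T hT =>
    (sandwich x y).toContinuousLinearMap.continuous.comp hT
  have h1 : ∀ x : n × m → ℂ,
      ∫ θ in a..b, (star x ⬝ᵥ (((1 : Matrix n n ℂ) ⊗ₖ μ θ) *ᵥ x)).re =
        t * ‖WithLp.toLp 2 x‖ ^ 2 := by
    intro x
    have e1 : ∫ θ in a..b, (1 : Matrix n n ℂ) ⊗ₖ μ θ = (t : ℂ) • (1 : Matrix (n × m) (n × m) ℂ) := by
      ext r s
      rw [Matrix.intervalIntegral_apply hc1]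
      simp only [Matrix.kroneckerMap_apply]
      rw [intervalIntegral.integral_const_mul, ← Matrix.intervalIntegral_apply hμ, hint,
        ← Matrix.one_kronecker_one]
      simp only [Matrix.smul_apply, Matrix.kroneckerMap_apply, smul_eq_mul]
      ring
    have e2 := Matrix.intervalIntegral_linear hc1 (a := a) (b := b) (sandwich x x)
    rw [e1, map_smul] at e2
    have e3 : (sandwich x x) (1 : Matrix (n × m) (n × m) ℂ) = ((‖WithLp.toLp 2 x‖ ^ 2 : ℝ) : ℂ) := by
      rw [← Matrix.dotProduct_self_eq_norm_sq]
      simp [sandwich]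
    rw [e3, smul_eq_mul, ← Complex.ofReal_mul] at e2
    have e4 := Complex.reCLM.intervalIntegral_comp_comm (μ := volume)
      ((hcs x x hc1).intervalIntegrable a b)
    refine e4.trans ?_
    have e5 : ∫ θ in a..b, star x ⬝ᵥ (((1 : Matrix n n ℂ) ⊗ₖ μ θ) *ᵥ x) =
      ((t * ‖WithLp.toLp 2 x‖ ^ 2 : ℝ) : ℂ) := e2.symm
    rw [e5]
    exact Complex.ofReal_re _
  have key : ‖∫ θ in a..b, Φ θ ⊗ₖ μ θ‖ ≤ 2 * (C / 2 * t) := by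
    refine Matrix.l2_opNorm_le_of_bilin (fun x y => ?_) (by positivity)
    have e2 : star x ⬝ᵥ ((∫ θ in a..b, Φ θ ⊗ₖ μ θ) *ᵥ y) =
        ∫ θ in a..b, star x ⬝ᵥ ((Φ θ ⊗ₖ μ θ) *ᵥ y) :=
      Matrix.intervalIntegral_linear hcK (sandwich x y)
    have i1 := (Complex.continuous_re.comp (hcs x x hc1)).intervalIntegrable (μ := volume) a b
    have i2 := (Complex.continuous_re.comp (hcs y y hc1)).intervalIntegrable (μ := volume) a b
    rw [e2]
    refine (intervalIntegral.norm_integral_le_of_norm_le hab (g := fun θ =>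
      C / 2 * ((star x ⬝ᵥ (((1 : Matrix n n ℂ) ⊗ₖ μ θ) *ᵥ x)).re +
        (star y ⬝ᵥ (((1 : Matrix n n ℂ) ⊗ₖ μ θ) *ᵥ y)).re)) (Eventually.of_forall fun θ _ =>
      Matrix.norm_dotProduct_kronecker_le (hC θ) (hpos θ) x y) ((i1.add i2).const_mul _)).trans ?_
    rw [intervalIntegral.integral_const_mul]
    have e3 := intervalIntegral.integral_add i1 i2
    simp only [Function.comp_def] at e3
    rw [e3, h1, h1]
    exact le_of_eq (by ring)
  exact key.trans (le_of_eq (by ring))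

end MatrixIntegral

/-! ### Matrix polynomials and dilations -/

section MatrixPolynomial

variable {m n : Type*} [Fintype m] [Fintype n] [DecidableEq m] [DecidableEq n]

/-- The value of a matrix of polynomials at a point. -/
noncomputable def polyEval (P : Matrix n n (Polynomial ℂ)) (z : ℂ) : Matrix n n ℂ :=
  P.map (Polynomial.eval z)

/-- The value of a matrix of polynomials at a matrix, a block matrix. -/
noncomputable def polyAeval (P : Matrix n n (Polynomial ℂ)) (A : Matrix m m ℂ) :
    Matrix (n × m) (n × m) ℂ :=
  Matrix.comp n n m m ℂ (P.map (Polynomial.aeval A))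

theorem polyEval_mul (P Q : Matrix n n (Polynomial ℂ)) (z : ℂ) :
    polyEval (P * Q) z = polyEval P z * polyEval Q z :=
  Matrix.map_mul (f := Polynomial.evalRingHom z)

/-- Multiplicativity is what identifies P(A) Q(A) P(A) with the value of one matrix polynomial to
which the best constant applies. -/
theorem polyAeval_mul (P Q : Matrix n n (Polynomial ℂ)) (A : Matrix m m ℂ) :
    polyAeval (P * Q) A = polyAeval P A * polyAeval Q A := by
  have h1 : (P * Q).map (Polynomial.aeval A) = P.map (Polynomial.aeval A) * Q.map (Polynomial.aeval A) :=
    Matrix.map_mul (f := (Polynomial.aeval A : Polynomial ℂ →ₐ[ℂ] Matrix m m ℂ).toRingHom)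
  rw [polyAeval, h1]
  exact map_mul (Matrix.compRingEquiv n m ℂ) _ _

theorem polyAeval_apply (P : Matrix n n (Polynomial ℂ)) (A : Matrix m m ℂ) (r s : n × m) :
    polyAeval P A r s = Polynomial.aeval A (P r.1 s.1) r.2 s.2 := rfl

theorem continuous_polyEval (P : Matrix n n (Polynomial ℂ)) : Continuous (polyEval P) :=
  continuous_matrix fun i j => (P i j).continuous

theorem continuous_polyAeval (P : Matrix n n (Polynomial ℂ)) :
    Continuous fun A : Matrix m m ℂ => polyAeval P A :=
  continuous_matrix fun r s => ((P r.1 s.1).continuous_aeval).matrix_elem r.2 s.2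

/-- Substitution of the affine function `c + r (X - c)`. -/
noncomputable def polyDilate (c r : ℂ) (P : Matrix n n (Polynomial ℂ)) :
    Matrix n n (Polynomial ℂ) :=
  P.map fun p => p.comp (Polynomial.C (c - r * c) + Polynomial.C r * Polynomial.X)

/-- The matrix `c + r (A - c)`. -/
noncomputable def Matrix.dilate (c r : ℂ) (A : Matrix m m ℂ) : Matrix m m ℂ :=
  (c - r * c) • (1 : Matrix m m ℂ) + r • A

theorem polyEval_polyDilate (c r : ℂ) (P : Matrix n n (Polynomial ℂ)) (z : ℂ) :
    polyEval (polyDilate c r P) z = polyEval P (c + r * (z - c)) := by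
  ext i j
  simp only [polyEval, polyDilate, Matrix.map_apply, Polynomial.eval_comp]
  congr 1
  simp
  ring

theorem polyAeval_polyDilate (c r : ℂ) (P : Matrix n n (Polynomial ℂ)) (A : Matrix m m ℂ) :
    polyAeval (polyDilate c r P) A = polyAeval P (A.dilate c r) := by
  ext x y
  simp only [polyAeval_apply, polyDilate, Matrix.map_apply, Polynomial.aeval_comp]
  simp only [map_add, map_mul, Polynomial.aeval_C, Polynomial.aeval_X, Matrix.dilate]
  rw [Algebra.algebraMap_eq_smul_one, Algebra.algebraMap_eq_smul_one, smul_mul_assoc, one_mul]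

theorem numericalRange_dilate (c r : ℂ) (A : Matrix m m ℂ) {z : ℂ}
    (hz : z ∈ numericalRange (A.dilate c r)) : ∃ y ∈ numericalRange A, z = c + r * (y - c) := by
  obtain ⟨v, hv, rfl⟩ := mem_numericalRange_iff.1 hz
  refine ⟨_, mem_numericalRange_iff.2 ⟨v, hv, rfl⟩, ?_⟩
  rw [Matrix.dilate, Matrix.add_mulVec, Matrix.smul_mulVec, Matrix.smul_mulVec, Matrix.one_mulVec,
    dotProduct_add, dotProduct_smul, dotProduct_smul, Matrix.dotProduct_self_eq_norm_sq, hv]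
  simp
  ring

end MatrixPolynomial

/-! ### Dilated bodies and the resolvent kernel on the boundary -/

namespace SupportFunction

variable (S : SupportFunction) {m n : Type*} [Fintype m] [Fintype n] [DecidableEq m]
  [DecidableEq n]

/-- The dilation of a convex body with centre `c` and ratio `r`. -/
noncomputable def dilate (c : ℂ) (r : ℝ) (hr : 0 ≤ r) : SupportFunction where
  h θ := r * S.h θ + (1 - r) * (Real.cos θ * c.re + Real.sin θ * c.im)
  h₁ θ := r * S.h₁ θ + (1 - r) * (-Real.sin θ * c.re + Real.cos θ * c.im)
  h₂ θ := r * S.h₂ θ + (1 - r) * (-Real.cos θ * c.re + -Real.sin θ * c.im)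
  hasDerivAt_h θ := ((S.hasDerivAt_h θ).const_mul r).add
    ((((Real.hasDerivAt_cos θ).mul_const _).add ((Real.hasDerivAt_sin θ).mul_const _)).const_mul _)
  hasDerivAt_h₁ θ := ((S.hasDerivAt_h₁ θ).const_mul r).add
    ((((Real.hasDerivAt_sin θ).neg.mul_const _).add
      ((Real.hasDerivAt_cos θ).mul_const _)).const_mul _)
  continuous_h₂ := by have := S.continuous_h₂; fun_prop
  periodic_h θ := by simp only [S.periodic_h θ, Real.cos_add_two_pi, Real.sin_add_two_pi]
  nonneg θ := by
    have := mul_nonneg hr (S.nonneg θ)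
    nlinarith

theorem gap_dilate (c : ℂ) (r : ℝ) (hr : 0 ≤ r) (θ : ℝ) (z : ℂ) :
    (S.dilate c r hr).gap θ (c + r * (z - c)) = r * S.gap θ z := by
  simp only [gap, dilate, Complex.add_re, Complex.add_im, Complex.mul_re, Complex.mul_im,
    Complex.ofReal_re, Complex.ofReal_im, Complex.sub_re, Complex.sub_im]
  ring

theorem gap_affine (c : ℂ) (r : ℝ) (θ : ℝ) (z : ℂ) :
    S.gap θ (c + r * (z - c)) = r * S.gap θ z + (1 - r) * S.gap θ c := by
  simp only [gap, Complex.add_re, Complex.add_im, Complex.mul_re, Complex.mul_im,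
    Complex.ofReal_re, Complex.ofReal_im, Complex.sub_re, Complex.sub_im]
  ring

theorem exists_of_mem_body_dilate {c : ℂ} {r : ℝ} (hr : 0 < r) {z : ℂ}
    (hz : z ∈ (S.dilate c r hr.le).body) : ∃ y ∈ S.body, z = c + r * (y - c) := by
  have hr' : (r : ℂ) ≠ 0 := by exact_mod_cast hr.ne'
  have hzy : z = c + r * ((c + (z - c) / r) - c) := by field_simp; ring
  refine ⟨c + (z - c) / r, fun θ => ?_, hzy⟩
  have := hz θ
  rw [hzy, gap_dilate] at this
  exact nonneg_of_mul_nonneg_right this hr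

/-- The resolvent on the boundary curve, times the derivative of the curve over `i`. -/
noncomputable def resolventKernel (A : Matrix m m ℂ) (θ : ℝ) : Matrix m m ℂ :=
  (S.radius θ * Complex.exp (θ * Complex.I)) • (S.point θ • (1 : Matrix m m ℂ) - A)⁻¹

variable {S} {A : Matrix m m ℂ}

theorem point_notMem_spectrum (hA : numericalRange A ⊆ S.inner 0) (θ : ℝ) :
    S.point θ ∉ spectrum ℂ A := fun h =>
  S.point_notMem_inner θ (hA (spectrum_subset_numericalRange A h))

theorem encloses_spectrum (hA : numericalRange A ⊆ S.inner 0) :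
    S.contour.Encloses Set.univ (spectrum ℂ A) :=
  S.contour_encloses (Set.subset_univ _) ((spectrum_subset_numericalRange A).trans hA)

theorem continuous_resolventKernel (hA : numericalRange A ⊆ S.inner 0) :
    Continuous (S.resolventKernel A) := by
  have h1 := S.continuous_radius
  refine continuous_matrix fun i j => ?_
  simp only [resolventKernel, Matrix.smul_apply, smul_eq_mul]
  refine Continuous.mul (by fun_prop) ?_
  refine (differentiableOn_resolvent_entry A i j).continuousOn.comp_continuous S.continuous_point
    fun θ => point_notMem_spectrum hA θ

theorem contour_integral_resolvent (g : ℂ → ℂ) (i j : m) :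
    S.contour.integral (fun w => g w * (w • (1 : Matrix m m ℂ) - A)⁻¹ i j) =
      Complex.I * ∫ θ in (0 : ℝ)..2 * Real.pi, g (S.point θ) * S.resolventKernel A θ i j := by
  rw [contour_integral, ← intervalIntegral.integral_const_mul]
  refine intervalIntegral.integral_congr fun θ _ => ?_
  simp only [resolventKernel, Matrix.smul_apply, smul_eq_mul]
  ring

theorem integral_kronecker_resolventKernel (hA : numericalRange A ⊆ S.inner 0)
    (P : Matrix n n (Polynomial ℂ)) :
    ∫ θ in (0 : ℝ)..2 * Real.pi, polyEval P (S.point θ) ⊗ₖ S.resolventKernel A θ =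
      (2 * Real.pi : ℂ) • polyAeval P A := by
  ext r s
  rw [Matrix.intervalIntegral_apply
    (f := fun θ => polyEval P (S.point θ) ⊗ₖ S.resolventKernel A θ) (continuous_kronecker
    ((continuous_polyEval P).comp S.continuous_point) (continuous_resolventKernel hA))]
  have h1 := (encloses_spectrum hA).integral_eval_mul_resolvent (P r.1 s.1) r.2 s.2
  rw [contour_integral_resolvent] at h1
  refine mul_left_cancel₀ Complex.I_ne_zero (h1.trans ?_)
  rw [Matrix.smul_apply, polyAeval_apply, smul_eq_mul]
  ring

theorem integral_resolventKernel (hA : numericalRange A ⊆ S.inner 0) :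
    ∫ θ in (0 : ℝ)..2 * Real.pi, S.resolventKernel A θ = (2 * Real.pi : ℂ) • (1 : Matrix m m ℂ) := by
  ext i j
  rw [Matrix.intervalIntegral_apply (continuous_resolventKernel hA)]
  have h1 := (encloses_spectrum hA).integral_resolvent i j
  have h2 := contour_integral_resolvent (S := S) (A := A) (fun _ => 1) i j
  simp only [one_mul] at h2
  rw [h2] at h1
  refine mul_left_cancel₀ Complex.I_ne_zero (h1.trans ?_)
  rw [Matrix.smul_apply, smul_eq_mul]
  ring

/-- The double layer potential of the numerical range is positive. -/
theorem posSemidef_resolventKernel (hA : numericalRange A ⊆ S.inner 0) (θ : ℝ) :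
    (S.resolventKernel A θ + (S.resolventKernel A θ)ᴴ).PosSemidef := by
  set X := Complex.exp (θ * Complex.I) • (S.point θ • (1 : Matrix m m ℂ) - A)⁻¹ with hX
  set N := Complex.exp (-(θ * Complex.I)) • (S.point θ • (1 : Matrix m m ℂ) - A) with hN
  have hee : Complex.exp (θ * Complex.I) * Complex.exp (-(θ * Complex.I)) = 1 := by
    rw [← Complex.exp_add, add_neg_cancel, Complex.exp_zero]
  have hXN : X * N = 1 := by
    rw [hX, hN, smul_mul_smul_comm, hee, one_smul,
      resolvent_mul_cancel (point_notMem_spectrum hA θ)]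
  have hK : S.resolventKernel A θ = (S.radius θ : ℂ) • X := by
    rw [resolventKernel, hX, smul_smul]
  -- With X inverse to N, X + X* = X (N + N*) X*, so positivity reduces to N + N*. Its quadratic
  -- form at x is twice the gap at a point of the numerical range, times ‖x‖².
  have hsum : S.resolventKernel A θ + (S.resolventKernel A θ)ᴴ =
      (S.radius θ : ℂ) • (X * (N + Nᴴ) * Xᴴ) := by
    have h1 : X * (N + Nᴴ) * Xᴴ = X + Xᴴ := by
      rw [mul_add, add_mul, hXN, one_mul, Matrix.mul_assoc, ← Matrix.conjTranspose_mul, hXN,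
        Matrix.conjTranspose_one, mul_one, add_comm]
    rw [h1, hK, Matrix.conjTranspose_smul, smul_add]
    simp
  rw [hsum]
  refine Matrix.PosSemidef.smul (Matrix.PosSemidef.mul_mul_conjTranspose_same ?_ X)
    (by exact_mod_cast S.radius_nonneg θ)
  refine Matrix.PosSemidef.of_dotProduct_mulVec_nonneg ?_ fun x => ?_
  · exact Matrix.isHermitian_add_transpose_self N
  · by_cases hx : x = 0
    · simp [hx]
    obtain ⟨z, hz, h2⟩ := exists_dotProduct_mulVec_eq A hx
    set q := ‖WithLp.toLp 2 x‖ ^ 2 with hq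
    have h3 : star x ⬝ᵥ (N *ᵥ x) = Complex.exp (-(θ * Complex.I)) * ((S.point θ - z) * (q : ℂ)) := by
      rw [hN, Matrix.smul_mulVec, dotProduct_smul, Matrix.sub_mulVec, dotProduct_sub,
        Matrix.smul_mulVec, dotProduct_smul, Matrix.one_mulVec, h2,
        Matrix.dotProduct_self_eq_norm_sq, ← hq, smul_eq_mul, smul_eq_mul]
      ring
    have h4 : star x ⬝ᵥ (Nᴴ *ᵥ x) = star (star x ⬝ᵥ (N *ᵥ x)) := by
      rw [Matrix.dotProduct_mulVec, ← Matrix.star_mulVec, Matrix.star_dotProduct]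
    have h5 : star x ⬝ᵥ (N *ᵥ x) = (S.gap θ z + S.gapDeriv θ z * Complex.I) * q := by
      rw [h3, point_sub]
      linear_combination ((S.gap θ z + S.gapDeriv θ z * Complex.I) * q) * hee
    have h6 : star x ⬝ᵥ ((N + Nᴴ) *ᵥ x) = ((2 * (S.gap θ z * q) : ℝ) : ℂ) := by
      rw [Matrix.add_mulVec, dotProduct_add, h4, h5]
      simp only [Complex.star_def, map_mul, map_add, Complex.conj_ofReal, Complex.conj_I]
      push_cast
      ring
    rw [h6, Complex.zero_le_real]
    have := (hA hz θ).le
    positivity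

end SupportFunction

/-! ### The Crouzeix–Palencia theorem for matrix polynomials -/

section

variable {m n : Type*} [Fintype m] [Fintype n] [DecidableEq m] [DecidableEq n]

theorem polyEval_smul (c : ℂ) (P : Matrix n n (Polynomial ℂ)) (z : ℂ) :
    polyEval (c • P) z = c • polyEval P z := by
  ext i j
  simp [polyEval]

theorem polyAeval_smul (c : ℂ) (P : Matrix n n (Polynomial ℂ)) (A : Matrix m m ℂ) :
    polyAeval (c • P) A = c • polyAeval P A := by
  ext r s
  simp [polyAeval_apply]

namespace SupportFunction

variable {S : SupportFunction}

theorem continuous_smul_kernel {z : ℂ} (hz : ∀ θ, S.point θ - z ≠ 0)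
    (P : Matrix n n (Polynomial ℂ)) :
    Continuous fun θ => S.kernel z θ • polyEval P (S.point θ) :=
  (S.continuous_kernel hz).smul ((continuous_polyEval P).comp S.continuous_point)

/-- The adjoint of Cauchy's theorem for P(w)/(w - z), which is holomorphic off the outer point z. It
supplies the annihilation condition required of an antianalytic function. -/
theorem integral_conj_kernel_smul_polyEval {z : ℂ} (hz : z ∉ S.body)
    (P : Matrix n n (Polynomial ℂ)) :
    ∫ θ in (0 : ℝ)..2 * Real.pi,
      (starRingEnd ℂ) (S.kernel z θ) • (polyEval P (S.point θ))ᴴ = 0 := by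
  have hne := S.point_sub_ne_zero_of_notMem hz
  have hc := S.continuous_smul_kernel hne P
  have h1 : ∫ θ in (0 : ℝ)..2 * Real.pi, S.kernel z θ • polyEval P (S.point θ) = 0 := by
    ext i j
    rw [Matrix.intervalIntegral_apply hc]
    have h2 := S.contour_integral_div_sub (fun w => (P i j).eval w) z
    have h3 : S.contour.integral (fun w => (P i j).eval w / (w - z)) = 0 := by
      have hΩ : ∀ w, w ∈ ({z}ᶜ : Set ℂ) ↔ w - z ≠ 0 := fun w => by
        simp [sub_eq_zero]
      refine S.contour.integral_eq_zero (Ω := {z}ᶜ) isOpen_compl_singleton ?_ ?_ ?_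
      · intro w hw hwz
        rw [Set.mem_singleton_iff.1 hwz] at hw
        exact hz (S.contour_image_subset_body hw)
      · intro a ha
        rw [Set.notMem_compl_iff, Set.mem_singleton_iff] at ha
        rw [ha]
        exact S.integral_inv_sub_of_notMem hz
      · exact (P i j).differentiable.differentiableOn.div (by fun_prop) fun w hw => (hΩ w).1 hw
    rw [h3] at h2
    exact (mul_eq_zero.1 h2.symm).resolve_left Complex.I_ne_zero
  have h4 := Matrix.intervalIntegral_conjTranspose hc (a := 0) (b := 2 * Real.pi)
  rw [h1, Matrix.conjTranspose_zero] at h4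
  rw [h4]
  exact intervalIntegral.integral_congr fun θ _ => (Matrix.conjTranspose_smul _ _).symm

theorem norm_cauchyTransform_conjTranspose_le {ε : ℝ} (hε0 : 0 < ε) (hε : ∀ θ, ε ≤ S.radius θ)
    {P : Matrix n n (Polynomial ℂ)} (hP : ∀ z ∈ S.body, ‖polyEval P z‖ ≤ 1) {z : ℂ}
    (hz : z ∈ S.inner 0) : ‖S.cauchyTransform (fun w => (polyEval P w)ᴴ) z‖ ≤ 1 :=
  S.norm_cauchyTransform_le hε0 hε ((continuous_polyEval P).matrix_conjTranspose.continuousOn)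
    (fun w hw => by rw [Matrix.l2_opNorm_conjTranspose]; exact hP w hw)
    (fun _ hw => integral_conj_kernel_smul_polyEval hw P) hz

theorem cauchyTransform_conjTranspose_apply {z : ℂ} (hz : z ∈ S.inner 0)
    (P : Matrix n n (Polynomial ℂ)) (i j : n) :
    S.cauchyTransform (fun w => (polyEval P w)ᴴ) z i j =
      S.contour.integral fun w =>
        (2 * Real.pi * Complex.I)⁻¹ * (starRingEnd ℂ) ((P j i).eval w) / (w - z) := by
  have h1 := S.cauchyTransform_eq (fun w => (starRingEnd ℂ) ((P j i).eval w)) z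
  simp only [mul_div_assoc, Contour.integral_const_mul]
  rw [← h1, cauchyTransform, cauchyTransform, Matrix.smul_apply,
    Matrix.intervalIntegral_apply (f := fun θ => S.kernel z θ • (polyEval P (S.point θ))ᴴ)
    ((S.continuous_kernel (S.point_sub_ne_zero hz)).smul
      ((continuous_polyEval P).comp S.continuous_point).matrix_conjTranspose)]
  rfl

/-- The Cauchy transform of the adjoint of a matrix polynomial, evaluated at a matrix. -/
noncomputable def cauchyTransformAeval (S : SupportFunction) (P : Matrix n n (Polynomial ℂ))
    (A : Matrix m m ℂ) : Matrix (n × m) (n × m) ℂ :=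
  (2 * Real.pi : ℂ)⁻¹ • ∫ θ in (0 : ℝ)..2 * Real.pi,
    (polyEval P (S.point θ))ᴴ ⊗ₖ S.resolventKernel A θ

variable {A : Matrix m m ℂ}

/-- The density is the same as for the pointwise transform, so the same Runge polynomial
approximates both. -/
theorem cauchyTransformAeval_apply (hA : numericalRange A ⊆ S.inner 0)
    (P : Matrix n n (Polynomial ℂ)) (r s : n × m) :
    S.cauchyTransformAeval P A r s = S.contour.integral fun w =>
      (2 * Real.pi * Complex.I)⁻¹ * (starRingEnd ℂ) ((P s.1 r.1).eval w) *
        (w • (1 : Matrix m m ℂ) - A)⁻¹ r.2 s.2 := by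
  simp only [mul_assoc (2 * Real.pi * Complex.I)⁻¹, Contour.integral_const_mul]
  rw [contour_integral_resolvent, mul_inv _ Complex.I, mul_assoc,
    inv_mul_cancel_left₀ Complex.I_ne_zero, cauchyTransformAeval, Matrix.smul_apply,
    Matrix.intervalIntegral_apply
      (f := fun θ => (polyEval P (S.point θ))ᴴ ⊗ₖ S.resolventKernel A θ) (continuous_kronecker
      ((continuous_polyEval P).comp S.continuous_point).matrix_conjTranspose
      (continuous_resolventKernel hA))]
  rfl

/-- The two terms combine into (2π)⁻¹ times the integral of P against the resolvent kernel plus its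
adjoint, a positive weight of total mass 4π. -/
theorem norm_polyAeval_add_le (hA : numericalRange A ⊆ S.inner 0)
    {P : Matrix n n (Polynomial ℂ)} (hP : ∀ z ∈ S.body, ‖polyEval P z‖ ≤ 1) :
    ‖polyAeval P A + (S.cauchyTransformAeval P A)ᴴ‖ ≤ 2 := by
  have hpi : (2 * Real.pi : ℂ) ≠ 0 := by exact_mod_cast Real.two_pi_pos.ne'
  have hcP : Continuous fun θ => polyEval P (S.point θ) :=
    (continuous_polyEval P).comp S.continuous_point
  have hcR := continuous_resolventKernel hA
  have h1 : polyAeval P A = (2 * Real.pi : ℂ)⁻¹ • ∫ θ in (0 : ℝ)..2 * Real.pi,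
      polyEval P (S.point θ) ⊗ₖ S.resolventKernel A θ := by
    rw [integral_kronecker_resolventKernel hA, smul_smul, inv_mul_cancel₀ hpi, one_smul]
  have h2 : (S.cauchyTransformAeval P A)ᴴ = (2 * Real.pi : ℂ)⁻¹ • ∫ θ in (0 : ℝ)..2 * Real.pi,
      polyEval P (S.point θ) ⊗ₖ (S.resolventKernel A θ)ᴴ := by
    rw [cauchyTransformAeval, Matrix.conjTranspose_smul,
      Matrix.intervalIntegral_conjTranspose
        (f := fun θ => (polyEval P (S.point θ))ᴴ ⊗ₖ S.resolventKernel A θ)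
        (continuous_kronecker hcP.matrix_conjTranspose hcR)]
    simp [Matrix.conjTranspose_kronecker]
  have h3 : ∫ θ in (0 : ℝ)..2 * Real.pi,
      (S.resolventKernel A θ + (S.resolventKernel A θ)ᴴ) =
      ((4 * Real.pi : ℝ) : ℂ) • (1 : Matrix m m ℂ) := by
    rw [intervalIntegral.integral_add (hcR.intervalIntegrable _ _)
      (hcR.matrix_conjTranspose.intervalIntegrable _ _),
      ← Matrix.intervalIntegral_conjTranspose hcR, integral_resolventKernel hA,
      Matrix.conjTranspose_smul, Matrix.conjTranspose_one, ← add_smul]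
    congr 1
    simp
    ring
  have h4 := norm_integral_kronecker_le (Φ := fun θ => polyEval P (S.point θ)) hcP
    (fun θ => hP _ (S.point_mem_body θ))
    (hcR.add hcR.matrix_conjTranspose) (posSemidef_resolventKernel hA) Real.two_pi_pos.le
    (by positivity) h3
  rw [h1, h2, ← smul_add, ← intervalIntegral.integral_add
    ((continuous_kronecker hcP hcR).intervalIntegrable _ _)
    ((continuous_kronecker hcP hcR.matrix_conjTranspose).intervalIntegrable _ _), norm_smul]
  simp only [Pi.add_apply, Matrix.kronecker_add] at h4
  have h5 : ‖(2 * Real.pi : ℂ)⁻¹‖ = (2 * Real.pi)⁻¹ := by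
    rw [norm_inv, norm_mul, Complex.norm_real, Real.norm_eq_abs, abs_of_pos Real.pi_pos]
    simp
  rw [h5]
  have hpi0 := Real.pi_pos
  calc _ ≤ (2 * Real.pi)⁻¹ * (4 * Real.pi * 1) := mul_le_mul_of_nonneg_left h4 (by positivity)
    _ = 2 := by field_simp; norm_num

section Dilate

variable {c : ℂ} {r : ℝ}

theorem body_dilate_subset (hc : c ∈ S.inner 0) (hr : 0 < r) (hr1 : r < 1) :
    (S.dilate c r hr.le).body ⊆ S.inner 0 := by
  intro z hz θ
  obtain ⟨y, hy, rfl⟩ := S.exists_of_mem_body_dilate hr hz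
  rw [gap_affine]
  have h1 := mul_nonneg hr.le (hy θ)
  have h2 := mul_pos (sub_pos.2 hr1) (hc θ)
  linarith

theorem numericalRange_dilate_subset (hr : 0 < r) (hA : numericalRange A ⊆ S.inner 0) :
    numericalRange (A.dilate c r) ⊆ (S.dilate c r hr.le).body := by
  intro z hz θ
  obtain ⟨y, hy, rfl⟩ := numericalRange_dilate c r A hz
  rw [gap_dilate]
  exact mul_nonneg hr.le (hA hy θ).le

/-- The boundary curve of S is disjoint from the dilated body, so Runge approximation applies there
to the Cauchy transform of P*, which has norm at most 1. This disjointness is the purpose of the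
dilation. -/
theorem exists_polyAeval_near (hc : c ∈ S.inner 0) (hr : 0 < r) (hr1 : r < 1)
    {ε : ℝ} (hε0 : 0 < ε) (hε : ∀ θ, ε ≤ S.radius θ)
    (hA : numericalRange A ⊆ S.inner 0) {P : Matrix n n (Polynomial ℂ)}
    (hP : ∀ z ∈ S.body, ‖polyEval P z‖ ≤ 1) {δ : ℝ} (hδ : 0 < δ) :
    ∃ Q : Matrix n n (Polynomial ℂ),
      (∀ z ∈ (S.dilate c r hr.le).body, ‖polyEval Q z‖ ≤ 1 + δ) ∧
      ‖S.cauchyTransformAeval P (A.dilate c r) - polyAeval Q (A.dilate c r)‖ ≤ δ := by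
  obtain ⟨C₁, hC₁0, hC₁⟩ := Matrix.exists_l2_opNorm_le_of_entries n n
  obtain ⟨C₂, hC₂0, hC₂⟩ := Matrix.exists_l2_opNorm_le_of_entries (n × m) (n × m)
  -- The entrywise tolerance absorbs both norm equivalence constants.
  have hδ' : 0 < δ / (C₁ + C₂ + 1) := by positivity
  have hle : ∀ C, C ≤ C₁ + C₂ → C * (δ / (C₁ + C₂ + 1)) ≤ δ := fun C h => by
    rw [mul_div_assoc', div_le_iff₀ (by positivity)]
    nlinarith
  have hsub := body_dilate_subset hc hr hr1
  have hAr := numericalRange_dilate_subset (c := c) hr hA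
  have hdisj : Disjoint S.contour.image (S.dilate c r hr.le).body := by
    rw [Set.disjoint_left, contour_image]
    rintro _ ⟨θ, rfl⟩ h
    exact S.point_notMem_inner θ (hsub h)
  have hφ : ∀ i j, ContinuousOn (fun w => (2 * Real.pi * Complex.I)⁻¹ *
      (starRingEnd ℂ) ((P j i).eval w)) S.contour.image := fun i j =>
    (continuous_const.mul (Complex.continuous_conj.comp (P j i).continuous)).continuousOn
  choose Q hQ1 hQ2 using fun i j => (S.dilate c r hr.le).exists_polynomial_near
    ((spectrum_subset_numericalRange _).trans hAr) S.contour hdisj (hφ i j) hδ'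
  refine ⟨Matrix.of Q, fun z hz => ?_, ?_⟩
  · have h1 := norm_cauchyTransform_conjTranspose_le hε0 hε hP (hsub hz)
    have h2 : ‖polyEval (Matrix.of Q) z - S.cauchyTransform (fun w => (polyEval P w)ᴴ) z‖ ≤ δ := by
      refine (hC₁ _ _ hδ'.le fun i j => ?_).trans (hle C₁ (by linarith))
      rw [Matrix.sub_apply, cauchyTransform_conjTranspose_apply (hsub hz), norm_sub_rev]
      exact (hQ1 i j z hz).le
    calc _ = ‖S.cauchyTransform (fun w => (polyEval P w)ᴴ) z +
        (polyEval (Matrix.of Q) z - S.cauchyTransform (fun w => (polyEval P w)ᴴ) z)‖ := by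
          rw [add_sub_cancel]
      _ ≤ _ := (norm_add_le _ _).trans (add_le_add h1 h2)
  · refine (hC₂ _ _ hδ'.le fun x y => ?_).trans (hle C₂ (by linarith))
    rw [Matrix.sub_apply, cauchyTransformAeval_apply (hAr.trans hsub), polyAeval_apply]
    exact (hQ2 x.1 y.1 x.2 y.2).le

/-- The core of the argument: T T* T = T (T + G*)* T - T G T. The first term is at most 2‖T‖²; in
the second G is nearly Q of the dilated matrix, so T G T is nearly the value of P Q P, controlled by
K. -/
theorem norm_polyAeval_dilate_pow_le (hc : c ∈ S.inner 0) (hr : 0 < r) (hr1 : r < 1)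
    {ε : ℝ} (hε0 : 0 < ε) (hε : ∀ θ, ε ≤ S.radius θ)
    (hA : numericalRange A ⊆ S.inner 0) {K : ℝ} (hK : ∀ P : Matrix n n (Polynomial ℂ),
      (∀ z ∈ S.body, ‖polyEval P z‖ ≤ 1) → ‖polyAeval P A‖ ≤ K)
    {P : Matrix n n (Polynomial ℂ)} (hP : ∀ z ∈ S.body, ‖polyEval P z‖ ≤ 1) :
    ‖polyAeval P (A.dilate c r)‖ ^ 3 ≤ 2 * ‖polyAeval P (A.dilate c r)‖ ^ 2 + K := by
  set T := polyAeval P (A.dilate c r) with hT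
  set G := S.cauchyTransformAeval P (A.dilate c r) with hG
  have hsub := body_dilate_subset hc hr hr1
  have hAr := (numericalRange_dilate_subset (c := c) hr hA).trans hsub
  have key : ∀ δ > 0, ‖T‖ ^ 3 ≤ 2 * ‖T‖ ^ 2 + K + δ * (‖T‖ ^ 2 + K) := by
    intro δ hδ
    obtain ⟨Q, hQ1, hQ2⟩ := exists_polyAeval_near hc hr hr1 hε0 hε hA hP hδ
    have hδ1 : 0 < 1 + δ := by linarith
    have h1 : ‖polyAeval (P * Q * P) (A.dilate c r)‖ ≤ (1 + δ) * K := by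
      -- The constant K refers to A, not to the dilated matrix. Composing P Q P with the dilation
      -- moves the evaluation back to A, and the dilation maps the body of S into the smaller body
      -- on which Q is controlled.
      have h2 := hK (((1 + δ : ℝ) : ℂ)⁻¹ • polyDilate c r (P * Q * P)) fun z hz => by
        have hz' : c + r * (z - c) ∈ (S.dilate c r hr.le).body := fun θ => by
          rw [gap_dilate]; exact mul_nonneg hr.le (hz θ)
        have hz'' := S.inner_subset_body le_rfl (hsub hz')
        have h3 : ‖polyEval P (c + r * (z - c)) * polyEval Q (c + r * (z - c)) *
            polyEval P (c + r * (z - c))‖ ≤ 1 * (1 + δ) * 1 :=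
          (norm_mul_le _ _).trans (mul_le_mul ((norm_mul_le _ _).trans
            (mul_le_mul (hP _ hz'') (hQ1 _ hz') (norm_nonneg _) zero_le_one)) (hP _ hz'')
            (norm_nonneg _) (by positivity))
        rw [polyEval_smul, polyEval_polyDilate, polyEval_mul, polyEval_mul, norm_smul, norm_inv,
          Complex.norm_real, Real.norm_eq_abs, abs_of_pos hδ1, inv_mul_le_iff₀ hδ1]
        linarith
      rwa [polyAeval_smul, polyAeval_polyDilate, norm_smul, norm_inv,
          Complex.norm_real, Real.norm_eq_abs, abs_of_pos hδ1, inv_mul_le_iff₀ hδ1] at h2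
    rw [polyAeval_mul, polyAeval_mul, ← hT] at h1
    have h4 : T * Tᴴ * T = T * (T + Gᴴ)ᴴ * T - T * (G - polyAeval Q (A.dilate c r)) * T -
        T * polyAeval Q (A.dilate c r) * T := by
      rw [Matrix.conjTranspose_add, Matrix.conjTranspose_conjTranspose]
      noncomm_ring
    have h5 : ‖T * (T + Gᴴ)ᴴ * T‖ ≤ ‖T‖ * 2 * ‖T‖ := by
      refine (norm_mul_le _ _).trans (mul_le_mul_of_nonneg_right ((norm_mul_le _ _).trans
        (mul_le_mul_of_nonneg_left ?_ (norm_nonneg _))) (norm_nonneg _))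
      rw [Matrix.l2_opNorm_conjTranspose]
      exact norm_polyAeval_add_le hAr hP
    have h6 : ‖T * (G - polyAeval Q (A.dilate c r)) * T‖ ≤ ‖T‖ * δ * ‖T‖ :=
      (norm_mul_le _ _).trans (mul_le_mul_of_nonneg_right ((norm_mul_le _ _).trans
        (mul_le_mul_of_nonneg_left hQ2 (norm_nonneg _))) (norm_nonneg _))
    have h7 := Matrix.norm_pow_three_le T
    rw [h4] at h7
    have h8 := norm_sub_le (T * (T + Gᴴ)ᴴ * T - T * (G - polyAeval Q (A.dilate c r)) * T)
      (T * polyAeval Q (A.dilate c r) * T)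
    have h9 := norm_sub_le (T * (T + Gᴴ)ᴴ * T) (T * (G - polyAeval Q (A.dilate c r)) * T)
    nlinarith
  refine ge_of_tendsto (x := 𝓝[>] (0 : ℝ)) (b := ‖T‖ ^ 3)
    (f := fun δ => 2 * ‖T‖ ^ 2 + K + δ * (‖T‖ ^ 2 + K)) ?_
    (eventually_mem_nhdsWithin.mono fun δ hδ => key δ hδ)
  have : Tendsto (fun δ : ℝ => 2 * ‖T‖ ^ 2 + K + δ * (‖T‖ ^ 2 + K)) (𝓝 0)
      (𝓝 (2 * ‖T‖ ^ 2 + K + 0 * (‖T‖ ^ 2 + K))) := by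
    apply Continuous.tendsto; fun_prop
  rw [zero_mul, add_zero] at this
  exact this.mono_left nhdsWithin_le_nhds

end Dilate

/-- A crude bound from Cauchy's formula, needed so that the best constant exists as a finite
supremum. -/
theorem exists_norm_polyAeval_le (n : Type*) [Fintype n] [DecidableEq n]
    (hA : numericalRange A ⊆ S.inner 0) :
    ∃ K, ∀ P : Matrix n n (Polynomial ℂ),
      (∀ z ∈ S.body, ‖polyEval P z‖ ≤ 1) → ‖polyAeval P A‖ ≤ K := by
  obtain ⟨C, hC0, hC⟩ := Matrix.exists_l2_opNorm_le_of_entries (n × m) (n × m)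
  obtain ⟨B, hB⟩ := (isCompact_Icc (a := 0) (b := 2 * Real.pi)).exists_bound_of_continuousOn
    (continuous_resolventKernel hA).continuousOn
  have hB0 : 0 ≤ B := (norm_nonneg _).trans (hB 0 ⟨le_rfl, Real.two_pi_pos.le⟩)
  refine ⟨C * B, fun P hP => hC _ _ hB0 fun x y => ?_⟩
  have h1 := (encloses_spectrum hA).integral_eval_mul_resolvent (P x.1 y.1) x.2 y.2
  rw [contour_integral_resolvent, mul_comm (2 * Real.pi : ℂ), mul_assoc] at h1
  have h2 := mul_left_cancel₀ Complex.I_ne_zero h1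
  have h3 : ‖∫ θ in (0 : ℝ)..2 * Real.pi,
      (P x.1 y.1).eval (S.point θ) * S.resolventKernel A θ x.2 y.2‖ ≤ B * |2 * Real.pi - 0| := by
    refine intervalIntegral.norm_integral_le_of_norm_le_const fun θ hθ => ?_
    rw [Set.uIoc_of_le Real.two_pi_pos.le] at hθ
    rw [norm_mul]
    have h4 := (polyEval P (S.point θ)).norm_entry_le_l2_opNorm x.1 y.1
    have h5 := (S.resolventKernel A θ).norm_entry_le_l2_opNorm x.2 y.2
    calc _ ≤ 1 * B := mul_le_mul (h4.trans (hP _ (S.point_mem_body θ)))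
          (h5.trans (hB θ ⟨hθ.1.le, hθ.2⟩)) (norm_nonneg _) zero_le_one
      _ = B := one_mul B
  rw [h2, norm_mul, norm_mul, Complex.norm_real, Real.norm_eq_abs, abs_of_pos Real.pi_pos,
    sub_zero, abs_of_pos Real.two_pi_pos] at h3
  rw [polyAeval_apply]
  have hpi := Real.pi_pos
  simp only [Complex.norm_ofNat] at h3
  nlinarith

/-- **The Crouzeix–Palencia theorem** for matrix polynomials and smooth convex bodies. -/
theorem norm_polyAeval_le {ε : ℝ} (hε0 : 0 < ε) (hε : ∀ θ, ε ≤ S.radius θ) {c : ℂ}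
    (hc : c ∈ S.inner 0) (hA : numericalRange A ⊆ S.inner 0) {P : Matrix n n (Polynomial ℂ)}
    {M : ℝ} (hM : 0 < M) (hP : ∀ z ∈ S.body, ‖polyEval P z‖ ≤ M) :
    ‖polyAeval P A‖ ≤ (1 + √2) * M := by
  set s : Set ℝ := {t | ∃ P : Matrix n n (Polynomial ℂ),
    (∀ z ∈ S.body, ‖polyEval P z‖ ≤ 1) ∧ t = ‖polyAeval P A‖} with hs
  obtain ⟨K₀, hK₀⟩ := exists_norm_polyAeval_le n hA
  have hbdd : BddAbove s := ⟨K₀, by rintro _ ⟨P, hP, rfl⟩; exact hK₀ P hP⟩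
  have hne : s.Nonempty := ⟨_, 0, fun z _ => by
    have : polyEval (0 : Matrix n n (Polynomial ℂ)) z = 0 := by ext; simp [polyEval]
    rw [this, norm_zero]; exact zero_le_one, rfl⟩
  set K := sSup s with hKdef
  have hK : ∀ P : Matrix n n (Polynomial ℂ),
      (∀ z ∈ S.body, ‖polyEval P z‖ ≤ 1) → ‖polyAeval P A‖ ≤ K := fun P hP =>
    le_csSup hbdd ⟨P, hP, rfl⟩
  -- The inequality for dilated matrices passes to A by continuity as the ratio tends to 1 from
  -- below.
  have hsub : s ⊆ {t | t ^ 3 ≤ 2 * t ^ 2 + K} := by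
    rintro _ ⟨P, hP, rfl⟩
    have hcont : Continuous fun r : ℝ => ‖polyAeval P (A.dilate c r)‖ := by
      refine ((continuous_polyAeval P).comp ?_).norm
      unfold Matrix.dilate
      fun_prop
    have h1 : A.dilate c ((1 : ℝ) : ℂ) = A := by simp [Matrix.dilate]
    have hlim := (hcont.tendsto 1).mono_left (nhdsWithin_le_nhds (s := Set.Iio 1))
    simp only [h1] at hlim
    refine le_of_tendsto_of_tendsto (hlim.pow 3) (((hlim.pow 2).const_mul 2).add_const K) ?_
    filter_upwards [Ioo_mem_nhdsLT (zero_lt_one' ℝ)] with r hr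
    exact norm_polyAeval_dilate_pow_le hc hr.1 hr.2 hε0 hε hA hK hP
  have hclosed : IsClosed {t : ℝ | t ^ 3 ≤ 2 * t ^ 2 + K} :=
    isClosed_le (by fun_prop) (by fun_prop)
  -- With K held fixed on the right the condition is closed, so the supremum satisfies it too.
  have hKmem : K ^ 3 ≤ 2 * K ^ 2 + K :=
    closure_minimal hsub hclosed (csSup_mem_closure hne hbdd)
  -- 1 + √2 is the positive root of K² - 2K - 1.
  have hK1 : K ≤ 1 + √2 := by
    by_contra! hcon
    have h2 : √2 ^ 2 = 2 := Real.sq_sqrt zero_le_two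
    have h3 := Real.sqrt_nonneg 2
    have h4 : 0 < K ^ 2 - 2 * K - 1 := by nlinarith
    nlinarith
  have h5 := hK ((M : ℂ)⁻¹ • P) fun z hz => by
    rw [polyEval_smul, norm_smul, norm_inv, Complex.norm_real, Real.norm_eq_abs, abs_of_pos hM,
      inv_mul_le_iff₀ hM, mul_one]
    exact hP z hz
  rw [polyAeval_smul, norm_smul, norm_inv, Complex.norm_real, Real.norm_eq_abs, abs_of_pos hM,
    inv_mul_le_iff₀ hM] at h5
  nlinarith

end SupportFunction

end

/-! ### Compactness and convexity of the numerical range -/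

section

variable {m k : Type*} [Fintype m] [Fintype k] [DecidableEq m] [DecidableEq k]

theorem isCompact_numericalRange (A : Matrix m m ℂ) : IsCompact (numericalRange A) := by
  have h1 : numericalRange A = (fun v : EuclideanSpace ℂ m => star v.ofLp ⬝ᵥ (A *ᵥ v.ofLp)) ''
      Metric.sphere 0 1 := by
    ext z
    simp only [numericalRange, Set.mem_ofPred_eq, Set.mem_image, mem_sphere_zero_iff_norm]
    exact exists_congr fun v => and_congr_right fun _ => eq_comm
  rw [h1]
  refine (isCompact_sphere _ _).image ?_
  have h2 : Continuous fun v : EuclideanSpace ℂ m => v.ofLp := PiLp.continuous_ofLp 2 _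
  exact Continuous.dotProduct h2.star (Continuous.matrix_mulVec continuous_const h2)

theorem numericalRange_nonempty [Nonempty m] (A : Matrix m m ℂ) : (numericalRange A).Nonempty :=
  ⟨_, EuclideanSpace.single (Classical.arbitrary m) 1, by simp, rfl⟩

theorem norm_mulVec_of_conjTranspose_mul_self {U : Matrix m k ℂ} (hU : Uᴴ * U = 1) (v : k → ℂ) :
    ‖WithLp.toLp 2 (U *ᵥ v)‖ = ‖WithLp.toLp 2 v‖ := by
  have h1 := Matrix.dotProduct_self_eq_norm_sq (U *ᵥ v)
  rw [Matrix.star_mulVec, ← Matrix.dotProduct_mulVec, Matrix.mulVec_mulVec, hU, Matrix.one_mulVec,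
    Matrix.dotProduct_self_eq_norm_sq] at h1
  have h2 : ‖WithLp.toLp 2 v‖ ^ 2 = ‖WithLp.toLp 2 (U *ᵥ v)‖ ^ 2 := by exact_mod_cast h1
  exact ((sq_eq_sq₀ (norm_nonneg _) (norm_nonneg _)).1 h2).symm

theorem numericalRange_compression_subset (A : Matrix m m ℂ) {U : Matrix m k ℂ}
    (hU : Uᴴ * U = 1) : numericalRange (Uᴴ * A * U) ⊆ numericalRange A := by
  intro z hz
  obtain ⟨v, hv, rfl⟩ := mem_numericalRange_iff.1 hz
  refine mem_numericalRange_iff.2 ⟨U *ᵥ v, ?_, ?_⟩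
  · rw [norm_mulVec_of_conjTranspose_mul_self hU, hv]
  · rw [Matrix.star_mulVec, ← Matrix.dotProduct_mulVec, Matrix.mulVec_mulVec, Matrix.mulVec_mulVec,
      Matrix.mul_assoc]

/-- Along the path from u x to y, a suitable phase u makes the quadratic form real. The Rayleigh
quotient then moves continuously on the real line from 0 to 1, and the intermediate value theorem
applies. -/
theorem unitInterval_subset_numericalRange {A : Matrix m m ℂ} (h0 : (0 : ℂ) ∈ numericalRange A)
    (h1 : (1 : ℂ) ∈ numericalRange A) {s : ℝ} (hs : s ∈ Set.Icc (0 : ℝ) 1) :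
    (s : ℂ) ∈ numericalRange A := by
  obtain ⟨x, hx, hAx⟩ := mem_numericalRange_iff.1 h0
  obtain ⟨y, hy, hAy⟩ := mem_numericalRange_iff.1 h1
  set p := star x ⬝ᵥ (A *ᵥ y) with hp
  set q := star y ⬝ᵥ (A *ᵥ x) with hq
  obtain ⟨u, hu, hreal⟩ : ∃ u : ℂ, ‖u‖ = 1 ∧ (starRingEnd ℂ u * p + u * q).im = 0 := by
    -- The imaginary part of the cross terms equals that of u d, so the conjugate phase of d cancels
    -- it.
    set d := q - starRingEnd ℂ p with hd
    have him : ∀ u : ℂ, (starRingEnd ℂ u * p + u * q).im = (u * d).im := fun u => by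
      simp only [hd, Complex.add_im, Complex.mul_im, Complex.sub_im, Complex.sub_re,
        Complex.conj_re, Complex.conj_im]
      ring
    by_cases h : d = 0
    · exact ⟨1, norm_one, by rw [him, h]; simp⟩
    · refine ⟨starRingEnd ℂ d / ‖d‖, ?_, ?_⟩
      · rw [norm_div, RCLike.norm_conj, Complex.norm_real, norm_norm, div_self (norm_ne_zero_iff.2 h)]
      · rw [him, div_mul_eq_mul_div, mul_comm, Complex.mul_conj, ← Complex.ofReal_div,
          Complex.ofReal_im]
  have huu : starRingEnd ℂ u * u = 1 := by
    rw [mul_comm, Complex.mul_conj, Complex.normSq_eq_norm_sq, hu]; simp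
  set z : ℝ → m → ℂ := fun t => ((1 - t : ℝ) : ℂ) • u • x + (t : ℂ) • y with hz
  have hQ : ∀ t : ℝ, star (z t) ⬝ᵥ (A *ᵥ z t) =
      ((t ^ 2 + t * (1 - t) * (starRingEnd ℂ u * p + u * q).re : ℝ) : ℂ) := by
    intro t
    have hr : ((starRingEnd ℂ u * p + u * q).re : ℂ) = starRingEnd ℂ u * p + u * q :=
      Complex.ext (by simp) (by rw [hreal]; simp)
    push_cast
    rw [hr]
    simp only [hz, star_add, star_smul, Matrix.mulVec_add, Matrix.mulVec_smul, add_dotProduct,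
      dotProduct_add, smul_dotProduct, dotProduct_smul, ← hAx, ← hAy, ← hp, ← hq, smul_eq_mul,
      Complex.star_def, Complex.conj_ofReal]
    push_cast
    ring
  -- Comparing norms, the path can vanish only at t = 1/2; then y = -u x would have the same
  -- quadratic form value as x, contradicting 1 ≠ 0.
  have hz0 : ∀ t ∈ Set.Icc (0 : ℝ) 1, z t ≠ 0 := by
    intro t ht h
    have h2 : ((1 - t : ℝ) : ℂ) • u • x = -((t : ℂ) • y) := eq_neg_of_add_eq_zero_left h
    have h3 := congrArg (fun v => ‖WithLp.toLp 2 v‖) h2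
    simp only [WithLp.toLp_smul, WithLp.toLp_neg, norm_neg, norm_smul, hx, hy, hu,
      Complex.norm_real, Real.norm_eq_abs, mul_one, abs_of_nonneg ht.1,
      abs_of_nonneg (sub_nonneg.2 ht.2)] at h3
    have h4 := hQ t
    rw [h] at h4
    have ht2 : t = 1 / 2 := by linarith
    have h5 : (1 / 2 : ℂ) • (u • x + y) = 0 := by
      rw [smul_add, ← h, hz, ht2]; norm_num
    have h6 : y = -(u • x) := by
      rw [smul_eq_zero] at h5
      exact (neg_eq_of_add_eq_zero_right (h5.resolve_left (by norm_num))).symm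
    rw [h6, star_neg, Matrix.mulVec_neg, neg_dotProduct_neg, star_smul, Matrix.mulVec_smul,
      smul_dotProduct, dotProduct_smul, ← hAx] at hAy
    simp at hAy
  have hcz : Continuous z := by
    rw [hz]
    fun_prop
  have hcN : Continuous fun t => ‖WithLp.toLp 2 (z t)‖ ^ 2 :=
    ((PiLp.continuous_toLp 2 _).comp hcz).norm.pow 2
  have hN : ∀ t ∈ Set.Icc (0 : ℝ) 1, ‖WithLp.toLp 2 (z t)‖ ^ 2 ≠ 0 := fun t ht => by
    have : WithLp.toLp 2 (z t) ≠ 0 := fun h => hz0 t ht (by simpa using h)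
    positivity
  have hivt := intermediate_value_Icc (zero_le_one' ℝ) (f := fun t =>
    (t ^ 2 + t * (1 - t) * (starRingEnd ℂ u * p + u * q).re) / ‖WithLp.toLp 2 (z t)‖ ^ 2)
    (ContinuousOn.div (by fun_prop) hcN.continuousOn hN)
  have hz1 : z 1 = y := by simp [hz]
  have hs' : s ∈ Set.Icc
      (((0 : ℝ) ^ 2 + 0 * (1 - 0) * (starRingEnd ℂ u * p + u * q).re) / ‖WithLp.toLp 2 (z 0)‖ ^ 2)
      (((1 : ℝ) ^ 2 + 1 * (1 - 1) * (starRingEnd ℂ u * p + u * q).re) /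
        ‖WithLp.toLp 2 (z 1)‖ ^ 2) := by
    rw [hz1, hy]
    simpa using hs
  obtain ⟨t, ht, rfl⟩ := hivt hs'
  obtain ⟨w, hw, h7⟩ := exists_dotProduct_mulVec_eq A (hz0 t ht)
  rw [hQ] at h7
  have h8 : ((‖WithLp.toLp 2 (z t)‖ ^ 2 : ℝ) : ℂ) ≠ 0 := by exact_mod_cast hN t ht
  convert! hw
  rw [Complex.ofReal_div, h7, mul_div_cancel_left₀ _ h8]

/-- The **Toeplitz–Hausdorff theorem**. -/
theorem convex_numericalRange (A : Matrix m m ℂ) : Convex ℝ (numericalRange A) := by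
  rw [convex_iff_segment_subset]
  intro a ha b hb
  rw [segment_eq_image']
  rintro _ ⟨s, hs, rfl⟩
  by_cases hab : a = b
  · simpa [hab] using hb
  have hba : b - a ≠ 0 := sub_ne_zero.2 (Ne.symm hab)
  -- An affine change of A sends the given points of the numerical range to 0 and 1.
  set A' := (b - a)⁻¹ • (A - a • (1 : Matrix m m ℂ)) with hA'
  have key : ∀ v : m → ℂ, ‖WithLp.toLp 2 v‖ = 1 →
      star v ⬝ᵥ (A' *ᵥ v) = (b - a)⁻¹ * (star v ⬝ᵥ (A *ᵥ v) - a) := by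
    intro v hv
    rw [hA', Matrix.smul_mulVec, Matrix.sub_mulVec, Matrix.smul_mulVec, Matrix.one_mulVec,
      dotProduct_smul, dotProduct_sub, dotProduct_smul, Matrix.dotProduct_self_eq_norm_sq, hv]
    simp
  obtain ⟨x, hx, hAx⟩ := mem_numericalRange_iff.1 ha
  obtain ⟨y, hy, hAy⟩ := mem_numericalRange_iff.1 hb
  have h1 := unitInterval_subset_numericalRange (A := A')
    (mem_numericalRange_iff.2 ⟨x, hx, by rw [key x hx, ← hAx]; simp⟩)
    (mem_numericalRange_iff.2 ⟨y, hy, by rw [key y hy, ← hAy, inv_mul_cancel₀ hba]⟩) hs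
  obtain ⟨v, hv, hv'⟩ := mem_numericalRange_iff.1 h1
  refine mem_numericalRange_iff.2 ⟨v, hv, ?_⟩
  rw [key v hv] at hv'
  simp only [Complex.real_smul]
  rw [hv']
  field_simp
  ring

end

/-! ### Smoothing by moving averages -/

/-- The average of `k` over `[θ, θ + δ]`. -/
noncomputable def movingAverage (δ : ℝ) (k : ℝ → ℝ) (θ : ℝ) : ℝ :=
  δ⁻¹ * ∫ s in (0 : ℝ)..δ, k (θ + s)

section MovingAverage

variable {δ : ℝ} {k : ℝ → ℝ}

/-- A moving average is a difference of antiderivatives and gains one derivative; averaging twice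
reaches class C². -/
theorem hasDerivAt_movingAverage (hk : Continuous k) (θ : ℝ) :
    HasDerivAt (movingAverage δ k) (δ⁻¹ * (k (θ + δ) - k θ)) θ := by
  have h1 : movingAverage δ k = fun θ => δ⁻¹ * ((∫ x in (0 : ℝ)..θ + δ, k x) -
      ∫ x in (0 : ℝ)..θ, k x) := by
    ext θ
    rw [movingAverage, intervalIntegral.integral_comp_add_left,
      intervalIntegral.integral_interval_sub_left (hk.intervalIntegrable _ _)
      (hk.intervalIntegrable _ _), add_zero]
  rw [h1]
  have h2 := fun b => (hk.integral_hasStrictDerivAt 0 b).hasDerivAt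
  have h3 := (h2 (θ + δ)).comp_add_const θ δ
  exact (h3.sub (h2 θ)).const_mul _

theorem continuous_movingAverage (hk : Continuous k) : Continuous (movingAverage δ k) :=
  continuous_iff_continuousAt.2 fun θ => (hasDerivAt_movingAverage hk θ).continuousAt

theorem movingAverage_periodic {T : ℝ} (hk : Function.Periodic k T) :
    Function.Periodic (movingAverage δ k) T := fun θ => by
  simp only [movingAverage, add_right_comm θ T, hk _]

theorem abs_movingAverage_sub_le (hδ : 0 < δ) (hk : Continuous k) {a b η : ℝ}
    (h : ∀ s ∈ Set.Icc 0 δ, |k (a + s) - k (b + s)| ≤ η) :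
    |movingAverage δ k a - movingAverage δ k b| ≤ η := by
  have hi : ∀ c, IntervalIntegrable (fun s => k (c + s)) volume 0 δ := fun c =>
    (hk.comp (continuous_const.add continuous_id)).intervalIntegrable _ _
  rw [movingAverage, movingAverage, ← mul_sub, ← intervalIntegral.integral_sub (hi a) (hi b),
    abs_mul, abs_of_pos (inv_pos.2 hδ), inv_mul_le_iff₀ hδ]
  have := intervalIntegral.norm_integral_le_of_norm_le_const (a := 0) (b := δ) (C := η)
    (f := fun s => k (a + s) - k (b + s)) fun s hs => by
      rw [Set.uIoc_of_le hδ.le] at hs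
      exact h s ⟨hs.1.le, hs.2⟩
  rwa [sub_zero, abs_of_pos hδ, mul_comm] at this

theorem abs_movingAverage_sub_self_le (hδ : 0 < δ) (hk : Continuous k) {L : ℝ}
    (hL : ∀ a b, |k a - k b| ≤ L * |a - b|) (θ : ℝ) : |movingAverage δ k θ - k θ| ≤ L * δ := by
  have hi : IntervalIntegrable (fun s => k (θ + s)) volume 0 δ :=
    (hk.comp (continuous_const.add continuous_id)).intervalIntegrable _ _
  have hL0 : 0 ≤ L := by simpa using (abs_nonneg _).trans (hL 1 0)
  have h1 : k θ = δ⁻¹ * ∫ s in (0 : ℝ)..δ, k θ := by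
    rw [intervalIntegral.integral_const, sub_zero, smul_eq_mul, inv_mul_cancel_left₀ hδ.ne']
  rw [movingAverage]
  rw [h1]
  rw [← mul_sub, ← intervalIntegral.integral_sub hi (by simp),
    abs_mul, abs_of_pos (inv_pos.2 hδ), inv_mul_le_iff₀ hδ]
  have := intervalIntegral.norm_integral_le_of_norm_le_const (a := 0) (b := δ) (C := L * δ)
    (f := fun s => k (θ + s) - k θ) fun s hs => by
      rw [Set.uIoc_of_le hδ.le] at hs
      refine (hL _ _).trans (mul_le_mul_of_nonneg_left ?_ hL0)
      rw [add_sub_cancel_left, abs_of_pos hs.1]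
      exact hs.2
  rwa [sub_zero, abs_of_pos hδ, mul_comm] at this

/-- The finite-difference form of convexity for support functions is linear and translation
invariant, so averaging preserves it. -/
theorem two_cos_mul_movingAverage_le (hδ : 0 < δ) (hk : Continuous k)
    (h : ∀ θ a, 2 * Real.cos a * k θ ≤ k (θ + a) + k (θ - a)) (θ a : ℝ) :
    2 * Real.cos a * movingAverage δ k θ ≤
      movingAverage δ k (θ + a) + movingAverage δ k (θ - a) := by
  have hi : ∀ c, IntervalIntegrable (fun s => k (c + s)) volume 0 δ := fun c =>
    (hk.comp (continuous_const.add continuous_id)).intervalIntegrable _ _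
  simp only [movingAverage]
  rw [← mul_add, ← intervalIntegral.integral_add (hi _) (hi _), mul_left_comm,
    ← intervalIntegral.integral_const_mul]
  refine mul_le_mul_of_nonneg_left (intervalIntegral.integral_mono_on hδ.le ((hi _).const_mul _)
    ((hi _).add (hi _)) fun s _ => ?_) (inv_pos.2 hδ).le
  have := h (θ + s) a
  rwa [add_right_comm, add_sub_right_comm] at this

end MovingAverage

/-- As a function of a, the defect in the hypothesis is nonnegative, vanishes at 0 and has second
derivative 2(H + H'') there. -/
theorem add_deriv_deriv_nonneg {H H₁ H₂ : ℝ → ℝ} (h1 : ∀ θ, HasDerivAt H (H₁ θ) θ)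
    (h2 : ∀ θ, HasDerivAt H₁ (H₂ θ) θ)
    (h : ∀ θ a, 2 * Real.cos a * H θ ≤ H (θ + a) + H (θ - a)) (θ : ℝ) : 0 ≤ H θ + H₂ θ := by
  by_contra! hneg
  set g : ℝ → ℝ := fun a => H (θ + a) + H (θ - a) - 2 * Real.cos a * H θ with hg
  have hd : ∀ a, HasDerivAt g (H₁ (θ + a) + -H₁ (θ - a) - 2 * -Real.sin a * H θ) a := fun a =>
    (((h1 _).comp_const_add θ a).add ((h1 _).comp_const_sub θ a)).sub
      (((Real.hasDerivAt_cos a).const_mul 2).mul_const _)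
  have hd' : deriv g = fun a => H₁ (θ + a) + -H₁ (θ - a) - 2 * -Real.sin a * H θ :=
    funext fun a => (hd a).deriv
  have hdd : HasDerivAt (deriv g)
      (H₂ (θ + 0) + - -H₂ (θ - 0) - 2 * -Real.cos 0 * H θ) 0 := by
    rw [hd']
    exact (((h2 _).comp_const_add θ 0).add ((h2 _).comp_const_sub θ 0).neg).sub
      (((Real.hasDerivAt_sin 0).neg.const_mul 2).mul_const _)
  have hdd0 : deriv (deriv g) 0 = 2 * (H θ + H₂ θ) := by
    rw [hdd.deriv]; simp; ring
  -- A negative second derivative would make 0 a local maximum. A nonnegative function with maximal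
  -- value 0 vanishes nearby, and so does its second derivative.
  have hmax := isLocalMax_of_deriv_deriv_neg (f := g) (x₀ := 0) (by rw [hdd0]; linarith)
    (by rw [hd']; simp) (hd 0).continuousAt
  have hg0 : g 0 = 0 := by simp [hg]; ring
  have hzero : g =ᶠ[𝓝 0] fun _ => 0 := by
    filter_upwards [hmax] with a ha
    rw [hg0] at ha
    exact le_antisymm ha (sub_nonneg.2 (h θ a))
  have h3 := hzero.deriv.deriv_eq
  rw [hdd0] at h3
  simp at h3
  linarith

/-! ### Smooth convex neighbourhoods of a compact convex set -/

section SupportFunctionOfSet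

variable {W : Set ℂ}

/-- The support function of a compact set of complex numbers. -/
noncomputable def supportValue (W : Set ℂ) (θ : ℝ) : ℝ :=
  sSup ((fun w : ℂ => Real.cos θ * w.re + Real.sin θ * w.im) '' W)

theorem le_supportValue (hW : IsCompact W) {w : ℂ} (hw : w ∈ W) (θ : ℝ) :
    Real.cos θ * w.re + Real.sin θ * w.im ≤ supportValue W θ :=
  le_csSup (hW.image (by fun_prop)).bddAbove ⟨w, hw, rfl⟩

theorem exists_eq_supportValue (hW : IsCompact W) (hne : W.Nonempty) (θ : ℝ) :
    ∃ w ∈ W, Real.cos θ * w.re + Real.sin θ * w.im = supportValue W θ :=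
  (hW.image (by fun_prop)).sSup_mem (hne.image _)

theorem supportValue_periodic (W : Set ℂ) : Function.Periodic (supportValue W) (2 * Real.pi) :=
  fun θ => by simp only [supportValue, Real.cos_add_two_pi, Real.sin_add_two_pi]

/-- For a single point the relation is an equality; it is applied to a point that attains the
support value at θ. -/
theorem two_cos_mul_supportValue_le (hW : IsCompact W) (hne : W.Nonempty) (θ a : ℝ) :
    2 * Real.cos a * supportValue W θ ≤ supportValue W (θ + a) + supportValue W (θ - a) := by
  obtain ⟨w, hw, h⟩ := exists_eq_supportValue hW hne θ
  have h1 := le_supportValue hW hw (θ + a)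
  have h2 := le_supportValue hW hw (θ - a)
  rw [Real.cos_add, Real.sin_add] at h1
  rw [Real.cos_sub, Real.sin_sub] at h2
  rw [← h]
  linarith

theorem exists_abs_supportValue_sub_le (hW : IsCompact W) (hne : W.Nonempty) :
    ∃ L, ∀ a b, |supportValue W a - supportValue W b| ≤ L * |a - b| := by
  obtain ⟨B, hB⟩ := hW.isBounded.exists_norm_le
  have key : ∀ a b, supportValue W a - supportValue W b ≤ 2 * B * |a - b| := by
    intro a b
    obtain ⟨w, hw, h⟩ := exists_eq_supportValue hW hne a
    have h1 := le_supportValue hW hw b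
    have hBw := hB w hw
    have hcos : |Real.cos a - Real.cos b| ≤ |a - b| := by
      simpa [Real.dist_eq] using Real.lipschitzWith_cos.dist_le_mul a b
    have hsin : |Real.sin a - Real.sin b| ≤ |a - b| := by
      simpa [Real.dist_eq] using Real.lipschitzWith_sin.dist_le_mul a b
    have h2 : (Real.cos a - Real.cos b) * w.re ≤ |a - b| * B :=
      (le_abs_self _).trans (by
        rw [abs_mul]
        exact mul_le_mul hcos ((Complex.abs_re_le_norm w).trans hBw) (abs_nonneg _) (abs_nonneg _))
    have h3 : (Real.sin a - Real.sin b) * w.im ≤ |a - b| * B :=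
      (le_abs_self _).trans (by
        rw [abs_mul]
        exact mul_le_mul hsin ((Complex.abs_im_le_norm w).trans hBw) (abs_nonneg _) (abs_nonneg _))
    linarith
  refine ⟨2 * B, fun a b => abs_sub_le_iff.2 ⟨key a b, ?_⟩⟩
  rw [abs_sub_comm]
  exact key b a

/-- The hypothesis is tested in the direction from the nearest point of W to z; there the support
value of W is attained at that nearest point. -/
theorem exists_dist_le_of_supportValue (hW : IsCompact W) (hne : W.Nonempty) (hconv : Convex ℝ W)
    {z : ℂ} {η : ℝ} (hη : 0 ≤ η)
    (hz : ∀ θ, Real.cos θ * z.re + Real.sin θ * z.im ≤ supportValue W θ + η) :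
    ∃ w ∈ W, dist z w ≤ η := by
  obtain ⟨w, hw, hmin⟩ := exists_norm_eq_iInf_of_complete_convex hne hW.isComplete hconv z
  refine ⟨w, hw, ?_⟩
  rw [norm_eq_iInf_iff_real_inner_le_zero hconv hw] at hmin
  rw [dist_eq_norm]
  set d := ‖z - w‖ with hd
  rcases (norm_nonneg (z - w)).eq_or_lt with h0 | h0
  · rw [hd, ← h0]; exact hη
  set θ := (z - w).arg
  have hre : d * Real.cos θ = z.re - w.re := by
    rw [hd, Complex.norm_mul_cos_arg, Complex.sub_re]
  have him : d * Real.sin θ = z.im - w.im := by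
    rw [hd, Complex.norm_mul_sin_arg, Complex.sub_im]
  obtain ⟨w', hw', h'⟩ := exists_eq_supportValue hW hne θ
  have h1 := hmin w' hw'
  rw [Complex.inner] at h1
  simp only [Complex.mul_re, Complex.conj_re, Complex.conj_im, Complex.sub_re, Complex.sub_im] at h1
  rw [← hre, ← him] at h1
  have h2 : d * (Real.cos θ * (w'.re - w.re) + Real.sin θ * (w'.im - w.im)) ≤ 0 := by linarith
  have h3 : Real.cos θ * (w'.re - w.re) + Real.sin θ * (w'.im - w.im) ≤ 0 :=
    nonpos_of_mul_nonpos_right h2 h0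
  have h4 := hz θ
  have h5 : z.re = w.re + d * Real.cos θ := by linarith
  have h6 : z.im = w.im + d * Real.sin θ := by linarith
  rw [← h', h5, h6] at h4
  nlinarith [Real.sin_sq_add_cos_sq θ]

/-- A support function of class `C²` close to that of a given compact set. -/
theorem SupportFunction.exists_near (hW : IsCompact W) (hne : W.Nonempty) {η : ℝ} (hη : 0 < η) :
    ∃ S : SupportFunction, ∀ θ, |S.h θ - supportValue W θ| ≤ η := by
  obtain ⟨L, hL⟩ := exists_abs_supportValue_sub_le hW hne
  have hL0 : 0 ≤ L := by simpa using (abs_nonneg _).trans (hL 1 0)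
  have hc : Continuous (supportValue W) := by
    refine (LipschitzWith.of_dist_le_mul (K := ⟨L, hL0⟩) fun a b => ?_).continuous
    exact hL a b
  -- Each of the two averages moves the function by at most Lδ; the added 1 covers L = 0.
  set δ := η / (2 * (L + 1)) with hδ
  have hδ0 : 0 < δ := by positivity
  set k := movingAverage δ (supportValue W) with hk
  have hkc : Continuous k := continuous_movingAverage hc
  have hkL : ∀ a b, |k a - k b| ≤ L * |a - b| := fun a b =>
    abs_movingAverage_sub_le hδ0 hc fun s _ => (hL _ _).trans_eq (by rw [add_sub_add_right_eq_sub])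
  have hd1 : ∀ θ, HasDerivAt (movingAverage δ k) (δ⁻¹ * (k (θ + δ) - k θ)) θ :=
    hasDerivAt_movingAverage hkc
  have hd2 : ∀ θ, HasDerivAt (fun θ => δ⁻¹ * (k (θ + δ) - k θ))
      (δ⁻¹ * (δ⁻¹ * (supportValue W (θ + δ + δ) - supportValue W (θ + δ)) -
        δ⁻¹ * (supportValue W (θ + δ) - supportValue W θ))) θ := fun θ =>
    (((hasDerivAt_movingAverage hc (θ + δ)).comp_add_const θ δ).sub
      (hasDerivAt_movingAverage hc θ)).const_mul _
  refine ⟨⟨movingAverage δ k, _, _, hd1, hd2, by fun_prop,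
    movingAverage_periodic (movingAverage_periodic (supportValue_periodic W)), fun θ =>
    add_deriv_deriv_nonneg hd1 hd2 (two_cos_mul_movingAverage_le hδ0 hkc
      (two_cos_mul_movingAverage_le hδ0 hc (two_cos_mul_supportValue_le hW hne))) θ⟩, fun θ => ?_⟩
  have h1 := abs_movingAverage_sub_self_le hδ0 hkc hkL θ
  have h2 := abs_movingAverage_sub_self_le hδ0 hc hL θ
  have h3 := abs_sub_le (movingAverage δ k θ) (k θ) (supportValue W θ)
  have h4 : L * δ + L * δ ≤ η := by
    have : δ * (2 * (L + 1)) = η := div_mul_cancel₀ _ (by positivity)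
    nlinarith
  exact h3.trans ((add_le_add h1 h2).trans h4)

theorem SupportFunction.exists_between (hW : IsCompact W) (hne : W.Nonempty) (hconv : Convex ℝ W)
    {Ω : Set ℂ} (hΩ : IsOpen Ω) (hWΩ : W ⊆ Ω) :
    ∃ (S T : SupportFunction) (ε : ℝ), 0 < ε ∧ (∀ θ, ε ≤ S.radius θ) ∧ W ⊆ S.inner 0 ∧
      S.body ⊆ T.inner 0 ∧ T.body ⊆ Ω := by
  obtain ⟨d, hd, hdΩ⟩ := hW.exists_cthickening_subset_open hΩ hWΩ
  -- S and T enlarge the smooth approximation R by 2η and 3η. The approximation error η leaves W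
  -- strictly inside S, and T within 4η = d of W.
  set η := d / 4 with hη
  have hη0 : 0 < η := by positivity
  obtain ⟨R, hR⟩ := exists_near hW hne hη0
  have hR1 : ∀ θ, 0 ≤ 2 * η + R.radius θ := fun θ => by
    have := R.radius_nonneg θ
    positivity
  have hrad : ∀ θ, (R.parallel (2 * η) hR1).radius θ = 2 * η + R.radius θ := fun θ => by
    simp only [radius, parallel]; ring
  have hR2 : ∀ θ, 0 ≤ η + (R.parallel (2 * η) hR1).radius θ := fun θ => by
    rw [hrad]; linarith [hR1 θ]
  refine ⟨R.parallel (2 * η) hR1, (R.parallel (2 * η) hR1).parallel η hR2, 2 * η, by positivity,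
    fun θ => ?_, fun w hw θ => ?_, body_subset_inner_parallel _ hη0 _, fun z hz => ?_⟩
  · rw [hrad]; linarith [R.radius_nonneg θ]
  · rw [gap_parallel, gap]
    have h1 := le_supportValue hW hw θ
    have h2 := (abs_le.1 (hR θ)).1
    linarith
  · obtain ⟨w, hw, hdist⟩ := exists_dist_le_of_supportValue hW hne hconv (z := z) hd.le fun θ => by
      have h1 := hz θ
      rw [gap_parallel, gap_parallel, gap] at h1
      have h2 := (abs_le.1 (hR θ)).2
      linarith
    exact hdΩ (Metric.mem_cthickening_of_dist_le z w d W hw hdist)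

end SupportFunctionOfSet

/-! ### The Crouzeix–Palencia theorem for analytic functions -/

section

variable {m n : Type*} [Fintype m] [Fintype n] [DecidableEq m] [DecidableEq n]

theorem differentiableOn_mul_resolvent {A : Matrix m m ℂ} {Ω : Set ℂ} {g : ℂ → ℂ}
    (hg : DifferentiableOn ℂ g Ω) (i j : m) :
    DifferentiableOn ℂ (fun w => g w * (w • (1 : Matrix m m ℂ) - A)⁻¹ i j)
      (Ω \ spectrum ℂ A) :=
  (hg.mono Set.sdiff_subset).mul
    ((differentiableOn_resolvent_entry A i j).mono fun _ hw => hw.2)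

/-- Between W(A) and the open set where ‖F‖ < M + η two nested bodies are inserted. The Cauchy
integral over the outer boundary yields a matrix polynomial close to F on the inner body and close
to F(A) at A, to which the polynomial theorem applies. -/
theorem norm_integral_resolvent_le_add [Nonempty m] {A : Matrix m m ℂ} {Ω : Set ℂ}
    (hΩ : IsOpen Ω) (hA : numericalRange A ⊆ Ω) {Γ : Contour} (hΓ : Γ.Encloses Ω (spectrum ℂ A))
    {F : ℂ → Matrix n n ℂ} (hF : ∀ i j, DifferentiableOn ℂ (fun w => F w i j) Ω) {M : ℝ}
    (hM : ∀ z ∈ numericalRange A, ‖F z‖ ≤ M) {η : ℝ} (hη : 0 < η) :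
    ‖(Matrix.of fun r s => (2 * Real.pi * Complex.I)⁻¹ * Γ.integral fun w => F w r.1 s.1 *
      (w • (1 : Matrix m m ℂ) - A)⁻¹ r.2 s.2 : Matrix (n × m) (n × m) ℂ)‖ ≤
        (1 + √2) * (M + 2 * η) + η := by
  obtain ⟨x₀, hx₀⟩ := numericalRange_nonempty A
  have hM0 : 0 ≤ M := (norm_nonneg _).trans (hM _ hx₀)
  have hFc : ContinuousOn F Ω := continuousOn_pi.2 fun i => continuousOn_pi.2 fun j =>
    (hF i j).continuousOn
  obtain ⟨S, T, ε, hε0, hε, hWS, hST, hTΩ⟩ := SupportFunction.exists_between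
    (isCompact_numericalRange A) (numericalRange_nonempty A) (convex_numericalRange A)
    (hFc.norm.isOpen_inter_preimage hΩ (isOpen_Iio (a := M + η)))
    (fun z hz => ⟨hA hz, lt_of_le_of_lt (hM z hz) (lt_add_of_pos_right M hη)⟩)
  have hTΩ1 : T.body ⊆ Ω := hTΩ.trans Set.inter_subset_left
  have hspec := spectrum_subset_numericalRange A
  have hSbody := S.inner_subset_body le_rfl
  have hTenc : T.contour.Encloses Ω (spectrum ℂ A) :=
    T.contour_encloses hTΩ1 (hspec.trans (hWS.trans (hSbody.trans hST)))
  have hTS : Disjoint T.contour.image S.body := by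
    rw [Set.disjoint_left, SupportFunction.contour_image]
    rintro _ ⟨θ, rfl⟩ h
    exact T.point_notMem_inner θ (hST h)
  have hTimg : T.contour.image ⊆ Ω := T.contour_image_subset_body.trans hTΩ1
  obtain ⟨C₁, hC₁0, hC₁⟩ := Matrix.exists_l2_opNorm_le_of_entries n n
  obtain ⟨C₂, hC₂0, hC₂⟩ := Matrix.exists_l2_opNorm_le_of_entries (n × m) (n × m)
  have hδ : 0 < η / (C₁ + C₂ + 1) := by positivity
  have hle : ∀ C, C ≤ C₁ + C₂ → C * (η / (C₁ + C₂ + 1)) ≤ η := fun C h => by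
    rw [mul_div_assoc', div_le_iff₀ (by positivity)]
    nlinarith
  choose Q hQ1 hQ2 using fun i j => S.exists_polynomial_near (hspec.trans (hWS.trans hSbody))
    T.contour hTS (φ := fun w => (2 * Real.pi * Complex.I)⁻¹ * F w i j)
    (continuousOn_const.mul ((hF i j).continuousOn.mono hTimg)) hδ
  have hcauchy : ∀ z ∈ S.body, ∀ i j, T.contour.integral
      (fun w => (2 * Real.pi * Complex.I)⁻¹ * F w i j / (w - z)) = F z i j := by
    intro z hz i j
    simp only [mul_div_assoc, Contour.integral_const_mul]
    rw [T.contour.integral_div_sub hΩ hTimg (fun a ha => T.integral_inv_sub_of_notMem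
      fun h => ha (hTΩ1 h)) (hF i j) (hTΩ1 (T.inner_subset_body le_rfl (hST hz)))
      fun h => Set.disjoint_left.1 hTS h hz, T.integral_inv_sub_of_mem (hST hz),
      inv_mul_cancel_left₀ Complex.two_pi_I_ne_zero]
  have hQS : ∀ z ∈ S.body, ‖polyEval (Matrix.of Q) z‖ ≤ M + 2 * η := by
    intro z hz
    have h1 : ‖polyEval (Matrix.of Q) z - F z‖ ≤ η := by
      refine (hC₁ _ _ hδ.le fun i j => ?_).trans (hle C₁ (by linarith))
      rw [Matrix.sub_apply, norm_sub_rev, ← hcauchy z hz]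
      exact (hQ1 i j z hz).le
    have h2 : ‖F z‖ < M + η := (hTΩ (T.inner_subset_body le_rfl (hST hz))).2
    calc _ = ‖F z + (polyEval (Matrix.of Q) z - F z)‖ := by rw [add_sub_cancel]
      _ ≤ _ := (norm_add_le _ _).trans (by linarith)
  have hCP := SupportFunction.norm_polyAeval_le hε0 hε (hWS hx₀) hWS (by positivity) hQS
  set X : Matrix (n × m) (n × m) ℂ := Matrix.of fun r s => (2 * Real.pi * Complex.I)⁻¹ *
    Γ.integral fun w => F w r.1 s.1 * (w • (1 : Matrix m m ℂ) - A)⁻¹ r.2 s.2 with hX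
  have hXQ : ‖X - polyAeval (Matrix.of Q) A‖ ≤ η := by
    refine (hC₂ _ _ hδ.le fun r s => ?_).trans (hle C₂ (by linarith))
    have h1 := hQ2 r.1 s.1 r.2 s.2
    simp only [mul_assoc (2 * Real.pi * Complex.I)⁻¹, Contour.integral_const_mul] at h1
    rw [Contour.Encloses.integral_eq hΩ (spectrum.isClosed A) hTenc hΓ
      (differentiableOn_mul_resolvent (hF r.1 s.1) r.2 s.2)] at h1
    exact h1.le
  calc ‖X‖ = ‖polyAeval (Matrix.of Q) A + (X - polyAeval (Matrix.of Q) A)‖ := by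
        rw [add_sub_cancel]
    _ ≤ _ := (norm_add_le _ _).trans (add_le_add hCP hXQ)

/-- The **Crouzeix–Palencia theorem** for matrix-valued analytic functions. -/
theorem norm_integral_resolvent_le [Nonempty m] {A : Matrix m m ℂ} {Ω : Set ℂ}
    (hΩ : IsOpen Ω) (hA : numericalRange A ⊆ Ω) {Γ : Contour} (hΓ : Γ.Encloses Ω (spectrum ℂ A))
    {F : ℂ → Matrix n n ℂ} (hF : ∀ i j, DifferentiableOn ℂ (fun w => F w i j) Ω) {M : ℝ}
    (hM : ∀ z ∈ numericalRange A, ‖F z‖ ≤ M) :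
    ‖(Matrix.of fun r s => (2 * Real.pi * Complex.I)⁻¹ * Γ.integral fun w => F w r.1 s.1 *
      (w • (1 : Matrix m m ℂ) - A)⁻¹ r.2 s.2 : Matrix (n × m) (n × m) ℂ)‖ ≤ (1 + √2) * M := by
  have hlim : Tendsto (fun η : ℝ => (1 + √2) * (M + 2 * η) + η) (𝓝[>] 0)
      (𝓝 ((1 + √2) * (M + 2 * 0) + 0)) :=
    (Continuous.tendsto (by fun_prop) 0).mono_left nhdsWithin_le_nhds
  simp only [mul_zero, add_zero] at hlim
  exact ge_of_tendsto hlim (eventually_mem_nhdsWithin.mono fun η hη =>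
    norm_integral_resolvent_le_add hΩ hA hΓ hF hM hη)

/-- The **Crouzeix–Palencia theorem**. -/
theorem norm_integral_smul_resolvent_le [Nonempty m] {A : Matrix m m ℂ} {Ω : Set ℂ}
    (hΩ : IsOpen Ω) (hA : numericalRange A ⊆ Ω) {Γ : Contour} (hΓ : Γ.Encloses Ω (spectrum ℂ A))
    {g : ℂ → ℂ} (hg : DifferentiableOn ℂ g Ω) {M : ℝ} (hM : ∀ z ∈ numericalRange A, ‖g z‖ ≤ M) :
    ‖(Matrix.of fun i j => (2 * Real.pi * Complex.I)⁻¹ * Γ.integral fun w => g w *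
      (w • (1 : Matrix m m ℂ) - A)⁻¹ i j : Matrix m m ℂ)‖ ≤ (1 + √2) * M := by
  -- A scalar function is treated as a 1 × 1 matrix function.
  have h1 := norm_integral_resolvent_le hΩ hA hΓ (F := fun w => (g w) • (1 : Matrix Unit Unit ℂ))
    (fun i j => by simpa [Matrix.smul_apply] using hg) (M := M) fun z hz => by
      rw [norm_smul]
      exact (mul_le_of_le_one_right (norm_nonneg _) Matrix.l2_opNorm_one_le).trans (hM z hz)
  refine le_trans (Matrix.l2_opNorm_le_of_forall (norm_nonneg _) fun v => ?_) h1
  have h2 := Matrix.norm_toLp_mulVec_le (Matrix.of fun r s => (2 * Real.pi * Complex.I)⁻¹ *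
    Γ.integral fun w => ((g w) • (1 : Matrix Unit Unit ℂ)) r.1 s.1 *
      (w • (1 : Matrix m m ℂ) - A)⁻¹ r.2 s.2 : Matrix (Unit × m) (Unit × m) ℂ) fun r => v r.2
  have h3 : ∀ y : m → ℂ, ‖WithLp.toLp 2 fun r : Unit × m => y r.2‖ = ‖WithLp.toLp 2 y‖ := fun y =>
    (sq_eq_sq₀ (norm_nonneg _) (norm_nonneg _)).1 (by
      rw [EuclideanSpace.norm_sq_eq, EuclideanSpace.norm_sq_eq]
      simp [Fintype.sum_prod_type])
  rw [h3] at h2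
  rw [← h3]
  refine le_of_eq_of_le (congrArg norm (congrArg (WithLp.toLp 2) ?_)) h2
  ext r
  simp [Matrix.mulVec, dotProduct, Fintype.sum_prod_type]

end

/-! ### The bivariate matrix function -/

section

variable {m n k l : Type*} [Fintype m] [Fintype n] [DecidableEq m] [DecidableEq n]
  [Fintype k] [Fintype l] [DecidableEq k] [DecidableEq l]

/-- The matrix function `(2πi)⁻¹ ∮ f(x, y) (yI - B)⁻¹ dy` of the second variable. -/
noncomputable def partialMatrixFunction (Γ : Contour) (f : ℂ × ℂ → ℂ) (B : Matrix n n ℂ) (x : ℂ) :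
    Matrix n n ℂ :=
  Matrix.of fun i j => (2 * Real.pi * Complex.I)⁻¹ *
    Γ.integral fun y => f (x, y) * (y • (1 : Matrix n n ℂ) - B)⁻¹ i j

/-- The constant -1/(4π²) is the square of 1/(2πi), so the double integral is an iterated
one-variable calculus, first in B and then in A. -/
theorem bivariateMatrixFunction_eq (ΓA ΓB : Contour) (f : ℂ × ℂ → ℂ) (A : Matrix m m ℂ)
    (B : Matrix n n ℂ) : bivariateMatrixFunction ΓA ΓB f A B =
      Matrix.of fun r s => (2 * Real.pi * Complex.I)⁻¹ * ΓA.integral fun x =>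
        partialMatrixFunction ΓB f B x r.1 s.1 * (x • (1 : Matrix m m ℂ) - A)⁻¹ r.2 s.2 := by
  have h1 : -(1 / (4 * (Real.pi : ℂ) ^ 2)) =
      (2 * Real.pi * Complex.I)⁻¹ * (2 * Real.pi * Complex.I)⁻¹ := by
    rw [← mul_inv, mul_mul_mul_comm, Complex.I_mul_I, mul_neg_one, inv_neg, one_div]
    congr 2
    ring
  ext r s
  simp only [bivariateMatrixFunction, partialMatrixFunction, Matrix.of_apply,
    Matrix.kroneckerMap_apply]
  rw [h1, mul_assoc (2 * Real.pi * Complex.I)⁻¹, ← Contour.integral_const_mul]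
  congr 2
  ext x
  rw [mul_assoc (2 * Real.pi * Complex.I)⁻¹, ← Contour.integral_mul_const]
  simp only [mul_assoc]

variable {ΩA ΩB : Set ℂ} {ΓA ΓB : Contour} {A : Matrix m m ℂ} {B : Matrix n n ℂ} {f g : ℂ × ℂ → ℂ}

theorem continuousOn_mul_resolvent_snd (hΓB : ΓB.Encloses ΩB (spectrum ℂ B))
    (hf : ContinuousOn f (ΩA ×ˢ ΩB)) {x : ℂ} (hx : x ∈ ΩA) (i j : n) :
    ContinuousOn (fun y => f (x, y) * (y • (1 : Matrix n n ℂ) - B)⁻¹ i j) ΓB.image :=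
  (hf.comp (by fun_prop) fun _ hy => ⟨hx, hΓB.image_subset hy⟩).mul
    (continuousOn_resolvent_entry hΓB.disjoint i j)

theorem differentiableOn_partialMatrixFunction (hΩA : IsOpen ΩA)
    (hΓB : ΓB.Encloses ΩB (spectrum ℂ B)) (hf : DifferentiableOn ℂ f (ΩA ×ˢ ΩB)) (i j : n) :
    DifferentiableOn ℂ (fun x => partialMatrixFunction ΓB f B x i j) ΩA := by
  refine DifferentiableOn.const_mul (ΓB.differentiableOn_integral hΩA
    (fun x hx => continuousOn_mul_resolvent_snd hΓB hf.continuousOn hx i j)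
    (fun y hy => ?_) fun x₀ hx₀ => ?_) _
  · exact (hf.comp (t := ΩA ×ˢ ΩB) (f := fun x => (x, y)) (by fun_prop)
      fun x hx => ⟨hx, hΓB.image_subset hy⟩).mul_const _
  · obtain ⟨r, hr, hball⟩ := Metric.nhds_basis_closedBall.mem_iff.1 (hΩA.mem_nhds hx₀)
    obtain ⟨M₁, hM₁⟩ := ((isCompact_closedBall x₀ r).prod
      ΓB.isCompact_image).exists_bound_of_continuousOn
      (hf.continuousOn.mono (Set.prod_mono hball hΓB.image_subset))
    obtain ⟨M₂, hM₂⟩ := ΓB.isCompact_image.exists_bound_of_continuousOn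
      (continuousOn_resolvent_entry hΓB.disjoint i j)
    refine ⟨r, hr, M₁ * M₂, fun x hx y hy => ?_⟩
    have h1 := hM₁ (x, y) ⟨Metric.ball_subset_closedBall hx, hy⟩
    rw [norm_mul]
    exact mul_le_mul h1 (hM₂ y hy) (norm_nonneg _) ((norm_nonneg _).trans h1)

/-- The tensor product version of the Crouzeix–Palencia theorem. -/
theorem norm_bivariateMatrixFunction_le [Nonempty m] [Nonempty n] (hΩA : IsOpen ΩA)
    (hΩB : IsOpen ΩB) (hA : numericalRange A ⊆ ΩA) (hB : numericalRange B ⊆ ΩB)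
    (hΓA : ΓA.Encloses ΩA (spectrum ℂ A)) (hΓB : ΓB.Encloses ΩB (spectrum ℂ B))
    (hf : DifferentiableOn ℂ f (ΩA ×ˢ ΩB)) {M : ℝ}
    (hM : ∀ x ∈ numericalRange A, ∀ y ∈ numericalRange B, ‖f (x, y)‖ ≤ M) :
    ‖bivariateMatrixFunction ΓA ΓB f A B‖ ≤ (1 + √2) ^ 2 * M := by
  rw [bivariateMatrixFunction_eq, sq, mul_assoc (1 + √2)]
  -- The matrix-valued theorem in A gives one factor 1+√2; the scalar theorem in B, at each fixed x
  -- in the numerical range of A, gives the other.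
  refine norm_integral_resolvent_le hΩA hA hΓA
    (differentiableOn_partialMatrixFunction hΩA hΓB hf) fun x hx => ?_
  exact norm_integral_smul_resolvent_le hΩB hB hΓB (g := fun y => f (x, y))
    (hf.comp (t := ΩA ×ˢ ΩB) (f := fun y => (x, y)) (by fun_prop) fun y hy => ⟨hA hx, hy⟩)
    (hM x hx)

theorem bivariateMatrixFunction_sub (hΩA : IsOpen ΩA)
    (hΓA : ΓA.Encloses ΩA (spectrum ℂ A)) (hΓB : ΓB.Encloses ΩB (spectrum ℂ B))
    (hf : DifferentiableOn ℂ f (ΩA ×ˢ ΩB)) (hg : DifferentiableOn ℂ g (ΩA ×ˢ ΩB)) :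
    bivariateMatrixFunction ΓA ΓB (fun z => f z - g z) A B =
      bivariateMatrixFunction ΓA ΓB f A B - bivariateMatrixFunction ΓA ΓB g A B := by
  have h1 : ∀ x ∈ ΩA, ∀ i j, partialMatrixFunction ΓB (fun z => f z - g z) B x i j =
      partialMatrixFunction ΓB f B x i j - partialMatrixFunction ΓB g B x i j := by
    intro x hx i j
    simp only [partialMatrixFunction, Matrix.of_apply, sub_mul]
    rw [Contour.integral_sub _ (continuousOn_mul_resolvent_snd hΓB hf.continuousOn hx i j)
      (continuousOn_mul_resolvent_snd hΓB hg.continuousOn hx i j), mul_sub]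
  have h2 : ∀ {f : ℂ × ℂ → ℂ}, DifferentiableOn ℂ f (ΩA ×ˢ ΩB) → ∀ (i j : n) (i' j' : m),
      ContinuousOn (fun x => partialMatrixFunction ΓB f B x i j *
        (x • (1 : Matrix m m ℂ) - A)⁻¹ i' j') ΓA.image := fun hf i j i' j' =>
    ((differentiableOn_partialMatrixFunction hΩA hΓB hf i j).continuousOn.mono
      hΓA.image_subset).mul (continuousOn_resolvent_entry hΓA.disjoint i' j')
  ext r s
  simp only [bivariateMatrixFunction_eq, Matrix.sub_apply, Matrix.of_apply]
  rw [← mul_sub, ← Contour.integral_sub _ (h2 hf _ _ _ _) (h2 hg _ _ _ _)]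
  congr 1
  refine Contour.integral_congr _ fun x hx => ?_
  simp only [h1 x (hΓA.image_subset hx), sub_mul]

theorem eval_mvPolynomial_eq (p : MvPolynomial (Fin 2) ℂ) (z : ℂ × ℂ) :
    MvPolynomial.eval ![z.1, z.2] p = ∑ d ∈ p.support, p.coeff d * (z.1 ^ d 0 * z.2 ^ d 1) := by
  rw [MvPolynomial.eval_eq']
  simp [Fin.prod_univ_two]

theorem differentiable_eval_mvPolynomial (p : MvPolynomial (Fin 2) ℂ) :
    Differentiable ℂ fun z : ℂ × ℂ => MvPolynomial.eval ![z.1, z.2] p := by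
  simp only [eval_mvPolynomial_eq]
  fun_prop

theorem bivariateMatrixFunction_mvPolynomial (hΓA : ΓA.Encloses ΩA (spectrum ℂ A))
    (hΓB : ΓB.Encloses ΩB (spectrum ℂ B)) (p : MvPolynomial (Fin 2) ℂ) :
    bivariateMatrixFunction ΓA ΓB (fun z => MvPolynomial.eval ![z.1, z.2] p) A B =
      ∑ d ∈ p.support, p.coeff d • ((B ^ (d 1)) ⊗ₖ (A ^ (d 0))) := by
  have h1 : ∀ x i j, partialMatrixFunction ΓB (fun z => MvPolynomial.eval ![z.1, z.2] p) B x i j =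
      ∑ d ∈ p.support, p.coeff d * x ^ d 0 * (B ^ d 1) i j := by
    intro x i j
    have h2 : ∀ y, MvPolynomial.eval ![x, y] p * (y • (1 : Matrix n n ℂ) - B)⁻¹ i j =
        ∑ d ∈ p.support, (p.coeff d * x ^ d 0) *
          (y ^ d 1 * (y • (1 : Matrix n n ℂ) - B)⁻¹ i j) := fun y => by
      rw [eval_mvPolynomial_eq p (x, y), Finset.sum_mul]
      exact Finset.sum_congr rfl fun d _ => by ring
    simp only [partialMatrixFunction, Matrix.of_apply, h2]
    rw [Contour.integral_sum_const_mul _ _ _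
      (f := fun (d : Fin 2 →₀ ℕ) y => y ^ d 1 * (y • (1 : Matrix n n ℂ) - B)⁻¹ i j)
      fun d _ => (continuousOn_pow _).mul (continuousOn_resolvent_entry hΓB.disjoint i j),
      Finset.mul_sum]
    refine Finset.sum_congr rfl fun d _ => ?_
    rw [hΓB.integral_pow_mul_resolvent, mul_left_comm, inv_mul_cancel_left₀ Complex.two_pi_I_ne_zero]
  ext r s
  have h3 : ∀ x, (∑ d ∈ p.support, p.coeff d * x ^ d 0 * (B ^ d 1) r.1 s.1) *
      (x • (1 : Matrix m m ℂ) - A)⁻¹ r.2 s.2 = ∑ d ∈ p.support, (p.coeff d * (B ^ d 1) r.1 s.1) *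
        (x ^ d 0 * (x • (1 : Matrix m m ℂ) - A)⁻¹ r.2 s.2) := fun x => by
    rw [Finset.sum_mul]
    exact Finset.sum_congr rfl fun d _ => by ring
  simp only [bivariateMatrixFunction_eq, Matrix.of_apply, h1, h3]
  rw [Contour.integral_sum_const_mul _ _ _
    (f := fun (d : Fin 2 →₀ ℕ) x => x ^ d 0 * (x • (1 : Matrix m m ℂ) - A)⁻¹ r.2 s.2)
    fun d _ => (continuousOn_pow _).mul (continuousOn_resolvent_entry hΓA.disjoint r.2 s.2),
    Finset.mul_sum, Matrix.sum_apply]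
  refine Finset.sum_congr rfl fun d _ => ?_
  rw [hΓA.integral_pow_mul_resolvent, mul_left_comm, inv_mul_cancel_left₀ Complex.two_pi_I_ne_zero,
    Matrix.smul_apply, Matrix.kroneckerMap_apply, smul_eq_mul, mul_assoc]

/-- The starting vector is a pure tensor, so the Kronecker products act on its two factors
separately. -/
theorem kronecker_mulVec_mul (X : Matrix k m ℂ) (Y : Matrix l n ℂ) (u : m → ℂ) (v : n → ℂ) :
    (Y ⊗ₖ X) *ᵥ (fun q : n × m => u q.2 * v q.1) =
      fun q : l × k => (X *ᵥ u) q.2 * (Y *ᵥ v) q.1 := by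
  ext q
  simp only [Matrix.mulVec, dotProduct, Matrix.kroneckerMap_apply, Fintype.sum_prod_type,
    Finset.sum_mul_sum]
  rw [Finset.sum_comm]
  exact Finset.sum_congr rfl fun i _ => Finset.sum_congr rfl fun j _ => by ring

end

/-! ### Krylov spaces and the error of the Arnoldi approximation -/

section Krylov

variable {m : Type*} [Fintype m] [DecidableEq m] {k : ℕ} {U : Matrix m (Fin k) ℂ}
  {A : Matrix m m ℂ} {b : m → ℂ}

theorem IsKrylovBasis.mul_conjTranspose_mulVec (h : IsKrylovBasis U A b) {x : m → ℂ}
    (hx : x ∈ krylovSubspace k A b) : U *ᵥ (Uᴴ *ᵥ x) = x := by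
  rw [← h.2] at hx
  have h1 : x ∈ LinearMap.range U.mulVecLin := by
    rw [Matrix.range_mulVecLin]
    exact hx
  obtain ⟨v, rfl⟩ := h1
  rw [Matrix.mulVecLin_apply, Matrix.mulVec_mulVec v, h.1, Matrix.one_mulVec]

/-- For i < k the vector A^i b still lies in the Krylov space, where U U* is the identity; each
projection in the compressed power therefore changes nothing. -/
theorem IsKrylovBasis.pow_mulVec (h : IsKrylovBasis U A b) {i : ℕ} (hi : i < k) :
    U *ᵥ ((Uᴴ * A * U) ^ i *ᵥ (Uᴴ *ᵥ b)) = A ^ i *ᵥ b := by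
  induction i with
  | zero =>
    rw [pow_zero, pow_zero, Matrix.one_mulVec, Matrix.one_mulVec]
    exact h.mul_conjTranspose_mulVec (Submodule.subset_span ⟨⟨0, hi⟩, by simp⟩)
  | succ i ih =>
    have h1 := ih (Nat.lt_of_succ_lt hi)
    rw [pow_succ', ← Matrix.mulVec_mulVec, ← Matrix.mulVec_mulVec, h1, ← Matrix.mulVec_mulVec,
      Matrix.mulVec_mulVec b, ← pow_succ']
    exact h.mul_conjTranspose_mulVec (Submodule.subset_span ⟨⟨i + 1, hi⟩, rfl⟩)

theorem IsKrylovBasis.nonempty (h : IsKrylovBasis U A b) (hk : 1 ≤ k) : Nonempty m := by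
  by_contra hm
  rw [not_nonempty_iff] at hm
  have h1 := congrFun (congrFun h.1 ⟨0, hk⟩) ⟨0, hk⟩
  simp [Matrix.mul_apply] at h1

end Krylov

section

variable {m n : Type*} [Fintype m] [Fintype n] [DecidableEq m] [DecidableEq n] {k l : ℕ}
  {A : Matrix m m ℂ} {B : Matrix n n ℂ} {U : Matrix m (Fin k) ℂ} {V : Matrix n (Fin l) ℂ}
  {a : m → ℂ} {b : n → ℂ} {ΩA ΩB : Set ℂ} {ΓA ΓB ΔA ΔB : Contour}

/-- The bivariate Arnoldi approximation is exact for polynomials of low degree. -/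
theorem arnoldiApprox_mvPolynomial (hU : IsKrylovBasis U A a) (hV : IsKrylovBasis V B b)
    (hk : 1 ≤ k) (hl : 1 ≤ l)
    (hΓA : ΓA.Encloses ΩA (spectrum ℂ A)) (hΓB : ΓB.Encloses ΩB (spectrum ℂ B))
    (hΔA : ΔA.Encloses ΩA (spectrum ℂ (Uᴴ * A * U)))
    (hΔB : ΔB.Encloses ΩB (spectrum ℂ (Vᴴ * B * V))) {p : MvPolynomial (Fin 2) ℂ}
    (hp : p ∈ bivariatePolynomials (k - 1) (l - 1)) :
    arnoldiApprox ΔA ΔB (fun z => MvPolynomial.eval ![z.1, z.2] p) A B U V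
        (Matrix.vec (Matrix.vecMulVec a b)) =
      bivariateMatrixFunction ΓA ΓB (fun z => MvPolynomial.eval ![z.1, z.2] p) A B *ᵥ
        Matrix.vec (Matrix.vecMulVec a b) := by
  have hc : Matrix.vec (Matrix.vecMulVec a b) = fun q : n × m => a q.2 * b q.1 := by
    ext q
    simp [Matrix.vec, Matrix.vecMulVec_apply]
  rw [arnoldiApprox, bivariateMatrixFunction_mvPolynomial hΓA hΓB,
    bivariateMatrixFunction_mvPolynomial hΔA hΔB, Matrix.sum_mulVec, Matrix.sum_mulVec,
    Matrix.mulVec_sum, hc]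
  refine Finset.sum_congr rfl fun d hd => ?_
  -- Since k ≥ 1, the truncated difference k - 1 is a true predecessor, and the exponent stays below
  -- k.
  have hd0 : d 0 < k := by
    have := (MvPolynomial.monomial_le_degreeOf 0 hd).trans hp.1
    omega
  have hd1 : d 1 < l := by
    have := (MvPolynomial.monomial_le_degreeOf 1 hd).trans hp.2
    omega
  rw [Matrix.smul_mulVec, Matrix.smul_mulVec, Matrix.mulVec_smul, Matrix.conjTranspose_kronecker,
    kronecker_mulVec_mul, kronecker_mulVec_mul, kronecker_mulVec_mul, kronecker_mulVec_mul,
    hU.pow_mulVec hd0, hV.pow_mulVec hd1]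

/-- Compactness makes the family bounded; a real supremum of an unbounded family would take the
default value 0. -/
theorem norm_le_supNormOn {S : Set (ℂ × ℂ)} (hS : IsCompact S) {g : ℂ × ℂ → ℂ}
    (hg : ContinuousOn g S) {z : ℂ × ℂ} (hz : z ∈ S) : ‖g z‖ ≤ supNormOn S g := by
  obtain ⟨M, hM⟩ := hS.exists_bound_of_continuousOn hg
  exact le_ciSup (f := fun z : S => ‖g z‖)
    ⟨M, Set.forall_mem_range.2 fun z => hM z z.2⟩ ⟨z, hz⟩

theorem euclideanNorm_mulVec_le (M : Matrix m n ℂ) (v : n → ℂ) :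
    euclideanNorm (M *ᵥ v) ≤ ‖M‖ * euclideanNorm v :=
  M.norm_toLp_mulVec_le v

theorem euclideanNorm_sub_le (u v : m → ℂ) :
    euclideanNorm (u - v) ≤ euclideanNorm u + euclideanNorm v :=
  norm_sub_le (WithLp.toLp 2 u) (WithLp.toLp 2 v)

theorem norm_kronecker_le_one (hU : Uᴴ * U = 1) (hV : Vᴴ * V = 1) : ‖V ⊗ₖ U‖ ≤ 1 := by
  refine Matrix.l2_opNorm_le_of_forall zero_le_one fun v => ?_
  rw [one_mul, norm_mulVec_of_conjTranspose_mul_self]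
  rw [Matrix.conjTranspose_kronecker, ← Matrix.mul_kronecker_mul, hU, hV, Matrix.one_kronecker_one]

theorem euclideanNorm_sub_arnoldiApprox_le {f : ℂ × ℂ → ℂ} (hΩA : IsOpen ΩA) (hΩB : IsOpen ΩB)
    (hA : numericalRange A ⊆ ΩA) (hB : numericalRange B ⊆ ΩB)
    (hf : DifferentiableOn ℂ f (ΩA ×ˢ ΩB)) (hk : 1 ≤ k) (hl : 1 ≤ l)
    (hU : IsKrylovBasis U A a) (hV : IsKrylovBasis V B b)
    (hΓA : ΓA.Encloses ΩA (spectrum ℂ A)) (hΓB : ΓB.Encloses ΩB (spectrum ℂ B))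
    (hΔA : ΔA.Encloses ΩA (spectrum ℂ (Uᴴ * A * U)))
    (hΔB : ΔB.Encloses ΩB (spectrum ℂ (Vᴴ * B * V))) {p : MvPolynomial (Fin 2) ℂ}
    (hp : p ∈ bivariatePolynomials (k - 1) (l - 1)) {c : n × m → ℂ}
    (hc : c = Matrix.vec (Matrix.vecMulVec a b)) :
    euclideanNorm (bivariateMatrixFunction ΓA ΓB f A B *ᵥ c - arnoldiApprox ΔA ΔB f A B U V c) ≤
      2 * (1 + √2) ^ 2 * euclideanNorm c *
        supNormOn (numericalRange A ×ˢ numericalRange B)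
          (fun z => f z - MvPolynomial.eval ![z.1, z.2] p) := by
  have := hU.nonempty hk
  have := hV.nonempty hl
  have : Nonempty (Fin k) := ⟨⟨0, hk⟩⟩
  have : Nonempty (Fin l) := ⟨⟨0, hl⟩⟩
  set P : ℂ × ℂ → ℂ := fun z => MvPolynomial.eval ![z.1, z.2] p with hP
  have hPd : DifferentiableOn ℂ P (ΩA ×ˢ ΩB) := (differentiable_eval_mvPolynomial p).differentiableOn
  have hd : DifferentiableOn ℂ (fun z => f z - P z) (ΩA ×ˢ ΩB) := hf.sub hPd
  set M := supNormOn (numericalRange A ×ˢ numericalRange B) fun z => f z - P z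
  have hM : ∀ x ∈ numericalRange A, ∀ y ∈ numericalRange B, ‖f (x, y) - P (x, y)‖ ≤ M :=
    fun x hx y hy => norm_le_supNormOn
      ((isCompact_numericalRange A).prod (isCompact_numericalRange B))
      (hd.continuousOn.mono (Set.prod_mono hA hB)) (z := (x, y)) ⟨hx, hy⟩
  have hAU := numericalRange_compression_subset A hU.1
  have hBV := numericalRange_compression_subset B hV.1
  have h1 := norm_bivariateMatrixFunction_le hΩA hΩB hA hB hΓA hΓB hd hM
  have h2 := norm_bivariateMatrixFunction_le hΩA hΩB (hAU.trans hA) (hBV.trans hB) hΔA hΔB hd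
    fun x hx y hy => hM x (hAU hx) y (hBV hy)
  have h3 := arnoldiApprox_mvPolynomial hU hV hk hl hΓA hΓB hΔA hΔB hp
  rw [← hc, ← hP] at h3
  -- Both terms are linear in f and agree on p, so f may be replaced by f - p.
  have h4 : bivariateMatrixFunction ΓA ΓB f A B *ᵥ c - arnoldiApprox ΔA ΔB f A B U V c =
      bivariateMatrixFunction ΓA ΓB (fun z => f z - P z) A B *ᵥ c -
        arnoldiApprox ΔA ΔB (fun z => f z - P z) A B U V c := by
    rw [arnoldiApprox] at h3
    rw [arnoldiApprox, arnoldiApprox, bivariateMatrixFunction_sub hΩA hΓA hΓB hf hPd,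
      bivariateMatrixFunction_sub hΩA hΔA hΔB hf hPd, Matrix.sub_mulVec, Matrix.sub_mulVec,
      Matrix.mulVec_sub, h3]
    abel
  have hc0 : 0 ≤ euclideanNorm c := norm_nonneg _
  have hW := norm_kronecker_le_one hU.1 hV.1
  have hW' : ‖(V ⊗ₖ U)ᴴ‖ ≤ 1 := by rwa [Matrix.l2_opNorm_conjTranspose]
  have h5 : euclideanNorm (bivariateMatrixFunction ΓA ΓB (fun z => f z - P z) A B *ᵥ c) ≤
      (1 + √2) ^ 2 * M * euclideanNorm c :=
    (euclideanNorm_mulVec_le _ _).trans (mul_le_mul_of_nonneg_right h1 hc0)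
  have h6 : euclideanNorm ((V ⊗ₖ U)ᴴ *ᵥ c) ≤ euclideanNorm c :=
    (euclideanNorm_mulVec_le _ _).trans (mul_le_of_le_one_left hc0 hW')
  have h7 : euclideanNorm (arnoldiApprox ΔA ΔB (fun z => f z - P z) A B U V c) ≤
      (1 + √2) ^ 2 * M * euclideanNorm c :=
    (euclideanNorm_mulVec_le _ _).trans ((mul_le_of_le_one_left (norm_nonneg _) hW).trans
      ((euclideanNorm_mulVec_le _ _).trans (mul_le_mul h2 h6 (norm_nonneg _)
        ((norm_nonneg _).trans h2))))
  rw [h4]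
  refine (euclideanNorm_sub_le _ _).trans ((add_le_add h5 h7).trans_eq (by ring))

end

end

theorem corollary6p1 (m n : ℕ)
    (A : Matrix (Fin m) (Fin m) ℂ) (B : Matrix (Fin n) (Fin n) ℂ)
    (cA : Fin m → ℂ) (cB : Fin n → ℂ)
    (ΩA ΩB : Set ℂ) (hΩA : IsOpen ΩA) (hΩB : IsOpen ΩB)
    (hA : numericalRange A ⊆ ΩA) (hB : numericalRange B ⊆ ΩB)
    (f : ℂ × ℂ → ℂ) (hf : AnalyticOnNhd ℂ f (ΩA ×ˢ ΩB))
    (k l : ℕ) (hk : 1 ≤ k) (hl : 1 ≤ l)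
    (U : Matrix (Fin m) (Fin k) ℂ) (V : Matrix (Fin n) (Fin l) ℂ)
    (hU : IsKrylovBasis U A cA) (hV : IsKrylovBasis V B cB)
    (c : Fin n × Fin m → ℂ) (hc : c = Matrix.vec (Matrix.vecMulVec cA cB))
    -- contours that define `f{A,B}`
    (ΓA ΓB : Contour)
    (hΓA : ΓA.Encloses ΩA (spectrum ℂ A)) (hΓB : ΓB.Encloses ΩB (spectrum ℂ B))
    -- contours that define `f{U^* A U, V^* B V}`
    (ΔA ΔB : Contour)
    (hΔA : ΔA.Encloses ΩA (spectrum ℂ (Uᴴ * A * U)))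
    (hΔB : ΔB.Encloses ΩB (spectrum ℂ (Vᴴ * B * V))) :
    euclideanNorm (bivariateMatrixFunction ΓA ΓB f A B *ᵥ c - arnoldiApprox ΔA ΔB f A B U V c) ≤
      2 * (1 + √2) ^ 2 * euclideanNorm c *
        ⨅ p : bivariatePolynomials (k - 1) (l - 1),
          supNormOn (numericalRange A ×ˢ numericalRange B)
            (fun z => f z - MvPolynomial.eval ![z.1, z.2] p.1) := by
  have hc0 : 0 ≤ euclideanNorm c := norm_nonneg (WithLp.toLp 2 c)
  -- The zero polynomial keeps the index type of the infimum nonempty, as `le_ciInf` requires.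
  have hne : Nonempty (bivariatePolynomials (k - 1) (l - 1)) :=
    ⟨⟨0, by simp [bivariatePolynomials]⟩⟩
  rw [Real.mul_iInf_of_nonneg (by positivity)]
  exact le_ciInf fun p => euclideanNorm_sub_arnoldiApprox_le hΩA hΩB hA hB hf.differentiableOn hk hl
    hU hV hΓA hΓB hΔA hΔB p.2 hc
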